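/- Let $Z$ be a (finite dimensional, Hausdorff) complex manifold, let $M\subset Z$ be a real-analytic submanifold that is generically embedded, i.e. $T_pZ=T_pM+iT_pM$ for all $p\in M$, and let $a\in M$. Let $\mathfrak{hol}(Z,a)$ be the complex Lie algebra of germs at $a$ of holomorphic vector fields on $Z$, let $\mathfrak{hol}(M,a)\subset\mathfrak{hol}(Z,a)$ be the real subalgebra of those germs that are tangent to $M$ (the germs at $a$ of real-analytic infinitesimal CR-transformations of $M$), and let $\mathrm{Aut}(M,a)$ be the group of germs of (bianalytic) CR-automorphisms of $(M,a)$. A tube realization of $(M,a)$ is a CR-isomorphism of germs $\varphi:(M,a)\to(T,c)$, where $E=V\oplus iV$ is the complexification of a finite dimensional real vector space $V$, $T=V+iF\subset E$ for a connected, locally closed real-analytic submanifold $F\subset V$, and $c\in T$. Two tube realizations $\varphi:(M,a)\to(T,c)$ and $\varphi':(M,a)\to(T',c')$ with $T\subset E$, $T'\subset E'$ are affinely equivalent if some complex affine isomorphism $\lambda:E\to E'$ maps the germ $(T,c)$ onto the germ $(T',c')$. Subsets $\mathfrak v,\mathfrak v'\subset\mathfrak{hol}(M,a)$ are conjugate under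 $\mathrm{Aut}(M,a)$ if $\mathfrak v'=g_*(\mathfrak v)$ for some $g\in\mathrm{Aut}(M,a)$. Call an abelian real Lie subalgebra $\mathfrak v\subset\mathfrak{hol}(M,a)$ admissible if (i) $\mathfrak v$ is totally real in $\mathfrak{hol}(Z,a)$, i.e. $\mathfrak v\cap i\mathfrak v=0$, and (ii) $\mathfrak e:=\mathfrak v\oplus i\mathfrak v$ spans the full tangent space $T_aZ$, i.e. $\{\xi_a:\xi\in\mathfrak e\}=T_aZ$. Then affine equivalence and conjugacy are equivalence relations, and the following hold. For every tube realization $\varphi:(M,a)\to(T,c)$ the pull backs to $M$ of the constant vector fields $v\,\partial/\partial z$, $v\in V$, form a unique admissible subalgebra $\{\varphi^*(v\,\partial/\partial z):v\in V\}$, and assigning it to $\varphi$ induces a well-defined bijection from the set of affine equivalence classes of tube realizations of $(M,a)$ onto the set of $\mathrm{Aut}(M,a)$-conjugacy classes of admissible subalgebras $\mathfrak v\subset\mathfrak{hol}(M,a)$. Conversely, for every admissible $\mathfrak v$ the map $\psi(\xi):=\exp(\xi)(a)$ is a biholomorphic map from an open neighbourhood of $0$ in the complex vector space $E:=\mathfrak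 e$ onto an open neighbourhood of $a$ in $Z$ on which all germs in $\mathfrak e$ have holomorphic representatives, where $\exp(\xi)(a)$ is the value at time $1$ of the integral curve of $\xi$ starting at $a$; and $\varphi:=\psi^{-1}$ restricts to a tube realization $(M,a)\to(T,0)$, $T=V+iF\subset E$ with $V:=\mathfrak v$, such that $\mathfrak v=\{\varphi^*(v\,\partial/\partial z):v\in V\}$. -/

import Mathlib

open scoped Manifold ContDiff Topology
open Set Filter

universe u v w u' v'

set_option linter.unusedSectionVars false

noncomputable section

namespace CRTube

/-! ### The complex Lie algebra of germs of holomorphic vector fields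

Complex manifolds are modelled on a finite dimensional complex normed space `E`. -/

section Germs

variable (E : Type v) [NormedAddCommGroup E] [NormedSpace ℂ E] [FiniteDimensional ℂ E]
  {Z : Type u} [TopologicalSpace Z] [ChartedSpace E Z] [IsManifold 𝓘(ℂ, E) ω Z]

/-- Vector fields on `Z` that are holomorphic in some neighbourhood of `a`. -/
def holAt (a : Z) : Submodule ℂ (Π p : Z, TangentSpace 𝓘(ℂ, E) p) where
  carrier := {X | ∀ᶠ p in 𝓝 a, ContMDiffAt 𝓘(ℂ, E) 𝓘(ℂ, E).tangent ω (T% X) p}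
  add_mem' {X Y} hX hY := by
    filter_upwards [hX, hY] with p h1 h2 using h1.add_section h2
  zero_mem' := Eventually.of_forall fun p => (Bundle.contMDiff_zeroSection ℂ _).contMDiffAt
  smul_mem' c X hX := by
    filter_upwards [hX] with p h1 using h1.const_smul_section

/-- The fields vanishing identically near `a`. -/
def vanishAt (a : Z) : Submodule ℂ (holAt E a) where
  carrier := {X | ∀ᶠ p in 𝓝 a, X.1 p = 0}
  add_mem' {X Y} hX hY := by
    filter_upwards [hX, hY] with p h1 h2
    simp [h1, h2]
  zero_mem' := Eventually.of_forall fun p => rfl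
  smul_mem' c X hX := by
    filter_upwards [hX] with p h1
    simp [h1]

/-- `𝔥𝔬𝔩(Z,a)`: germs at `a` of holomorphic vector fields on `Z`. -/
def HolGerm (a : Z) : Type (max u v) := holAt E a ⧸ vanishAt E a

variable {E}

instance (a : Z) : AddCommGroup (HolGerm E a) :=
  inferInstanceAs (AddCommGroup (holAt E a ⧸ vanishAt E a))

instance (a : Z) : Module ℂ (HolGerm E a) :=
  inferInstanceAs (Module ℂ (holAt E a ⧸ vanishAt E a))

/-- The germ of a field that is holomorphic near `a`. -/
def germ (a : Z) : holAt E a →ₗ[ℂ] HolGerm E a := (vanishAt E a).mkQ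

/-- A vector field representing a germ. -/
def HolGerm.rep {a : Z} (ξ : HolGerm E a) : Π p : Z, TangentSpace 𝓘(ℂ, E) p :=
  (Submodule.Quotient.mk_surjective (vanishAt E a) ξ).choose.1

theorem HolGerm.rep_mem {a : Z} (ξ : HolGerm E a) : ξ.rep ∈ holAt E a :=
  (Submodule.Quotient.mk_surjective (vanishAt E a) ξ).choose.2

theorem HolGerm.germ_rep {a : Z} (ξ : HolGerm E a) : germ a ⟨ξ.rep, ξ.rep_mem⟩ = ξ :=
  (Submodule.Quotient.mk_surjective (vanishAt E a) ξ).choose_spec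

theorem germ_eq_iff {a : Z} (X Y : holAt E a) : germ a X = germ a Y ↔ X.1 =ᶠ[𝓝 a] Y.1 := by
  refine (Submodule.Quotient.eq (vanishAt E a)).trans ?_
  refine eventually_congr (Eventually.of_forall fun p => ?_)
  exact sub_eq_zero

theorem rep_germ {a : Z} (X : holAt E a) : (germ a X).rep =ᶠ[𝓝 a] X.1 :=
  (germ_eq_iff ⟨_, HolGerm.rep_mem _⟩ X).1 (HolGerm.germ_rep _)

theorem HolGerm.ext_rep {a : Z} {ξ η : HolGerm E a} (h : ξ.rep =ᶠ[𝓝 a] η.rep) : ξ = η := by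
  rw [← ξ.germ_rep, ← η.germ_rep]
  exact (germ_eq_iff _ _).2 h

theorem HolGerm.rep_add {a : Z} (ξ η : HolGerm E a) :
    (ξ + η).rep =ᶠ[𝓝 a] ξ.rep + η.rep := by
  have := rep_germ (E := E) (⟨ξ.rep, ξ.rep_mem⟩ + ⟨η.rep, η.rep_mem⟩ : holAt E a)
  rwa [map_add, germ_rep, germ_rep] at this

theorem HolGerm.rep_smul {a : Z} (c : ℂ) (ξ : HolGerm E a) :
    (c • ξ).rep =ᶠ[𝓝 a] c • ξ.rep := by
  have := rep_germ (E := E) (c • ⟨ξ.rep, ξ.rep_mem⟩ : holAt E a)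
  rwa [map_smul, germ_rep] at this

theorem HolGerm.rep_zero {a : Z} : (0 : HolGerm E a).rep =ᶠ[𝓝 a] 0 := by
  have := rep_germ (E := E) (0 : holAt E a)
  rwa [map_zero] at this

theorem mlieBracket_mem_holAt {a : Z} {X Y : Π p : Z, TangentSpace 𝓘(ℂ, E) p}
    (hX : X ∈ holAt E a) (hY : Y ∈ holAt E a) :
    VectorField.mlieBracket 𝓘(ℂ, E) X Y ∈ holAt E a := by
  have : CompleteSpace E := FiniteDimensional.complete ℂ E
  have : IsManifold 𝓘(ℂ, E) (minSmoothness ℂ 2) Z := IsManifold.of_le (n := ω) le_top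
  have : IsManifold 𝓘(ℂ, E) (ω + 1) Z := IsManifold.of_le (n := ω) le_top
  filter_upwards [hX, hY] with p h1 h2
  have := ContMDiffWithinAt.mlieBracketWithin_vectorField (m := ω) (n := ω)
    h1.contMDiffWithinAt h2.contMDiffWithinAt uniqueMDiffOn_univ (mem_univ p) le_top
  simpa [contMDiffWithinAt_univ, VectorField.mlieBracketWithin_univ] using this

instance (a : Z) : Bracket (HolGerm E a) (HolGerm E a) where
  bracket ξ η := germ a ⟨VectorField.mlieBracket 𝓘(ℂ, E) ξ.rep η.rep,
    mlieBracket_mem_holAt ξ.rep_mem η.rep_mem⟩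

theorem HolGerm.rep_bracket {a : Z} (ξ η : HolGerm E a) :
    ⁅ξ, η⁆.rep =ᶠ[𝓝 a] VectorField.mlieBracket 𝓘(ℂ, E) ξ.rep η.rep :=
  rep_germ _

theorem mdiffAt_of_mem {a : Z} {X : Π p : Z, TangentSpace 𝓘(ℂ, E) p} (hX : X ∈ holAt E a) :
    ∀ᶠ p in 𝓝 a, MDifferentiableAt 𝓘(ℂ, E) 𝓘(ℂ, E).tangent (T% X) p := by
  filter_upwards [hX] with p h using h.mdifferentiableAt (by simp)

instance (a : Z) : LieRing (HolGerm E a) where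
  add_lie ξ η ζ := by
    have : CompleteSpace E := FiniteDimensional.complete ℂ E
    have : IsManifold 𝓘(ℂ, E) 2 Z := IsManifold.of_le (n := ω) le_top
    refine HolGerm.ext_rep ?_
    filter_upwards [(⁅ξ, ζ⁆).rep_add ⁅η, ζ⁆, ξ.rep_bracket ζ, η.rep_bracket ζ,
      (ξ + η).rep_bracket ζ, (ξ.rep_add η).mlieBracket_vectorField (EventuallyEq.refl _ ζ.rep),
      mdiffAt_of_mem ξ.rep_mem, mdiffAt_of_mem η.rep_mem] with p h1 h2 h3 h4 h5 h6 h7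
    rw [h1, Pi.add_apply, h2, h3, h4, h5, VectorField.mlieBracket_add_left h6 h7]
  lie_add ξ η ζ := by
    have : CompleteSpace E := FiniteDimensional.complete ℂ E
    have : IsManifold 𝓘(ℂ, E) 2 Z := IsManifold.of_le (n := ω) le_top
    refine HolGerm.ext_rep ?_
    filter_upwards [(⁅ξ, η⁆).rep_add ⁅ξ, ζ⁆, ξ.rep_bracket η, ξ.rep_bracket ζ,
      ξ.rep_bracket (η + ζ), (EventuallyEq.refl _ ξ.rep).mlieBracket_vectorField (η.rep_add ζ),
      mdiffAt_of_mem η.rep_mem, mdiffAt_of_mem ζ.rep_mem] with p h1 h2 h3 h4 h5 h6 h7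
    rw [h1, Pi.add_apply, h2, h3, h4, h5, VectorField.mlieBracket_add_right h6 h7]
  lie_self ξ := by
    refine HolGerm.ext_rep ?_
    filter_upwards [ξ.rep_bracket ξ, HolGerm.rep_zero (E := E) (a := a)] with p h1 h2
    rw [h1, h2, VectorField.mlieBracket_self]
    rfl
  leibniz_lie ξ η ζ := by
    have : CompleteSpace E := FiniteDimensional.complete ℂ E
    have : IsManifold 𝓘(ℂ, E) (minSmoothness ℂ 3) Z := IsManifold.of_le (n := ω) le_top
    refine HolGerm.ext_rep ?_
    filter_upwards [(⁅⁅ξ, η⁆, ζ⁆).rep_add ⁅η, ⁅ξ, ζ⁆⁆, ξ.rep_bracket ⁅η, ζ⁆,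
      (⁅ξ, η⁆).rep_bracket ζ, η.rep_bracket ⁅ξ, ζ⁆,
      (EventuallyEq.refl _ ξ.rep).mlieBracket_vectorField (η.rep_bracket ζ),
      (ξ.rep_bracket η).mlieBracket_vectorField (EventuallyEq.refl _ ζ.rep),
      (EventuallyEq.refl _ η.rep).mlieBracket_vectorField (ξ.rep_bracket ζ),
      ξ.rep_mem, η.rep_mem, ζ.rep_mem] with p h1 h2 h3 h4 h5 h6 h7 hX hY hZ
    rw [h1, Pi.add_apply, h2, h3, h4, h5, h6, h7]
    exact VectorField.leibniz_identity_mlieBracket_apply (hX.of_le le_top) (hY.of_le le_top)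
      (hZ.of_le le_top)

theorem HolGerm.lie_smul_complex {a : Z} (c : ℂ) (ξ η : HolGerm E a) :
    ⁅ξ, c • η⁆ = c • ⁅ξ, η⁆ := by
  have : CompleteSpace E := FiniteDimensional.complete ℂ E
  have : IsManifold 𝓘(ℂ, E) 2 Z := IsManifold.of_le (n := ω) le_top
  refine HolGerm.ext_rep ?_
  filter_upwards [(⁅ξ, η⁆).rep_smul c, ξ.rep_bracket η, ξ.rep_bracket (c • η),
    (EventuallyEq.refl _ ξ.rep).mlieBracket_vectorField (η.rep_smul c),
    mdiffAt_of_mem η.rep_mem] with p h1 h2 h3 h4 h5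
  rw [h1, Pi.smul_apply, h2, h3, h4, VectorField.mlieBracket_const_smul_right h5]

instance (a : Z) : LieAlgebra ℂ (HolGerm E a) where
  lie_smul c ξ η := ξ.lie_smul_complex c η

/-- `𝔥𝔬𝔩(Z,a)` as a real Lie algebra. -/
instance (a : Z) : LieAlgebra ℝ (HolGerm E a) where
  lie_smul c ξ η := ξ.lie_smul_complex (c : ℂ) η

/-- The evaluation `ξ ↦ ξ_a` on `𝔥𝔬𝔩(Z,a)`. -/
def evalAt (a : Z) : HolGerm E a →ₗ[ℂ] TangentSpace 𝓘(ℂ, E) a where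
  toFun ξ := ξ.rep a
  map_add' ξ η := (ξ.rep_add η).self_of_nhds
  map_smul' c ξ := (ξ.rep_smul c).self_of_nhds

end Germs

/-! ### Real-analytic submanifolds, CR structure, germs of CR maps -/

/-- `S` is an (embedded, hence locally closed) real-analytic submanifold of the real-analytic
manifold `X`: near each of its points some real-analytic chart of `X` maps it onto an open piece
of a linear subspace. -/
def IsAnalyticSubmanifold (W : Type v) [NormedAddCommGroup W] [NormedSpace ℝ W]
    {X : Type u} [TopologicalSpace X] [ChartedSpace W X] (S : Set X) : Prop :=
  ∀ p ∈ S, ∃ Φ ∈ IsManifold.maximalAtlas 𝓘(ℝ, W) ω X, p ∈ Φ.source ∧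
    ∃ L : Submodule ℝ W, ∀ x ∈ Φ.source, x ∈ S ↔ Φ x ∈ L

section CR

variable (E : Type v) [NormedAddCommGroup E] [NormedSpace ℂ E]
  {Z : Type u} [TopologicalSpace Z] [ChartedSpace E Z]
  (E' : Type v') [NormedAddCommGroup E'] [NormedSpace ℂ E']
  {Z' : Type u'} [TopologicalSpace Z'] [ChartedSpace E' Z']

/-- The real tangent space `T_pM` of a submanifold `M ⊆ Z`, as a real subspace of the complex
vector space `T_pZ`: it consists of the velocities at `p` of curves in `M`. -/
def tangentAt (M : Set Z) (p : Z) : Submodule ℝ (TangentSpace 𝓘(ℂ, E) p) :=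
  Submodule.span ℝ {v | ∃ γ : ℝ → Z, γ 0 = p ∧ (∀ᶠ t in 𝓝 0, γ t ∈ M) ∧
    HasMFDerivAt 𝓘(ℝ, ℝ) 𝓘(ℝ, E) γ 0 ((1 : ℝ →L[ℝ] ℝ).smulRight (v : E))}

/-- The holomorphic tangent space `H_pM = T_pM ∩ i T_pM`. -/
def holTangentAt (M : Set Z) (p : Z) : Set (TangentSpace 𝓘(ℂ, E) p) :=
  {v | v ∈ tangentAt E M p ∧ Complex.I • v ∈ tangentAt E M p}

/-- `M` is a real-analytic submanifold of the complex manifold `Z`, generically embedded, i.e.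
`T_pZ = T_pM + i T_pM` for all `p ∈ M`. -/
structure IsGenericSubmanifold (M : Set Z) : Prop where
  submanifold : IsAnalyticSubmanifold E M
  generic : ∀ p ∈ M,
    Submodule.span ℂ (tangentAt E M p : Set (TangentSpace 𝓘(ℂ, E) p)) = ⊤

/-- The real differential `T_pZ → T_{f(p)}Z'` of a map between complex manifolds. -/
def realDeriv (f : Z → Z') (p : Z) :
    TangentSpace 𝓘(ℂ, E) p →L[ℝ] TangentSpace 𝓘(ℂ, E') (f p) :=
  mfderiv 𝓘(ℝ, E) 𝓘(ℝ, E') f p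

/-- `f` represents a germ at `a` of a real-analytic CR map `M → N`. Germs along `M` of
real-analytic maps are restrictions to `M` of real-analytic maps defined near `a` in `Z`;
accordingly `f` is a map on `Z`, real-analytic near `a`, of which only the restriction to `M` near
`a` matters (`f` itself need not be holomorphic). -/
structure IsCRMapGerm (M : Set Z) (a : Z) (N : Set Z') (f : Z → Z') : Prop where
  analytic : ContMDiffAt 𝓘(ℝ, E) 𝓘(ℝ, E') ω f a
  mapsTo : ∀ᶠ p in 𝓝[M] a, f p ∈ N
  cr : ∀ᶠ p in 𝓝[M] a, ∀ v ∈ holTangentAt E M p,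
    realDeriv E E' f p v ∈ holTangentAt E' N (f p) ∧
      realDeriv E E' f p (Complex.I • v) = Complex.I • realDeriv E E' f p v

/-- `f` represents an isomorphism of CR-manifold germs `(M,a) → (N,b)`, bianalytic. -/
def IsCRIsoGerm (M : Set Z) (a : Z) (N : Set Z') (b : Z') (f : Z → Z') : Prop :=
  f a = b ∧ IsCRMapGerm E E' M a N f ∧ ∃ g : Z' → Z, IsCRMapGerm E' E N b M g ∧
    (∀ᶠ p in 𝓝[M] a, g (f p) = p) ∧ ∀ᶠ q in 𝓝[N] b, f (g q) = q

end CR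

/-! ### `𝔥𝔬𝔩(M,a)`, the admissible abelian subalgebras and their conjugacy -/

section Subalgebras

variable {E : Type v} [NormedAddCommGroup E] [NormedSpace ℂ E] [FiniteDimensional ℂ E]
  {Z : Type u} [TopologicalSpace Z] [ChartedSpace E Z] [IsManifold 𝓘(ℂ, E) ω Z]

/-- `𝔥𝔬𝔩(M,a)` as a real subspace of `𝔥𝔬𝔩(Z,a)`, for `M` generic in `Z`: the germs of real-analytic
infinitesimal CR transformations of `M` are the germs of holomorphic vector fields on `Z` that are
tangent to `M`. -/
def holM (M : Set Z) (a : Z) : Submodule ℝ (HolGerm E a) where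
  carrier := {ξ | ∀ᶠ p in 𝓝[M] a, ξ.rep p ∈ tangentAt E M p}
  add_mem' {ξ η} hξ hη := by
    filter_upwards [hξ, hη, (ξ.rep_add η).filter_mono nhdsWithin_le_nhds] with p h1 h2 h3
    rw [h3]
    exact add_mem h1 h2
  zero_mem' := by
    filter_upwards [(HolGerm.rep_zero (E := E) (a := a)).filter_mono nhdsWithin_le_nhds] with p h
    rw [h]
    exact zero_mem _
  smul_mem' c ξ hξ := by
    filter_upwards [hξ, (ξ.rep_smul (c : ℂ)).filter_mono nhdsWithin_le_nhds] with p h1 h2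
    have h3 : (c • ξ).rep p = (c : ℂ) • ξ.rep p := h2
    rw [h3]
    exact Submodule.smul_mem _ c h1

/-- Abelian Lie subalgebras `𝔳 ⊆ 𝔥𝔬𝔩(M,a)` such that (i) `𝔳` is totally real in `𝔥𝔬𝔩(Z,a)`, and
(ii) `𝔳 ⊕ i𝔳` spans `T_aZ`. -/
structure IsAdmissible (M : Set Z) (a : Z) (𝔳 : LieSubalgebra ℝ (HolGerm E a)) : Prop where
  le_holM : 𝔳.toSubmodule ≤ holM M a
  abelian : IsLieAbelian 𝔳
  totallyReal : ∀ ξ ∈ 𝔳, Complex.I • ξ ∈ 𝔳 → ξ = 0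
  spans : (Submodule.span ℂ (𝔳 : Set (HolGerm E a))).map (evalAt a) = ⊤

variable (E) in
/-- The set of all admissible subalgebras. -/
abbrev Admissible (M : Set Z) (a : Z) : Type (max u v) :=
  {𝔳 : LieSubalgebra ℝ (HolGerm E a) // IsAdmissible M a 𝔳}

/-- `g_* ξ = η` along `M`, for `g` a germ of a self-map of `(M,a)`. -/
def Pushes (M : Set Z) (a : Z) (g : Z → Z) (ξ η : HolGerm E a) : Prop :=
  ∀ᶠ p in 𝓝[M] a, realDeriv E E g p (ξ.rep p) = η.rep (g p)

/-- Conjugacy under the stability group: `𝔴 = g_*(𝔳)` for some `g ∈ Aut(M,a)`. -/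
def Conjugate (M : Set Z) (a : Z) (𝔳 𝔴 : Admissible E M a) : Prop :=
  ∃ g : Z → Z, IsCRIsoGerm E E M a M a g ∧
    (∀ ξ ∈ 𝔳.1, ∃ η ∈ 𝔴.1, Pushes M a g ξ η) ∧ ∀ η ∈ 𝔴.1, ∃ ξ ∈ 𝔳.1, Pushes M a g ξ η

end Subalgebras

/-! ### Tube realizations -/

/-- The tube `V + iF` over the base `F ⊆ V`. -/
def tube {C : Type w} [AddCommGroup C] [Module ℂ C] (V : Submodule ℝ C) (F : Set V) : Set C :=
  {z | ∃ x : V, ∃ y ∈ F, z = (x : C) + Complex.I • (y : C)}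

/-- A tube realization of the germ `(M,a)`: a CR isomorphism `φ : (M,a) → (T,c)`, where
`T = V + iF ⊆ C = V ⊕ iV` is the tube over a connected real-analytic submanifold `F` of the finite
dimensional real vector space `V`. -/
structure TubeRealization (E : Type v) [NormedAddCommGroup E] [NormedSpace ℂ E]
    {Z : Type u} [TopologicalSpace Z] [ChartedSpace E Z] (M : Set Z) (a : Z) where
  C : Type w
  [instNorm : NormedAddCommGroup C]
  [instSpace : NormedSpace ℂ C]
  [instFin : FiniteDimensional ℂ C]
  V : Submodule ℝ C
  realForm : ∀ z : C, ∃! q : V × V, (q.1 : C) + Complex.I • (q.2 : C) = z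
  F : Set V
  submanifold : IsAnalyticSubmanifold V F
  connected : IsConnected F
  c : C
  c_mem : c ∈ tube V F
  φ : Z → C
  isCRIso : IsCRIsoGerm E C M a (tube V F) c φ

attribute [instance] TubeRealization.instNorm TubeRealization.instSpace TubeRealization.instFin

section Realizations

variable {E : Type v} [NormedAddCommGroup E] [NormedSpace ℂ E]
  {Z : Type u} [TopologicalSpace Z] [ChartedSpace E Z]
  {M : Set Z} {a : Z}

/-- The tube `T`. -/
def TubeRealization.T (R : TubeRealization.{u, v, w} E M a) : Set R.C := tube R.V R.F

variable (E M a) in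
/-- Affine equivalence: the tube germs `(T,c)`, `(T',c')` correspond under an affine isomorphism of
the ambient complex vector spaces. -/
def AffEquiv (R R' : TubeRealization.{u, v, w} E M a) : Prop :=
  ∃ l : R.C ≃ᵃ[ℂ] R'.C, l R.c = R'.c ∧ ∀ᶠ z in 𝓝 R.c, z ∈ R.T ↔ l z ∈ R'.T

variable [FiniteDimensional ℂ E] [IsManifold 𝓘(ℂ, E) ω Z]

/-- `𝔳 = {φ^*(x ∂/∂z) : x ∈ V}`. -/
def TubeRealization.Induces (R : TubeRealization.{u, v, w} E M a) (𝔳 : Admissible E M a) : Prop :=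
  (∀ ξ ∈ 𝔳.1, ∃ x ∈ R.V, ∀ᶠ p in 𝓝[M] a, realDeriv E R.C R.φ p (ξ.rep p) = x) ∧
    ∀ x ∈ R.V, ∃ ξ ∈ 𝔳.1, ∀ᶠ p in 𝓝[M] a, realDeriv E R.C R.φ p (ξ.rep p) = x

/-- The realization `R` is the one obtained by inverting `ξ ↦ exp(ξ)(a)` on `𝔢 = 𝔳 ⊕ i𝔳`: there is
a complex linear isomorphism `L : C ≅ 𝔢` with `L(V) = 𝔳`, and a biholomorphic map `ψ` from an open
neighbourhood of `0 ∈ C` onto an open neighbourhood `ψ.target` of `a ∈ Z`, such that `c = 0`, the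
germs in `𝔢` have holomorphic representatives `X z` on `ψ.target` (linear in `z`),
`ψ(z) = exp(X z)(a)`, i.e. `ψ(z)` is the value at time `1` of an integral curve of `X z` starting at
`a`, and `φ` is the restriction of `ψ⁻¹` to `M` near `a`. -/
def TubeRealization.IsExp (R : TubeRealization.{u, v, w} E M a) (𝔳 : Admissible E M a) : Prop :=
  R.c = 0 ∧
  ∃ (L : R.C ≃ₗ[ℂ] Submodule.span ℂ (𝔳.1 : Set (HolGerm E a)))
    (X : R.C →ₗ[ℂ] Π p : Z, TangentSpace 𝓘(ℂ, E) p) (ψ : OpenPartialHomeomorph R.C Z),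
    (∀ z, z ∈ R.V ↔ (L z : HolGerm E a) ∈ 𝔳.1) ∧
    (∀ z, (L z : HolGerm E a).rep =ᶠ[𝓝 a] X z) ∧
    (∀ z, ∀ p ∈ ψ.target, ContMDiffAt 𝓘(ℂ, E) 𝓘(ℂ, E).tangent ω (T% (X z)) p) ∧
    0 ∈ ψ.source ∧ ψ 0 = a ∧
    ContMDiffOn 𝓘(ℂ, R.C) 𝓘(ℂ, E) ω ψ ψ.source ∧
    ContMDiffOn 𝓘(ℂ, E) 𝓘(ℂ, R.C) ω ψ.symm ψ.target ∧
    (∀ z ∈ ψ.source, ∃ γ : ℝ → Z, γ 0 = a ∧ γ 1 = ψ z ∧ (∀ t ∈ Icc (0 : ℝ) 1, γ t ∈ ψ.target) ∧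
      IsMIntegralCurveOn (I := 𝓘(ℝ, E)) γ (fun p => (X z p : E)) (Icc 0 1)) ∧
    ∀ᶠ p in 𝓝[M] a, R.φ p = ψ.symm p

end Realizations

end CRTube

end

namespace CRTube

/-! ### Complex analysis in vector spaces -/

/-! A tube is invariant under translations by `V`, so the constant fields `v ∂/∂z` form an abelian
algebra tangent to it. Conversely, commuting holomorphic fields that span the tangent space are
constant in suitable holomorphic coordinates. If the real ones are tangent to `M`, then `M` becomes
invariant under real translations, hence a tube. The theorem makes both directions precise on germs.

Everything living on `M` is first moved to holomorphic objects near `a`. A real-analytic CR map on a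
generic submanifold extends holomorphically (`exists_holomorphic_extension`): the parametrization
and the map are complexified, the CR condition says at real points that the complexified map is
infinitesimally constant along the fibres of the complexified parametrization, and the identity
principle spreads this to a neighbourhood. For a CR isomorphism the extension has invertible
derivative (`IsCRIsoGerm.exists_extension`). The identity principle along generic sets
(`eventually_eq_zero_of_velocities`) also shows that a germ of a field is determined by its values
on `M`. Pulling back constant fields under the extension of `φ` gives the subalgebra
(`TubeRealization.existsUnique_induces`).

If two tube germs are affinely equivalent, composing the affine map with the realizations gives an
automorphism of `(M,a)`, and it conjugates the subalgebras provided the linear part maps `V` onto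
`V'`. This can fail when a tube has additional translational symmetries, and `exists_adapted_equiv`
corrects the linear part. Conversely, a conjugating automorphism, read in tube coordinates, has
constant derivative in the directions of `V`. Since `V` spans over `ℂ`, its holomorphic extension is
affine (`eventually_affine`). This gives well-definedness and injectivity.

For surjectivity, evaluation at `a` is injective on `𝔢`, because a field commuting with a commuting
frame and vanishing at `a` is zero. The dual coframe of the frame is closed, and a primitive of it
is the inverse of a coordinate map `ψ` in which all fields of `𝔢` are constant
(`exists_straightening`). The curves `t ↦ ψ (t z)` are then integral curves, so `ψ` is the
exponential map. The tangent spaces of `ψ⁻¹(M)` contain `V`, which forces it to be a graph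
independent of the real part, that is, a tube (`exists_tube_of_param`). -/

theorem eventually_eq_top {K W α : Type*} [Field K] [AddCommGroup W] [Module K W]
    [Module.Finite K W] {l : Filter α} {S : α → Submodule K W}
    (h : ∀ w, ∀ᶠ p in l, w ∈ S p) : ∀ᶠ p in l, S p = ⊤ := by
  obtain ⟨s, hs⟩ := Module.Finite.fg_top (R := K) (M := W)
  have : ∀ᶠ p in l, ∀ w ∈ s, w ∈ S p := (eventually_all_finset s).2 fun w _ => h w
  filter_upwards [this] with p hp
  rw [eq_top_iff, ← hs, Submodule.span_le]
  exact hp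

/-- The inclusion `ℝᵐ → ℂᵐ`. -/
noncomputable def ofRealPi (m : ℕ) : (Fin m → ℝ) →L[ℝ] (Fin m → ℂ) :=
  ContinuousLinearMap.pi fun i => Complex.ofRealCLM.comp (ContinuousLinearMap.proj i)

@[simp] theorem ofRealPi_apply {m : ℕ} (x : Fin m → ℝ) (i : Fin m) :
    ofRealPi m x i = (x i : ℂ) := rfl

theorem exists_ofRealPi_add {m : ℕ} (z : Fin m → ℂ) :
    ∃ x y, z = ofRealPi m x + Complex.I • ofRealPi m y :=
  ⟨fun i => (z i).re, fun i => (z i).im, by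
    ext i; simp [mul_comm Complex.I, Complex.re_add_im]⟩

/-- A real-analytic germ on `ℝᵐ` with values in a complex space extends holomorphically
to `ℂᵐ`. -/
theorem exists_complexification {m : ℕ} {G : Type*} [NormedAddCommGroup G] [NormedSpace ℂ G]
    [CompleteSpace G] {h : (Fin m → ℝ) → G} (hh : ContDiffAt ℝ ω h 0) :
    ∃ H : (Fin m → ℂ) → G, ContDiffAt ℂ ω H 0 ∧
      ∀ᶠ x in 𝓝 0, H (ofRealPi m x) = h x := by
  obtain ⟨p, r, hp⟩ := hh.analyticAt
  let e : Fin m → (Fin m → ℝ) := fun i => Pi.single i 1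
  have he : ∀ i, ‖e i‖ ≤ 1 := fun i => by
    refine (pi_norm_le_iff_of_nonneg zero_le_one).2 fun j => ?_
    by_cases hij : j = i
    · subst hij; simp [e]
    · simp [e, hij]
  -- Expanding the Taylor terms of `h` in the standard basis writes them as sums of products of
  -- coordinates with coefficients in `G`; such products make sense over `ℂ`.
  let mon : ∀ n, (Fin n → Fin m) → ContinuousMultilinearMap ℂ (fun _ : Fin n => Fin m → ℂ) ℂ :=
    fun n s => (ContinuousMultilinearMap.mkPiAlgebra ℂ (Fin n) ℂ).compContinuousLinearMap
      fun k => ContinuousLinearMap.proj (s k)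
  have hmon : ∀ n s, ‖mon n s‖ ≤ 1 := fun n s => by
    refine ContinuousMultilinearMap.opNorm_le_bound zero_le_one fun v => ?_
    simp only [mon, ContinuousMultilinearMap.compContinuousLinearMap_apply,
      ContinuousMultilinearMap.mkPiAlgebra_apply, ContinuousLinearMap.proj_apply, one_mul]
    rw [norm_prod]
    exact Finset.prod_le_prod (fun _ _ => norm_nonneg _) fun k _ => norm_le_pi_norm _ _
  let q : FormalMultilinearSeries ℂ (Fin m → ℂ) G := fun n =>
    ∑ s : Fin n → Fin m, (mon n s).smulRight (p n fun k => e (s k))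
  have hq : ∀ n, ‖q n‖ ≤ (m : ℝ) ^ n * ‖p n‖ := fun n => by
    refine (norm_sum_le _ _).trans ?_
    have : ∀ s ∈ (Finset.univ : Finset (Fin n → Fin m)),
        ‖(mon n s).smulRight (p n fun k => e (s k))‖ ≤ ‖p n‖ := fun s _ => by
      refine ContinuousMultilinearMap.opNorm_le_bound (norm_nonneg _) fun v => ?_
      rw [ContinuousMultilinearMap.smulRight_apply, norm_smul, mul_comm]
      refine mul_le_mul ?_ ?_ (norm_nonneg _) (norm_nonneg _)
      · refine ((p n).le_opNorm _).trans ?_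
        refine mul_le_of_le_one_right (norm_nonneg _) ?_
        exact Finset.prod_le_one (fun _ _ => norm_nonneg _) fun k _ => he _
      · refine ((mon n s).le_opNorm v).trans ?_
        exact mul_le_of_le_one_left (Finset.prod_nonneg fun _ _ => norm_nonneg _) (hmon n s)
    refine (Finset.sum_le_sum this).trans ?_
    simp [Finset.card_univ]
  have hqx : ∀ n x, q n (fun _ => ofRealPi m x) = p n fun _ => x := fun n x => by
    have hx : x = ∑ i, x i • e i := by
      ext j
      simp [e, Finset.sum_apply, Pi.single_apply]
    have h1 : (p n fun _ => x) = p n fun _ : Fin n => ∑ i, x i • e i := by rw [← hx]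
    rw [h1, ContinuousMultilinearMap.map_sum]
    simp only [q, _root_.sum_apply, ContinuousMultilinearMap.smulRight_apply]
    refine Finset.sum_congr rfl fun s _ => ?_
    rw [ContinuousMultilinearMap.map_smul_univ]
    simp only [mon, ContinuousMultilinearMap.compContinuousLinearMap_apply,
      ContinuousMultilinearMap.mkPiAlgebra_apply, ContinuousLinearMap.proj_apply, ofRealPi_apply]
    rw [← Complex.ofReal_prod]
    rfl
  have hrad : 0 < q.radius := by
    have hpr : 0 < p.radius := hp.r_pos.trans_le hp.r_le
    obtain ⟨ρ, hρ0, hρ⟩ := ENNReal.lt_iff_exists_nnreal_btwn.1 hpr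
    obtain ⟨B, hB0, hB⟩ := p.norm_mul_pow_le_of_lt_radius hρ
    have hρ' : (0 : ℝ) < ρ := by exact_mod_cast hρ0
    -- There are `m ^ n` index tuples of length `n`, which costs a factor `m` in the radius;
    -- dividing by `m + 1` also covers `m = 0`.
    let ρ' : NNReal := ρ / (m + 1)
    have hρ'0 : 0 < ρ' := div_pos (by exact_mod_cast hρ') (by positivity)
    refine lt_of_lt_of_le (by exact_mod_cast hρ'0) (q.le_radius_of_bound (r := ρ') B fun n => ?_)
    calc ‖q n‖ * (ρ' : ℝ) ^ n ≤ ((m : ℝ) ^ n * ‖p n‖) * (ρ' : ℝ) ^ n := by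
          gcongr; exact hq n
      _ = ‖p n‖ * ((m : ℝ) / (m + 1) * ρ) ^ n := by
          simp only [ρ', NNReal.coe_div, NNReal.coe_add, NNReal.coe_natCast, NNReal.coe_one]
          rw [mul_comm ((m : ℝ) ^ n), mul_assoc, ← mul_pow]
          congr 2
          ring
      _ ≤ ‖p n‖ * (1 * ρ) ^ n := by
          gcongr
          rw [div_le_one (by positivity)]; linarith
      _ ≤ B := by simpa using hB n
  have hQ := q.hasFPowerSeriesOnBall hrad
  refine ⟨q.sum, hQ.analyticAt.contDiffAt, ?_⟩
  have h1 : ∀ᶠ x : Fin m → ℝ in 𝓝 0, x ∈ Metric.eball 0 r :=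
    Metric.eball_mem_nhds _ hp.r_pos
  filter_upwards [h1] with x hx
  have h2 := hp.hasSum hx
  rw [zero_add] at h2
  simp_rw [← hqx] at h2
  exact h2.tsum_eq

/-- A holomorphic map vanishing along `S` has vanishing derivative where the velocities of
curves in `S` span. -/
theorem fderiv_eq_zero_of_velocities {E G : Type*} [NormedAddCommGroup E] [NormedSpace ℂ E]
    [NormedAddCommGroup G] [NormedSpace ℂ G] {S : Set E} {p : E}
    (hS : Submodule.span ℂ {v : E | ∃ γ : ℝ → E, γ 0 = p ∧ (∀ᶠ t in 𝓝 0, γ t ∈ S) ∧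
      HasDerivAt γ v 0} = ⊤) {U : E → G} (hU : DifferentiableAt ℂ U p)
    (h0 : ∀ᶠ x in 𝓝[S] p, U x = 0) : fderiv ℂ U p = 0 := by
  have h1 : Submodule.span ℂ {v : E | ∃ γ : ℝ → E, γ 0 = p ∧ (∀ᶠ t in 𝓝 0, γ t ∈ S) ∧
      HasDerivAt γ v 0} ≤ LinearMap.ker (fderiv ℂ U p : E →ₗ[ℂ] G) := by
    rw [Submodule.span_le]
    rintro v ⟨γ, hγ0, hγS, hγ⟩
    have hd : HasFDerivAt U ((fderiv ℂ U p).restrictScalars ℝ) (γ 0) := by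
      rw [hγ0]; exact hU.hasFDerivAt.restrictScalars ℝ
    have h2 := hd.comp_hasDerivAt (0 : ℝ) hγ
    have h3 : Tendsto γ (𝓝 0) (𝓝[S] p) :=
      tendsto_nhdsWithin_iff.2 ⟨hγ0 ▸ hγ.continuousAt, hγS⟩
    have h4 : (U ∘ γ) =ᶠ[𝓝 0] fun _ => 0 := h3.eventually h0
    have h5 := (hasDerivAt_const (0 : ℝ) (0 : G)).congr_of_eventuallyEq h4
    exact h2.unique h5
  rw [hS, top_le_iff] at h1
  ext v
  have : v ∈ LinearMap.ker (fderiv ℂ U p : E →ₗ[ℂ] G) := h1 ▸ Submodule.mem_top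
  exact this

/-- Identity principle along a set whose velocities span over `ℂ`. -/
theorem eventually_eq_zero_of_velocities {E G : Type*} [NormedAddCommGroup E] [NormedSpace ℂ E]
    [CompleteSpace E] [NormedAddCommGroup G] [NormedSpace ℂ G] [CompleteSpace G] {S : Set E}
    {a : E} (ha : a ∈ S)
    (hS : ∀ᶠ p in 𝓝[S] a, Submodule.span ℂ {v : E | ∃ γ : ℝ → E, γ 0 = p ∧
      (∀ᶠ t in 𝓝 0, γ t ∈ S) ∧ HasDerivAt γ v 0} = ⊤) {U : E → G}
    (hU : ContDiffAt ℂ ω U a) (h0 : ∀ᶠ x in 𝓝[S] a, U x = 0) : ∀ᶠ x in 𝓝 a, U x = 0 := by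
  have han : ∀ᶠ p in 𝓝[S] a, ContDiffAt ℂ ω U p :=
    (hU.eventually (by simp)).filter_mono nhdsWithin_le_nhds
  -- If the `n`-th derivative vanishes along `S`, its own derivative kills all velocities of curves
  -- in `S`, hence everything. So all Taylor coefficients at `a` vanish.
  have key : ∀ n, ∀ᶠ x in 𝓝[S] a, iteratedFDeriv ℂ n U x = 0 := by
    intro n
    induction n with
    | zero =>
      filter_upwards [h0] with x hx
      ext v
      simp [hx]
    | succ n ih =>
      filter_upwards [eventually_eventually_nhdsWithin.2 ih, hS, han] with p h1 h2 h3
      have h4 : DifferentiableAt ℂ (iteratedFDeriv ℂ n U) p :=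
        by
        have : AnalyticOnNhd ℂ U {p} := fun x hx => by
          rw [mem_singleton_iff.1 hx]; exact h3.analyticAt
        exact (this.iteratedFDeriv n p rfl).differentiableAt
      have h5 := fderiv_eq_zero_of_velocities h2 h4 h1
      ext v
      rw [iteratedFDeriv_succ_apply_left, h5]
      simp
  obtain ⟨p, r, hp⟩ := hU.analyticAt
  have h1 : ∀ᶠ x in 𝓝 a, x ∈ Metric.eball a r := Metric.eball_mem_nhds _ hp.r_pos
  filter_upwards [h1] with x hx
  have h2 := hp.hasSum_iteratedFDeriv (y := x - a) (by
    simpa [Metric.mem_eball, edist_eq_enorm_sub] using hx)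
  have h3 : ∀ n, iteratedFDeriv ℂ n U a = 0 := fun n => (key n).self_of_nhdsWithin ha
  simp only [h3, add_sub_cancel] at h2
  exact h2.unique (by simp)

/-- A holomorphic germ on `ℂᵐ` vanishing on `ℝᵐ` vanishes. -/
theorem eventually_eq_zero_of_real {m : ℕ} {G : Type*} [NormedAddCommGroup G] [NormedSpace ℂ G]
    [CompleteSpace G] {U : (Fin m → ℂ) → G} (hU : ContDiffAt ℂ ω U 0)
    (h0 : ∀ᶠ x in 𝓝 0, U (ofRealPi m x) = 0) : ∀ᶠ z in 𝓝 0, U z = 0 := by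
  refine eventually_eq_zero_of_velocities (S := range (ofRealPi m)) ⟨0, map_zero _⟩ ?_ hU ?_
  · refine eventually_nhdsWithin_of_forall ?_
    rintro _ ⟨x, rfl⟩
    rw [eq_top_iff]
    intro z _
    have hmem : ∀ y, ofRealPi m y ∈ Submodule.span ℂ {v : Fin m → ℂ | ∃ γ : ℝ → (Fin m → ℂ),
        γ 0 = ofRealPi m x ∧ (∀ᶠ t in 𝓝 0, γ t ∈ range (ofRealPi m)) ∧ HasDerivAt γ v 0} := by
      intro y
      refine Submodule.subset_span ⟨fun t => ofRealPi m (x + t • y), by simp,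
        Eventually.of_forall fun t => ⟨_, rfl⟩, ?_⟩
      have : HasDerivAt (fun t : ℝ => x + t • y) y 0 := by
        simpa using ((hasDerivAt_id (0 : ℝ)).smul_const y).const_add x
      exact (ofRealPi m).hasFDerivAt.comp_hasDerivAt (0 : ℝ) this
    obtain ⟨x', y', rfl⟩ := exists_ofRealPi_add z
    exact add_mem (hmem _) (Submodule.smul_mem _ _ (hmem _))
  · let re : (Fin m → ℂ) → (Fin m → ℝ) := fun z i => (z i).re
    have hre : Continuous re := by fun_prop
    have h1 : Tendsto re (𝓝 0) (𝓝 0) := by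
      have := hre.tendsto 0
      rwa [show re 0 = 0 by ext i; simp [re]] at this
    filter_upwards [(h1.eventually h0).filter_mono nhdsWithin_le_nhds, self_mem_nhdsWithin]
      with z hz hz'
    obtain ⟨x, rfl⟩ := hz'
    have : re (ofRealPi m x) = x := by ext i; simp [re]
    rwa [this] at hz

/-- The real derivative of the restriction of a holomorphic map to `ℝᵐ`. -/
theorem fderiv_comp_ofRealPi {m : ℕ} {G : Type*} [NormedAddCommGroup G] [NormedSpace ℂ G]
    {h : (Fin m → ℝ) → G} {H : (Fin m → ℂ) → G} (hH : ContDiffAt ℂ ω H 0)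
    (hh : ∀ᶠ x in 𝓝 0, H (ofRealPi m x) = h x) :
    ∀ᶠ x in 𝓝 0, ∀ u, fderiv ℝ h x u = fderiv ℂ H (ofRealPi m x) (ofRealPi m u) := by
  have ht : Tendsto (ofRealPi m) (𝓝 0) (𝓝 0) := by
    simpa using (ofRealPi m).continuous.tendsto 0
  filter_upwards [ht.eventually (hH.eventually (by simp)), eventually_eventually_nhds.2 hh]
    with x h1 h2 u
  have h3 : HasFDerivAt H ((fderiv ℂ H (ofRealPi m x)).restrictScalars ℝ) (ofRealPi m x) :=
    (h1.differentiableAt (by simp)).hasFDerivAt.restrictScalars ℝ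
  have h4 := h3.comp x (ofRealPi m).hasFDerivAt
  have h5 : h =ᶠ[𝓝 x] H ∘ ofRealPi m := by filter_upwards [h2] with y hy using hy.symm
  rw [(h4.congr_of_eventuallyEq h5).fderiv]
  rfl

/-- Real-analytic CR maps on a generic real-analytic submanifold extend holomorphically: here the
submanifold is given by a parametrization `σ`, and the map `h` in terms of the parameters. -/
theorem exists_holomorphic_extension {m : ℕ} {E G : Type*} [NormedAddCommGroup E]
    [NormedSpace ℂ E] [FiniteDimensional ℂ E] [NormedAddCommGroup G] [NormedSpace ℂ G]
    [CompleteSpace G] {σ : (Fin m → ℝ) → E} {h : (Fin m → ℝ) → G} (hσ : ContDiffAt ℝ ω σ 0)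
    (hh : ContDiffAt ℝ ω h 0)
    (hspan : Submodule.span ℂ (range (fderiv ℝ σ 0)) = ⊤)
    (hcr : ∀ᶠ x in 𝓝 0, ∀ u v, fderiv ℝ σ x u + Complex.I • fderiv ℝ σ x v = 0 →
      fderiv ℝ h x u + Complex.I • fderiv ℝ h x v = 0) :
    ∃ F : E → G, ContDiffAt ℂ ω F (σ 0) ∧ ∀ᶠ x in 𝓝 0, F (σ x) = h x := by
  have : CompleteSpace E := FiniteDimensional.complete ℂ E
  obtain ⟨S, hS, hSσ⟩ := exists_complexification hσ
  obtain ⟨H, hH, hHh⟩ := exists_complexification hh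
  have hSd := fderiv_comp_ofRealPi hS hSσ
  have hHd := fderiv_comp_ofRealPi hH hHh
  have ht : Tendsto (ofRealPi m) (𝓝 0) (𝓝 0) := by
    simpa using (ofRealPi m).continuous.tendsto 0
  have hS0 : S 0 = σ 0 := by simpa using hSσ.self_of_nhds
  let A := fderiv ℂ S 0
  have hA : A.range = ⊤ := by
    rw [eq_top_iff, ← hspan, Submodule.span_le]
    rintro _ ⟨u, rfl⟩
    rw [hSd.self_of_nhds u, map_zero]
    exact ⟨_, rfl⟩
  -- `H` has to descend through `S`. A projection onto the kernel of `A` completes `S` to local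
  -- coordinates `Ψ = (S, π)`, in which the fibres of `S` are the slices with fixed first entry.
  obtain ⟨π, hπ⟩ := Submodule.ClosedComplemented.of_finiteDimensional_quotient (𝕜 := ℂ)
    (p := A.ker) (Submodule.closed_of_finiteDimensional _)
  let Ψ : (Fin m → ℂ) → E × A.ker := fun w => (S w, π w)
  have hΨ : ContDiffAt ℂ ω Ψ 0 := hS.prodMk π.contDiff.contDiffAt
  have hinj : (A.prod π).ker = ⊥ := by
    rw [LinearMap.ker_eq_bot']
    intro w hw
    obtain ⟨h1, h2⟩ := Prod.ext_iff.1 hw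
    have h3 := hπ ⟨w, h1⟩
    change π w = 0 at h2
    rw [h2] at h3
    exact (congrArg Subtype.val h3).symm
  have hsurj : (A.prod π).range = ⊤ := by
    rw [LinearMap.range_eq_top]
    rintro ⟨e, q⟩
    obtain ⟨w, hw⟩ := LinearMap.range_eq_top.1 hA e
    refine ⟨w + (q - π w : A.ker), Prod.ext ?_ ?_⟩
    · have : A (q - π w : A.ker) = 0 := (q - π w).2
      change A (w + (q - π w : A.ker)) = e
      rw [map_add, this, add_zero]
      exact hw
    · change π (w + (q - π w : A.ker)) = q
      rw [map_add, hπ]; abel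
  let B := ContinuousLinearEquiv.ofBijective (A.prod π) hinj hsurj
  have hB : HasFDerivAt Ψ (B : (Fin m → ℂ) →L[ℂ] E × A.ker) 0 := by
    rw [ContinuousLinearEquiv.coe_ofBijective]
    exact (hS.differentiableAt (by simp)).hasFDerivAt.prodMk π.hasFDerivAt
  let Θ := hΨ.toOpenPartialHomeomorph Ψ hB (by simp)
  have h0Θ : 0 ∈ Θ.source := hΨ.mem_toOpenPartialHomeomorph_source hB (by simp)
  have hΘ0 : Ψ 0 ∈ Θ.target := hΨ.image_mem_toOpenPartialHomeomorph_target hB (by simp)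
  have hΘs0 : Θ.symm (Ψ 0) = 0 := Θ.left_inv h0Θ
  have hΘs : ContDiffAt ℂ ω Θ.symm (Ψ 0) := Θ.contDiffAt_symm (f₀' := B) hΘ0
    (by rw [hΘs0]; exact hB) (by rw [hΘs0]; exact hΨ)
  let k : E × A.ker → G := H ∘ Θ.symm
  have hk : ContDiffAt ℂ ω k (Ψ 0) := ContDiffAt.comp _ (by rw [hΘs0]; exact hH) hΘs
  -- Restriction of a derivative to the fibre directions: `k` is locally independent of its second
  -- variable once `R (fderiv ℂ k y)` vanishes near `Ψ 0`.
  let R : (E × A.ker →L[ℂ] G) → (A.ker →L[ℂ] G) := fun f => f.comp (.inr ℂ E A.ker)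
  have hg : ContDiffAt ℂ ω (fun w => R (fderiv ℂ k (Ψ w))) 0 :=
    (ContDiffAt.comp (𝕜 := ℂ) 0 (hk.fderiv_right (m := ω) le_top) hΨ).clm_comp contDiffAt_const
  have hHk : ∀ᶠ w in 𝓝 0, k (Ψ w) = H w := by
    filter_upwards [Θ.open_source.mem_nhds h0Θ] with w hw
    exact congrArg H (Θ.left_inv hw)
  -- At a real point, a vector `u + iv` tangent to the fibre of `S` satisfies `dσ u + i dσ v = 0`,
  -- and `hcr` then says that `dH` kills it.
  have hg0 : ∀ᶠ x in 𝓝 0, R (fderiv ℂ k (Ψ (ofRealPi m x))) = 0 := by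
    have e1 : ∀ᶠ w in 𝓝 0, ContDiffAt ℂ ω k (Ψ w) :=
      hΨ.continuousAt.eventually (hk.eventually (by simp))
    have e2 : ∀ᶠ w in 𝓝 0, ContDiffAt ℂ ω Ψ w := hΨ.eventually (by simp)
    have e3 : ∀ᶠ w in 𝓝 0, ContDiffAt ℂ ω S w := hS.eventually (by simp)
    have e4 : ∀ᶠ w in 𝓝 0, (fderiv ℂ Ψ w).IsInvertible := by
      have hc : ContinuousAt (fderiv ℂ Ψ) 0 :=
        (hΨ.fderiv_right (m := ω) le_top).continuousAt
      have : ∀ᶠ f in 𝓝 (fderiv ℂ Ψ 0),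
          f ∈ range ((↑) : ((Fin m → ℂ) ≃L[ℂ] E × A.ker) → _) := by
        rw [hB.fderiv]
        exact ContinuousLinearEquiv.nhds B
      exact hc.eventually this
    filter_upwards [ht.eventually e1, ht.eventually e2, ht.eventually e3, ht.eventually e4,
      ht.eventually (eventually_eventually_nhds.2 hHk), hSd, hHd, hcr]
      with x h1 h2 h3 h4 h5 h6 h7 h8
    obtain ⟨D, hD⟩ := h4
    ext q
    change fderiv ℂ k (Ψ (ofRealPi m x)) (0, q) = 0
    obtain ⟨u, v, huv⟩ := exists_ofRealPi_add (D.symm (0, q))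
    have h9 : fderiv ℂ Ψ (ofRealPi m x) (ofRealPi m u + Complex.I • ofRealPi m v) = (0, q) := by
      rw [← huv, ← hD]; simp
    have h10 : fderiv ℂ Ψ (ofRealPi m x) = (fderiv ℂ S (ofRealPi m x)).prod π :=
      ((h3.differentiableAt (by simp)).hasFDerivAt.prodMk π.hasFDerivAt).fderiv
    have h11 : fderiv ℂ S (ofRealPi m x) (ofRealPi m u + Complex.I • ofRealPi m v) = 0 := by
      rw [h10] at h9
      exact congrArg Prod.fst h9
    rw [map_add, map_smul, ← h6, ← h6] at h11
    have h12 := h8 u v h11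
    rw [h7, h7, ← map_smul, ← map_add] at h12
    have h13 : fderiv ℂ H (ofRealPi m x) =
        (fderiv ℂ k (Ψ (ofRealPi m x))).comp (fderiv ℂ Ψ (ofRealPi m x)) := by
      rw [← fderiv_comp _ (h1.differentiableAt (by simp)) (h2.differentiableAt (by simp))]
      refine Filter.EventuallyEq.fderiv_eq ?_
      filter_upwards [h5] with y hy using hy.symm
    rw [h13, ContinuousLinearMap.comp_apply, h9] at h12
    exact h12
  have hg1 := eventually_eq_zero_of_real hg hg0
  have hk0 : ∀ᶠ y in 𝓝 (Ψ 0), DifferentiableAt ℂ k y ∧ R (fderiv ℂ k y) = 0 := by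
    have : Tendsto Θ.symm (𝓝 (Ψ 0)) (𝓝 0) := by
      have := hΘs.continuousAt.tendsto
      rwa [hΘs0] at this
    filter_upwards [this.eventually hg1, hk.eventually (by simp), Θ.open_target.mem_nhds hΘ0]
      with y h1 h2 h3
    rw [show Ψ (Θ.symm y) = y from Θ.right_inv h3] at h1
    exact ⟨h2.differentiableAt (by simp), h1⟩
  obtain ⟨ρ, hρ, hball⟩ := Metric.eventually_nhds_iff_ball.1 hk0
  -- For the sup norm on the product, slices of the ball are balls, hence convex; they contain the
  -- second entry `0` because `π 0 = 0`.
  have hconst : ∀ e q, (e, q) ∈ Metric.ball (Ψ 0) ρ → k (e, q) = k (e, 0) := by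
    intro e q heq
    rw [← ball_prod_same] at heq
    have h1 := (convex_ball (Ψ 0).2 ρ).is_const_of_fderivWithin_eq_zero (𝕜 := ℂ)
      (f := fun q => k (e, q)) ?_ ?_ heq.2 (y := 0) ?_
    · exact h1
    · intro q' hq'
      have := (hball (e, q') (by rw [← ball_prod_same]; exact ⟨heq.1, hq'⟩)).1
      exact (this.comp q' (hasFDerivAt_prodMk_right e q').differentiableAt).differentiableWithinAt
    · intro q' hq'
      have h2 := hball (e, q') (by rw [← ball_prod_same]; exact ⟨heq.1, hq'⟩)
      rw [fderivWithin_of_isOpen Metric.isOpen_ball hq']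
      have h3 : HasFDerivAt (fun q => k (e, q)) _ q' :=
        h2.1.hasFDerivAt.comp q' (hasFDerivAt_prodMk_right e q')
      rw [h3.fderiv]
      exact h2.2
    · simp [Ψ, hρ]
  refine ⟨fun e => k (e, 0), ?_, ?_⟩
  · have h1 : ContDiffAt ℂ ω (fun e : E => (e, (0 : A.ker))) (σ 0) :=
      contDiffAt_id.prodMk contDiffAt_const
    have h2 : Ψ 0 = (σ 0, 0) := by simp [Ψ, hS0]
    rw [h2] at hk
    exact ContDiffAt.comp (g := k) (σ 0) hk h1
  · have h1 : ∀ᶠ w in 𝓝 0, Ψ w ∈ Metric.ball (Ψ 0) ρ :=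
      hΨ.continuousAt.eventually (Metric.ball_mem_nhds _ hρ)
    filter_upwards [ht.eventually h1, ht.eventually hHk, hSσ, hHh] with x h1 h2 h3 h4
    have := hconst _ _ h1
    rw [← h4, ← h2, this, ← h3]

/-! ### Real and complex differentiability on complex manifolds -/

section MD

variable {𝕜 : Type*} [NontriviallyNormedField 𝕜] {E E' E'' : Type*}
    [NormedAddCommGroup E] [NormedSpace 𝕜 E] [NormedAddCommGroup E'] [NormedSpace 𝕜 E']
    [NormedAddCommGroup E''] [NormedSpace 𝕜 E'']
    {Z Z' Z'' : Type*} [TopologicalSpace Z] [ChartedSpace E Z] [TopologicalSpace Z']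
    [ChartedSpace E' Z'] [TopologicalSpace Z''] [ChartedSpace E'' Z'']

variable (𝕜 E E') in
/-- The manifold derivative, as a map between the model vector spaces. -/
noncomputable def mD (f : Z → Z') (p : Z) : E →L[𝕜] E' := mfderiv 𝓘(𝕜, E) 𝓘(𝕜, E') f p

theorem hasMFDerivAt_mD {f : Z → Z'} {p : Z} (hf : MDifferentiableAt 𝓘(𝕜, E) 𝓘(𝕜, E') f p) :
    HasMFDerivAt 𝓘(𝕜, E) 𝓘(𝕜, E') f p (mD 𝕜 E E' f p) := hf.hasMFDerivAt

theorem mD_eq {f : Z → Z'} {p : Z} {f' : E →L[𝕜] E'}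
    (h : HasMFDerivAt 𝓘(𝕜, E) 𝓘(𝕜, E') f p f') : mD 𝕜 E E' f p = f' := h.mfderiv

theorem hasMFDerivAt_of_eq {f : Z → Z'} {p : Z} {f' f'' : E →L[𝕜] E'}
    (h : HasMFDerivAt 𝓘(𝕜, E) 𝓘(𝕜, E') f p f') (e : f' = f'') :
    HasMFDerivAt 𝓘(𝕜, E) 𝓘(𝕜, E') f p f'' := e ▸ h

theorem mD_comp {f : Z → Z'} {g : Z' → Z''} {p : Z}
    (hf : MDifferentiableAt 𝓘(𝕜, E) 𝓘(𝕜, E') f p)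
    (hg : MDifferentiableAt 𝓘(𝕜, E') 𝓘(𝕜, E'') g (f p)) :
    mD 𝕜 E E'' (fun q => g (f q)) p = (mD 𝕜 E' E'' g (f p)).comp (mD 𝕜 E E' f p) :=
  mD_eq (hg.hasMFDerivAt.comp p hf.hasMFDerivAt)

theorem mD_congr {f g : Z → Z'} {p : Z} (h : f =ᶠ[𝓝 p] g) :
    mD 𝕜 E E' f p = mD 𝕜 E E' g p := h.mfderiv_eq

theorem mD_id (p : Z) : mD 𝕜 E E (fun q : Z => q) p = ContinuousLinearMap.id 𝕜 E :=
  mD_eq (hasMFDerivAt_id p)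

theorem mD_eq_fderiv (f : E → E') (x : E) : mD 𝕜 E E' f x = fderiv 𝕜 f x := mfderiv_eq_fderiv

theorem mD_left_inverse {f : Z → Z'} {g : Z' → Z} {p : Z}
    (hf : MDifferentiableAt 𝓘(𝕜, E) 𝓘(𝕜, E') f p)
    (hg : MDifferentiableAt 𝓘(𝕜, E') 𝓘(𝕜, E) g (f p)) (hgf : ∀ᶠ q in 𝓝 p, g (f q) = q) (v : E) :
    mD 𝕜 E' E g (f p) (mD 𝕜 E E' f p v) = v := by
  rw [← ContinuousLinearMap.comp_apply, ← mD_comp hf hg, mD_congr hgf, mD_id]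
  rfl

end MD

theorem comp_smulRight_one {W G : Type*} [NormedAddCommGroup W] [NormedSpace ℝ W]
    [NormedAddCommGroup G] [NormedSpace ℝ G] (D : W →L[ℝ] G) (w : W) :
    D.comp ((1 : ℝ →L[ℝ] ℝ).smulRight w) = (1 : ℝ →L[ℝ] ℝ).smulRight (D w) := by
  ext; simp

theorem hasMFDerivAt_comp_curve {E E' : Type*} [NormedAddCommGroup E] [NormedSpace ℝ E]
    [NormedAddCommGroup E'] [NormedSpace ℝ E'] {Z Z' : Type*} [TopologicalSpace Z]
    [ChartedSpace E Z] [TopologicalSpace Z'] [ChartedSpace E' Z'] {f : Z → Z'} {γ : ℝ → Z} {p : Z}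
    {w : E} (hf : MDifferentiableAt 𝓘(ℝ, E) 𝓘(ℝ, E') f p) (h0 : γ 0 = p)
    (hγ : HasMFDerivAt 𝓘(ℝ, ℝ) 𝓘(ℝ, E) γ 0 ((1 : ℝ →L[ℝ] ℝ).smulRight w)) :
    HasMFDerivAt 𝓘(ℝ, ℝ) 𝓘(ℝ, E') (fun t => f (γ t)) 0
      ((1 : ℝ →L[ℝ] ℝ).smulRight (mD ℝ E E' f p w)) := by
  subst h0
  exact hasMFDerivAt_of_eq ((hasMFDerivAt_mD hf).comp (0 : ℝ) hγ) 
    (comp_smulRight_one (mD ℝ E E' f (γ 0)) w)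

section RealComplex

variable {E : Type v} [NormedAddCommGroup E] [NormedSpace ℂ E]
  {Z : Type u} [TopologicalSpace Z] [ChartedSpace E Z]
  {E' : Type v'} [NormedAddCommGroup E'] [NormedSpace ℂ E']
  {Z' : Type u'} [TopologicalSpace Z'] [ChartedSpace E' Z']

theorem isManifold_real [IsManifold 𝓘(ℂ, E) ω Z] : IsManifold 𝓘(ℝ, E) ω Z := by
  refine isManifold_of_contDiffOn _ _ _ fun e e' he he' => ?_
  have h := ((contDiffGroupoid ω 𝓘(ℂ, E)).compatible he he')
  have h1 := (mem_groupoid_of_pregroupoid.1 h).1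
  exact ContDiffOn.restrict_scalars ℝ h1

theorem contMDiffAt_real {f : Z → Z'} {p : Z} (h : ContMDiffAt 𝓘(ℂ, E) 𝓘(ℂ, E') ω f p) :
    ContMDiffAt 𝓘(ℝ, E) 𝓘(ℝ, E') ω f p := by
  rw [contMDiffAt_iff] at h ⊢
  exact ⟨h.1, h.2.restrict_scalars ℝ⟩

theorem hasMFDerivAt_real {f : Z → Z'} {p : Z} {f' : E →L[ℂ] E'}
    (h : HasMFDerivAt 𝓘(ℂ, E) 𝓘(ℂ, E') f p f') :
    HasMFDerivAt 𝓘(ℝ, E) 𝓘(ℝ, E') f p (f'.restrictScalars ℝ) :=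
  ⟨h.1, HasFDerivWithinAt.restrictScalars ℝ h.2⟩

theorem mD_real {f : Z → Z'} {p : Z} (h : MDifferentiableAt 𝓘(ℂ, E) 𝓘(ℂ, E') f p) :
    mD ℝ E E' f p = (mD ℂ E E' f p).restrictScalars ℝ :=
  mD_eq (hasMFDerivAt_real h.hasMFDerivAt)

theorem mD_real_apply {f : Z → Z'} {p : Z} (h : MDifferentiableAt 𝓘(ℂ, E) 𝓘(ℂ, E') f p) (v : E) :
    mD ℝ E E' f p v = mD ℂ E E' f p v := by
  rw [mD_real h]; rfl

variable (E) in
/-- The tangent space of `M` at `p`, as a subspace of the model vector space. -/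
noncomputable def Tan (M : Set Z) (p : Z) : Submodule ℝ E := tangentAt E M p

theorem mdifferentiableAt_real {f : Z → Z'} {p : Z}
    (h : MDifferentiableAt 𝓘(ℂ, E) 𝓘(ℂ, E') f p) : MDifferentiableAt 𝓘(ℝ, E) 𝓘(ℝ, E') f p :=
  (hasMFDerivAt_real h.hasMFDerivAt).mdifferentiableAt

theorem eventually_contMDiffAt {𝕜 : Type*} [NontriviallyNormedField 𝕜] {E E' : Type*}
    [NormedAddCommGroup E] [NormedSpace 𝕜 E] [NormedAddCommGroup E'] [NormedSpace 𝕜 E']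
    {Z Z' : Type*} [TopologicalSpace Z] [ChartedSpace E Z] [TopologicalSpace Z']
    [ChartedSpace E' Z'] [IsManifold 𝓘(𝕜, E) ω Z] [IsManifold 𝓘(𝕜, E') ω Z'] {f : Z → Z'} {p : Z}
    (hf : ContMDiffAt 𝓘(𝕜, E) 𝓘(𝕜, E') ω f p) :
    ∀ᶠ q in 𝓝 p, ContMDiffAt 𝓘(𝕜, E) 𝓘(𝕜, E') ω f q :=
  (contMDiffAt_iff_contMDiffAt_nhds (by simp)).1 hf

theorem eventually_mdifferentiableAt {𝕜 : Type*} [NontriviallyNormedField 𝕜] {E E' : Type*}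
    [NormedAddCommGroup E] [NormedSpace 𝕜 E] [NormedAddCommGroup E'] [NormedSpace 𝕜 E']
    {Z Z' : Type*} [TopologicalSpace Z] [ChartedSpace E Z] [TopologicalSpace Z']
    [ChartedSpace E' Z'] [IsManifold 𝓘(𝕜, E) ω Z] [IsManifold 𝓘(𝕜, E') ω Z'] {f : Z → Z'} {p : Z}
    (hf : ContMDiffAt 𝓘(𝕜, E) 𝓘(𝕜, E') ω f p) :
    ∀ᶠ q in 𝓝 p, MDifferentiableAt 𝓘(𝕜, E) 𝓘(𝕜, E') f q := by
  filter_upwards [eventually_contMDiffAt hf] with q hq using hq.mdifferentiableAt (by simp)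

theorem mem_Tan_of_curve {M : Set Z} {p : Z} {γ : ℝ → Z} {v : E} (h0 : γ 0 = p)
    (hM : ∀ᶠ t in 𝓝 0, γ t ∈ M)
    (h : HasMFDerivAt 𝓘(ℝ, ℝ) 𝓘(ℝ, E) γ 0 ((1 : ℝ →L[ℝ] ℝ).smulRight v)) : v ∈ Tan E M p := by
  have : v ∈ tangentAt E M p := Submodule.subset_span ⟨γ, h0, hM, h⟩
  exact this

theorem Tan_le {M : Set Z} {p : Z} {S : Submodule ℝ E}
    (h : ∀ (v : E) (γ : ℝ → Z), γ 0 = p → (∀ᶠ t in 𝓝 0, γ t ∈ M) →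
      HasMFDerivAt 𝓘(ℝ, ℝ) 𝓘(ℝ, E) γ 0 ((1 : ℝ →L[ℝ] ℝ).smulRight v) → v ∈ S) :
    Tan E M p ≤ S := by
  refine Submodule.span_le.2 ?_
  rintro v ⟨γ, h0, hM, hγ⟩
  exact h v γ h0 hM hγ

/-- The derivative along `M` of a map depends only on its restriction to `M`. -/
theorem mD_congr_of_mem_Tan {M : Set Z} {p : Z} {f g : Z → Z'}
    (hf : MDifferentiableAt 𝓘(ℝ, E) 𝓘(ℝ, E') f p) (hg : MDifferentiableAt 𝓘(ℝ, E) 𝓘(ℝ, E') g p)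
    (hfg : ∀ᶠ q in 𝓝[M] p, f q = g q) {v : E} (hv : v ∈ Tan E M p) :
    mD ℝ E E' f p v = mD ℝ E E' g p v := by
  suffices h : Tan E M p ≤
      LinearMap.ker ((mD ℝ E E' f p - mD ℝ E E' g p : E →L[ℝ] E') : E →ₗ[ℝ] E') from
    sub_eq_zero.1 (h hv)
  refine Tan_le fun w γ hγ0 hγM hγ => ?_
  have h1 := hasMFDerivAt_comp_curve hf hγ0 hγ
  have h2 := hasMFDerivAt_comp_curve hg hγ0 hγ
  have h3 : Tendsto γ (𝓝 0) (𝓝[M] p) :=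
    tendsto_nhdsWithin_iff.2 ⟨hγ0 ▸ hγ.continuousAt, hγM⟩
  have h4 : (fun t => f (γ t)) =ᶠ[𝓝 0] fun t => g (γ t) := h3.eventually hfg
  have h5 := hasMFDerivAt_unique (h2.congr_of_eventuallyEq h4) h1
  have h6 : (1 : ℝ) • mD ℝ E E' g p w = (1 : ℝ) • mD ℝ E E' f p w :=
    congrArg (fun l : ℝ →L[ℝ] E' => l 1) h5
  rw [one_smul, one_smul] at h6
  exact sub_eq_zero.2 h6.symm

/-- Composition with `f` turns curves in `M` through `p` into curves in `N`. -/
theorem mD_mem_Tan {M : Set Z} {N : Set Z'} {p : Z} {f : Z → Z'}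
    (hf : MDifferentiableAt 𝓘(ℝ, E) 𝓘(ℝ, E') f p)
    (hfN : ∀ᶠ q in 𝓝[M] p, f q ∈ N) {v : E} (hv : v ∈ Tan E M p) :
    mD ℝ E E' f p v ∈ Tan E' N (f p) := by
  suffices h : Tan E M p ≤ (Tan E' N (f p)).comap (mD ℝ E E' f p : E →ₗ[ℝ] E') from h hv
  refine Tan_le fun w γ hγ0 hγM hγ => ?_
  have h3 : Tendsto γ (𝓝 0) (𝓝[M] p) :=
    tendsto_nhdsWithin_iff.2 ⟨hγ0 ▸ hγ.continuousAt, hγM⟩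
  exact mem_Tan_of_curve (congrArg f hγ0) (h3.eventually hfN) (hasMFDerivAt_comp_curve hf hγ0 hγ)

/-- If `g ∘ f = id` along `M`, the same holds for the derivatives along `M`. -/
theorem mD_left_inverse_of_mem_Tan {M : Set Z} {p : Z} {f : Z → Z'} {g : Z' → Z}
    (hf : MDifferentiableAt 𝓘(ℝ, E) 𝓘(ℝ, E') f p)
    (hg : MDifferentiableAt 𝓘(ℝ, E') 𝓘(ℝ, E) g (f p))
    (hgf : ∀ᶠ q in 𝓝[M] p, g (f q) = q) {v : E} (hv : v ∈ Tan E M p) :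
    mD ℝ E' E g (f p) (mD ℝ E E' f p v) = v := by
  rw [← ContinuousLinearMap.comp_apply, ← mD_comp hf hg,
    mD_congr_of_mem_Tan (f := fun q => g (f q)) (g := fun q => q) (hg.comp p hf) mdifferentiableAt_id hgf hv, mD_id]
  rfl

end RealComplex

/-! ### Local parametrizations of submanifolds -/

/-- `σ` parametrizes `S` near `a` with left inverse `c`, both real-analytic. -/
structure IsParam (W : Type*) [NormedAddCommGroup W] [NormedSpace ℝ W] {X : Type*}
    [TopologicalSpace X] [ChartedSpace W X] (S : Set X) (a : X) {P : Type*}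
    [NormedAddCommGroup P] [NormedSpace ℝ P] (σ : P → X) (c : X → P) : Prop where
  smooth : ContMDiffAt 𝓘(ℝ, P) 𝓘(ℝ, W) ω σ 0
  map_zero : σ 0 = a
  mem : ∀ᶠ x in 𝓝 0, σ x ∈ S
  smooth_inv : ContMDiffAt 𝓘(ℝ, W) 𝓘(ℝ, P) ω c a
  inv_base : c a = 0
  right_inv : ∀ᶠ p in 𝓝[S] a, σ (c p) = p
  left_inv : ∀ᶠ x in 𝓝 0, c (σ x) = x

section Param

variable {W : Type*} [NormedAddCommGroup W] [NormedSpace ℝ W] {X : Type*}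
    [TopologicalSpace X] [ChartedSpace W X] {S : Set X} {a : X}

/-- A flattening chart, translated so that `a` goes to `0`, parametrizes `S` by `L`. A linear
projection onto `L` extends the inverse from `S` to an analytic map near `a` in the ambient
manifold. -/
theorem IsAnalyticSubmanifold.exists_isParam [FiniteDimensional ℝ W] [IsManifold 𝓘(ℝ, W) ω X]
    (hS : IsAnalyticSubmanifold W S) (ha : a ∈ S) :
    ∃ (L : Submodule ℝ W) (σ : L → X) (c : X → L), IsParam W S a σ c := by
  have : CompleteSpace W := FiniteDimensional.complete ℝ W
  obtain ⟨Φ, hΦ, haΦ, L, hL⟩ := hS a ha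
  obtain ⟨π, hπ⟩ := Submodule.ClosedComplemented.of_finiteDimensional_quotient (𝕜 := ℝ)
    (p := L) (Submodule.closed_of_finiteDimensional _)
  have haL : Φ a ∈ L := (hL a haΦ).1 ha
  have hi : ContDiff ℝ ω (fun l : L => Φ a + l) :=
    contDiff_const.add L.subtypeL.contDiff
  have hi0 : Φ a + ((0 : L) : W) = Φ a := by simp
  have ht : ∀ᶠ l : L in 𝓝 0, Φ a + l ∈ Φ.target := by
    have : Φ.target ∈ 𝓝 (Φ a + ((0 : L) : W)) := by
      rw [hi0]; exact Φ.open_target.mem_nhds (Φ.map_source haΦ)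
    exact hi.continuous.continuousAt.eventually this
  have hs : ∀ᶠ p in 𝓝 a, p ∈ Φ.source := Φ.open_source.mem_nhds haΦ
  refine ⟨L, fun l => Φ.symm (Φ a + l), fun p => π (Φ p - Φ a), ?_, ?_, ?_, ?_, ?_, ?_, ?_⟩
  · refine ContMDiffAt.comp (0 : L) (I' := 𝓘(ℝ, W)) ?_ hi.contMDiff.contMDiffAt
    rw [hi0]
    exact contMDiffAt_symm_of_mem_maximalAtlas hΦ (Φ.map_source haΦ)
  · simp [haΦ]
  · filter_upwards [ht] with l hl
    rw [hL _ (Φ.map_target hl), Φ.right_inv hl]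
    exact add_mem haL l.2
  · have h1 : ContDiff ℝ ω fun y : W => π (y - Φ a) :=
      π.contDiff.comp (contDiff_id.sub contDiff_const)
    exact ContMDiffAt.comp (g := fun y : W => π (y - Φ a)) a (I' := 𝓘(ℝ, W)) h1.contMDiff.contMDiffAt
      (contMDiffAt_of_mem_maximalAtlas hΦ haΦ)
  · simp
  · filter_upwards [hs.filter_mono nhdsWithin_le_nhds, self_mem_nhdsWithin] with p hp hpS
    have h1 : Φ p - Φ a ∈ L := sub_mem ((hL p hp).1 hpS) haL
    have h2 : ((π (Φ p - Φ a) : L) : W) = Φ p - Φ a := congrArg Subtype.val (hπ ⟨_, h1⟩)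
    rw [h2, add_sub_cancel, Φ.left_inv hp]
  · filter_upwards [ht] with l hl
    rw [Φ.right_inv hl, add_sub_cancel_left, hπ]

variable {P P' : Type*} [NormedAddCommGroup P] [NormedSpace ℝ P] [NormedAddCommGroup P']
  [NormedSpace ℝ P'] {σ : P → X} {c : X → P}

theorem IsParam.reparam (h : IsParam W S a σ c) (e : P' ≃L[ℝ] P) :
    IsParam W S a (fun x => σ (e x)) (fun p => e.symm (c p)) where
  smooth := by
    refine ContMDiffAt.comp (0 : P') (I' := 𝓘(ℝ, P)) ?_ e.contDiff.contMDiff.contMDiffAt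
    rw [_root_.map_zero]; exact h.smooth
  map_zero := by rw [_root_.map_zero, h.map_zero]
  mem := by
    have : Tendsto e (𝓝 0) (𝓝 0) := by simpa using e.continuous.tendsto 0
    exact this.eventually h.mem
  smooth_inv := ContMDiffAt.comp a (I' := 𝓘(ℝ, P)) e.symm.contDiff.contMDiff.contMDiffAt
    h.smooth_inv
  inv_base := by rw [h.inv_base, _root_.map_zero]
  right_inv := by
    filter_upwards [h.right_inv] with p hp
    simpa using hp
  left_inv := by
    have : Tendsto e (𝓝 0) (𝓝 0) := by simpa using e.continuous.tendsto 0
    filter_upwards [this.eventually h.left_inv] with x hx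
    rw [hx, e.symm_apply_apply]

theorem IsParam.exists_fin [FiniteDimensional ℝ P] (h : IsParam W S a σ c) :
    ∃ (m : ℕ) (σ : (Fin m → ℝ) → X) (c : X → (Fin m → ℝ)), IsParam W S a σ c :=
  ⟨_, _, _, h.reparam (ContinuousLinearEquiv.ofFinrankEq
    (by simp) : (Fin (Module.finrank ℝ P) → ℝ) ≃L[ℝ] P)⟩

theorem IsParam.tendsto (h : IsParam W S a σ c) : Tendsto σ (𝓝 0) (𝓝[S] a) :=
  tendsto_nhdsWithin_iff.2 ⟨h.map_zero ▸ h.smooth.continuousAt, h.mem⟩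

end Param

/-! ### Derivatives of holomorphic charts -/

section Chart

variable {E : Type v} [NormedAddCommGroup E] [NormedSpace ℂ E]
  {Z : Type u} [TopologicalSpace Z] [ChartedSpace E Z] [IsManifold 𝓘(ℂ, E) ω Z]

theorem contMDiffAt_chart (a : Z) {p : Z} (hp : p ∈ (chartAt E a).source) :
    ContMDiffAt 𝓘(ℂ, E) 𝓘(ℂ, E) ω (chartAt E a) p :=
  contMDiffOn_chart.contMDiffAt ((chartAt E a).open_source.mem_nhds hp)

theorem contMDiffAt_chart_symm (a : Z) {e : E} (he : e ∈ (chartAt E a).target) :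
    ContMDiffAt 𝓘(ℂ, E) 𝓘(ℂ, E) ω (chartAt E a).symm e :=
  contMDiffOn_chart_symm.contMDiffAt ((chartAt E a).open_target.mem_nhds he)

/-- The derivative at `p` of the chart at `a`, as an isomorphism. -/
noncomputable def chartDeriv (a p : Z) (hp : p ∈ (chartAt E a).source) : E ≃L[ℂ] E :=
  ContinuousLinearEquiv.equivOfInverse (mD ℂ E E (chartAt E a) p)
    (mD ℂ E E (chartAt E a).symm (chartAt E a p))
    (mD_left_inverse ((contMDiffAt_chart a hp).mdifferentiableAt (by simp))
      ((contMDiffAt_chart_symm a ((chartAt E a).map_source hp)).mdifferentiableAt (by simp))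
      (by filter_upwards [(chartAt E a).open_source.mem_nhds hp] with q hq
          using (chartAt E a).left_inv hq))
    (fun v => by
      have h := (chartAt E a).map_source hp
      have := mD_left_inverse (g := chartAt E a)
        ((contMDiffAt_chart_symm a h).mdifferentiableAt (by simp))
        (by rw [(chartAt E a).left_inv hp]
            exact (contMDiffAt_chart a hp).mdifferentiableAt (by simp))
        (by filter_upwards [(chartAt E a).open_target.mem_nhds h] with q hq
            using (chartAt E a).right_inv hq) v
      rwa [(chartAt E a).left_inv hp] at this)

theorem mD_chart (a : Z) {p : Z} (hp : p ∈ (chartAt E a).source) :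
    mD ℂ E E (chartAt E a) p = chartDeriv a p hp := rfl

theorem mdifferentiableAt_chart (a : Z) {p : Z} (hp : p ∈ (chartAt E a).source) :
    MDifferentiableAt 𝓘(ℂ, E) 𝓘(ℂ, E) (chartAt E a) p :=
  (contMDiffAt_chart a hp).mdifferentiableAt (by simp)

end Chart

/-! ### Holomorphic extension of CR maps between manifolds -/

section Extension

variable {E : Type v} [NormedAddCommGroup E] [NormedSpace ℂ E]
  {Z : Type u} [TopologicalSpace Z] [ChartedSpace E Z]
  {E' : Type v'} [NormedAddCommGroup E'] [NormedSpace ℂ E']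
  {Z' : Type u'} [TopologicalSpace Z'] [ChartedSpace E' Z']
  {P : Type*} [NormedAddCommGroup P] [NormedSpace ℝ P] {M : Set Z} {a : Z} {σ : P → Z} {c : Z → P}

theorem mD_param_mem_Tan {x : P} (hσ : MDifferentiableAt 𝓘(ℝ, P) 𝓘(ℝ, E) σ x)
    (hM : ∀ᶠ y in 𝓝 x, σ y ∈ M) (u : P) : mD ℝ P E σ x u ∈ Tan E M (σ x) := by
  have h0 : HasDerivAt (fun t : ℝ => x + t • u) u 0 := by
    simpa using ((hasDerivAt_id (0 : ℝ)).smul_const u).const_add x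
  have h1 : HasMFDerivAt 𝓘(ℝ, ℝ) 𝓘(ℝ, P) (fun t : ℝ => x + t • u) 0
      ((1 : ℝ →L[ℝ] ℝ).smulRight u) := h0.hasFDerivAt.hasMFDerivAt
  have h00 : x + (0 : ℝ) • u = x := by simp
  rw [← h00] at hσ
  have h2 := hasMFDerivAt_comp_curve hσ rfl h1
  rw [h00] at h2
  have h3 : Tendsto (fun t : ℝ => x + t • u) (𝓝 0) (𝓝 x) := by
    simpa using h0.continuousAt.tendsto
  exact mem_Tan_of_curve (congrArg σ h00) (h3.eventually hM) h2

/-- `σ ∘ c` is the identity on `M`, and derivatives along tangent vectors only see values on `M`.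
The tangent space thus lies in the image of `dσ`, which transfers genericity to the parametrization.
-/
theorem IsParam.mD_right_inverse (h : IsParam E M a σ c)
    {v : E} (hv : v ∈ Tan E M a) : mD ℝ P E σ 0 (mD ℝ E P c a v) = v := by
  have hσ : MDifferentiableAt 𝓘(ℝ, P) 𝓘(ℝ, E) σ (c a) := by
    rw [h.inv_base]; exact h.smooth.mdifferentiableAt (by simp)
  have hc : MDifferentiableAt 𝓘(ℝ, E) 𝓘(ℝ, P) c a := h.smooth_inv.mdifferentiableAt (by simp)
  rw [← h.inv_base, ← ContinuousLinearMap.comp_apply, ← mD_comp hc hσ,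
    mD_congr_of_mem_Tan (f := fun q => σ (c q)) (g := fun q => q) (hσ.comp a hc) mdifferentiableAt_id h.right_inv hv, mD_id]
  rfl

variable [FiniteDimensional ℂ E] [IsManifold 𝓘(ℂ, E) ω Z] [FiniteDimensional ℂ E']
  [IsManifold 𝓘(ℂ, E') ω Z']

/-- Real-analytic CR maps on a generic submanifold are restrictions of holomorphic maps. -/
theorem IsCRMapGerm.exists_extension [FiniteDimensional ℝ P] (h : IsParam E M a σ c)
    (hspan : Submodule.span ℂ (Tan E M a : Set E) = ⊤)
    {N : Set Z'} {f : Z → Z'} (hf : IsCRMapGerm E E' M a N f) :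
    ∃ F : Z → Z', ContMDiffAt 𝓘(ℂ, E) 𝓘(ℂ, E') ω F a ∧ F a = f a ∧ ∀ᶠ p in 𝓝[M] a, F p = f p := by
  obtain ⟨m, σ, c, h⟩ := h.exists_fin
  have : CompleteSpace E' := FiniteDimensional.complete ℂ E'
  have : IsManifold 𝓘(ℝ, E) ω Z := isManifold_real
  have : IsManifold 𝓘(ℝ, E') ω Z' := isManifold_real
  let κ := chartAt E a
  let κ' := chartAt E' (f a)
  have haκ : a ∈ κ.source := mem_chart_source E a
  have haκ' : f a ∈ κ'.source := mem_chart_source E' (f a)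
  have hfa : ContMDiffAt 𝓘(ℝ, E) 𝓘(ℝ, E') ω f (σ 0) := by
    rw [h.map_zero]; exact hf.analytic
  have hs : ContDiffAt ℝ ω (fun x => κ (σ x)) 0 := by
    rw [← contMDiffAt_iff_contDiffAt]
    refine ContMDiffAt.comp (g := κ) 0 (contMDiffAt_real (contMDiffAt_chart a ?_)) h.smooth
    rw [h.map_zero]; exact haκ
  have hh : ContDiffAt ℝ ω (fun x => κ' (f (σ x))) 0 := by
    rw [← contMDiffAt_iff_contDiffAt]
    refine ContMDiffAt.comp (g := κ') 0 (contMDiffAt_real (contMDiffAt_chart (f a) ?_))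
      (hfa.comp 0 h.smooth)
    simp only [h.map_zero]; exact haκ'
  have hds : ∀ x, MDifferentiableAt 𝓘(ℝ, Fin m → ℝ) 𝓘(ℝ, E) σ x →
      ∀ hx : σ x ∈ κ.source, ∀ u, fderiv ℝ (fun x => κ (σ x)) x u =
        chartDeriv a (σ x) hx (mD ℝ (Fin m → ℝ) E σ x u) := by
    intro x h1 hx u
    have h2 := mdifferentiableAt_chart a hx
    rw [← mD_eq_fderiv, mD_comp h1 (mdifferentiableAt_real h2), mD_real h2, mD_chart a hx]
    rfl
  have hdh : ∀ x, MDifferentiableAt 𝓘(ℝ, Fin m → ℝ) 𝓘(ℝ, E) σ x →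
      MDifferentiableAt 𝓘(ℝ, E) 𝓘(ℝ, E') f (σ x) →
      ∀ hx : f (σ x) ∈ κ'.source, ∀ u, fderiv ℝ (fun x => κ' (f (σ x))) x u =
        chartDeriv (f a) (f (σ x)) hx (mD ℝ E E' f (σ x) (mD ℝ (Fin m → ℝ) E σ x u)) := by
    intro x h1 h2 hx u
    have h3 := mdifferentiableAt_chart (f a) hx
    rw [← mD_eq_fderiv, mD_comp (f := fun x => f (σ x)) (h2.comp x h1) (mdifferentiableAt_real h3),
      mD_comp h1 h2, mD_real h3, mD_chart (f a) hx]
    rfl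
  have hσd := eventually_mdifferentiableAt h.smooth
  have hspan' : Submodule.span ℂ (range (fderiv ℝ (fun x => κ (σ x)) 0)) = ⊤ := by
    have hσ0 : σ 0 ∈ κ.source := by rw [h.map_zero]; exact haκ
    let D : E →L[ℂ] E := chartDeriv a (σ 0) hσ0
    have h1 : Submodule.span ℂ (Tan E M a : Set E) ≤ (Submodule.span ℂ
        (range (fderiv ℝ (fun x => κ (σ x)) 0))).comap (D : E →ₗ[ℂ] E) := by
      rw [Submodule.span_le]
      intro v hv
      refine Submodule.subset_span ⟨mD ℝ E (Fin m → ℝ) c a v, ?_⟩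
      rw [hds 0 hσd.self_of_nhds hσ0]
      rw [h.mD_right_inverse hv]; rfl
    rw [eq_top_iff]
    intro e _
    have h2 : (chartDeriv a (σ 0) hσ0).symm e ∈
        Submodule.span ℂ (Tan E M a : Set E) := hspan ▸ Submodule.mem_top
    simpa [D] using h1 h2
  have hcr' : ∀ᶠ x in 𝓝 0, ∀ u v, fderiv ℝ (fun x => κ (σ x)) x u +
      Complex.I • fderiv ℝ (fun x => κ (σ x)) x v = 0 →
      fderiv ℝ (fun x => κ' (f (σ x))) x u +
        Complex.I • fderiv ℝ (fun x => κ' (f (σ x))) x v = 0 := by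
    have e1 : ∀ᶠ x in 𝓝 0, σ x ∈ κ.source :=
      h.smooth.continuousAt.eventually (by rw [h.map_zero]; exact κ.open_source.mem_nhds haκ)
    have e2 : ∀ᶠ x in 𝓝 0, f (σ x) ∈ κ'.source := by
      refine (hfa.continuousAt.comp h.smooth.continuousAt).eventually ?_
      simp only [Function.comp, h.map_zero]; exact κ'.open_source.mem_nhds haκ'
    have e3 : ∀ᶠ x in 𝓝 0, MDifferentiableAt 𝓘(ℝ, E) 𝓘(ℝ, E') f (σ x) :=
      h.smooth.continuousAt.eventually (eventually_mdifferentiableAt hfa)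
    filter_upwards [e1, e2, e3, hσd, h.tendsto.eventually hf.cr,
      eventually_eventually_nhds.2 h.mem] with x h1 h2 h3 h4 h5 h6 u v huv
    rw [hds x h4 h1, hds x h4 h1, ← map_smul, ← map_add, EmbeddingLike.map_eq_zero_iff] at huv
    rw [hdh x h4 h3 h2, hdh x h4 h3 h2, ← map_smul, ← map_add, EmbeddingLike.map_eq_zero_iff]
    have hu := mD_param_mem_Tan h4 h6 u
    have hv := mD_param_mem_Tan h4 h6 v
    generalize mD ℝ (Fin m → ℝ) E σ x u = U at hu huv ⊢
    generalize mD ℝ (Fin m → ℝ) E σ x v = V at hv huv ⊢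
    -- The relation puts `U` and `V` into the holomorphic tangent space, the only place where the
    -- differential of `f` is known to be complex linear.
    have hUV : U = -(Complex.I • V) := eq_neg_of_add_eq_zero_left huv
    have hIV : (Complex.I • V : E) ∈ Tan E M (σ x) := by
      have := neg_mem hu
      rw [hUV] at this
      simpa using this
    have h7 : mD ℝ E E' f (σ x) (Complex.I • V) = Complex.I • mD ℝ E E' f (σ x) V :=
      (h5 V ⟨hv, hIV⟩).2
    rw [hUV, map_neg, h7, neg_add_cancel]
  obtain ⟨F, hF, hFσ⟩ := exists_holomorphic_extension hs hh hspan' hcr'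
  change ContDiffAt ℂ ω F (κ (σ 0)) at hF
  rw [h.map_zero] at hF
  have hFa : F (κ a) = κ' (f a) := by simpa [h.map_zero] using hFσ.self_of_nhds
  refine ⟨fun p => κ'.symm (F (κ p)), ?_, ?_, ?_⟩
  · refine ContMDiffAt.comp (g := κ'.symm) a (I' := 𝓘(ℂ, E'))
      (contMDiffAt_chart_symm (f a) ?_)
      (hF.contMDiffAt.comp a (contMDiffAt_chart a haκ))
    rw [hFa]; exact κ'.map_source haκ'
  · simp only [hFa]; exact κ'.left_inv haκ'
  · have ht : Tendsto c (𝓝[M] a) (𝓝 0) := by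
      have := h.smooth_inv.continuousAt.tendsto
      rw [h.inv_base] at this
      exact this.mono_left nhdsWithin_le_nhds
    have h1 : ∀ᶠ p in 𝓝[M] a, f p ∈ κ'.source :=
      (hf.analytic.continuousAt.eventually (κ'.open_source.mem_nhds haκ')).filter_mono
        nhdsWithin_le_nhds
    filter_upwards [ht.eventually hFσ, h.right_inv, h1] with p h2 h3 h4
    rw [h3] at h2
    rw [h2, κ'.left_inv h4]

end Extension

theorem hasMFDerivAt_curve_iff {W : Type*} [NormedAddCommGroup W] [NormedSpace ℝ W] {γ : ℝ → W}
    {w : W} {t : ℝ} : HasMFDerivAt 𝓘(ℝ, ℝ) 𝓘(ℝ, W) γ t ((1 : ℝ →L[ℝ] ℝ).smulRight w) ↔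
      HasDerivAt γ w t := by
  have h : ContinuousLinearMap.toSpanSingleton ℝ w = (1 : ℝ →L[ℝ] ℝ).smulRight w := by
    ext; simp
  rw [hasDerivAt_iff_hasFDerivAt, h]
  exact hasMFDerivAt_iff_hasFDerivAt

/-! ### Vector fields in charts and the identity principle for germs -/

section Local

variable {E : Type v} [NormedAddCommGroup E] [NormedSpace ℂ E] [FiniteDimensional ℂ E]
  {Z : Type u} [TopologicalSpace Z] [ChartedSpace E Z] [IsManifold 𝓘(ℂ, E) ω Z]

/-- The value of a vector field, as an element of the model vector space. -/
def val (X : Π p : Z, TangentSpace 𝓘(ℂ, E) p) (p : Z) : E := X p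

/-- A vector field in the chart at `a`. -/
noncomputable def loc (a : Z) (X : Π p : Z, TangentSpace 𝓘(ℂ, E) p) : E → E :=
  VectorField.mpullback 𝓘(ℂ, E) 𝓘(ℂ, E) (chartAt E a).symm X

theorem inverse_mD_chart_symm (a : Z) {p : Z} (hp : p ∈ (chartAt E a).source) :
    (mD ℂ E E (chartAt E a).symm (chartAt E a p)).inverse = chartDeriv a p hp := by
  have : mD ℂ E E (chartAt E a).symm (chartAt E a p) = (chartDeriv a p hp).symm := rfl
  rw [this, ContinuousLinearMap.inverse_equiv]
  simp

theorem loc_apply (a : Z) (X : Π p : Z, TangentSpace 𝓘(ℂ, E) p) {p : Z}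
    (hp : p ∈ (chartAt E a).source) : loc a X (chartAt E a p) = chartDeriv a p hp (val X p) := by
  have h1 : loc a X (chartAt E a p) = (mD ℂ E E (chartAt E a).symm (chartAt E a p)).inverse
    (val X ((chartAt E a).symm (chartAt E a p))) := rfl
  rw [h1, inverse_mD_chart_symm a hp, (chartAt E a).left_inv hp]
  rfl

theorem contDiffAt_loc {a : Z} {X : Π p : Z, TangentSpace 𝓘(ℂ, E) p} (hX : X ∈ holAt E a) :
    ContDiffAt ℂ ω (loc a X) (chartAt E a a) := by
  have : CompleteSpace E := FiniteDimensional.complete ℂ E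
  have : IsManifold 𝓘(ℂ, E) 1 Z := IsManifold.of_le (n := ω) le_top
  have ha := mem_chart_source E a
  have h0 := (chartAt E a).map_source ha
  refine contMDiffAt_vectorSpace_iff_contDiffAt.1 ?_
  refine ContMDiffAt.mpullback_vectorField_preimage (n := ω) ?_ (contMDiffAt_chart_symm a h0) ?_
    le_top
  · rw [(chartAt E a).left_inv ha]
    exact hX.self_of_nhds
  · exact ⟨(chartDeriv a a ha).symm, rfl⟩

theorem mlieBracket_vectorSpace (V W : E → E) (e : E) :
    (VectorField.mlieBracket 𝓘(ℂ, E) (V : Π x : E, TangentSpace 𝓘(ℂ, E) x) W e : E) =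
      VectorField.lieBracket ℂ V W e :=
  (congrFun VectorField.mlieBracketWithin_univ e).symm.trans
    ((congrFun VectorField.mlieBracketWithin_eq_lieBracketWithin e).trans
      (congrFun VectorField.lieBracketWithin_univ e))

/-- Brackets are natural under pull back by the inverse chart, so commutation of germs can be tested
with ordinary derivatives. -/
theorem eventually_loc_mlieBracket {a : Z} {X Y : Π p : Z, TangentSpace 𝓘(ℂ, E) p}
    (hX : X ∈ holAt E a) (hY : Y ∈ holAt E a) : ∀ᶠ e in 𝓝 (chartAt E a a),
      loc a (VectorField.mlieBracket 𝓘(ℂ, E) X Y) e =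
        VectorField.lieBracket ℂ (loc a X) (loc a Y) e := by
  have : CompleteSpace E := FiniteDimensional.complete ℂ E
  have : IsManifold 𝓘(ℂ, E) (minSmoothness ℂ 2) Z := IsManifold.of_le (n := ω) le_top
  have : IsManifold 𝓘(ℂ, E) (minSmoothness ℂ 3) Z := IsManifold.of_le (n := ω) le_top
  have h0 := mem_chart_target E a
  have ht : Tendsto (chartAt E a).symm (𝓝 (chartAt E a a)) (𝓝 a) := by
    have := (chartAt E a).continuousAt_symm h0
    rwa [ContinuousAt, (chartAt E a).left_inv (mem_chart_source E a)] at this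
  filter_upwards [ht.eventually (mdiffAt_of_mem hX), ht.eventually (mdiffAt_of_mem hY),
    (chartAt E a).open_target.mem_nhds h0] with e h1 h2 h3
  have h4 := VectorField.mpullback_mlieBracket h1 h2 (contMDiffAt_chart_symm a h3) le_top
  exact h4.trans (mlieBracket_vectorSpace _ _ e)

/-- The chart carries curves in `M` to curves in its image and has complex linear invertible
derivative. This makes the identity principle in vector spaces available for `M`. -/
theorem span_velocities_chart {M : Set Z} {a p : Z} (hp : p ∈ (chartAt E a).source)
    (hspan : Submodule.span ℂ (Tan E M p : Set E) = ⊤) :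
    Submodule.span ℂ {v : E | ∃ γ : ℝ → E, γ 0 = chartAt E a p ∧
      (∀ᶠ t in 𝓝 0, γ t ∈ (chartAt E a).target ∩ (chartAt E a).symm ⁻¹' M) ∧
      HasDerivAt γ v 0} = ⊤ := by
  set S := Submodule.span ℂ {v : E | ∃ γ : ℝ → E, γ 0 = chartAt E a p ∧
      (∀ᶠ t in 𝓝 0, γ t ∈ (chartAt E a).target ∩ (chartAt E a).symm ⁻¹' M) ∧ HasDerivAt γ v 0}
  let D : E →L[ℂ] E := chartDeriv a p hp
  have h1 : Tan E M p ≤ (S.comap (D : E →ₗ[ℂ] E)).restrictScalars ℝ := by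
    refine Tan_le fun v γ h0 hM hγ => ?_
    have h2 := hasMFDerivAt_comp_curve (mdifferentiableAt_real (mdifferentiableAt_chart a hp)) h0 hγ
    rw [mD_real_apply (mdifferentiableAt_chart a hp), mD_chart a hp] at h2
    have h3 : HasDerivAt (fun t => chartAt E a (γ t)) (D v) 0 :=
      hasMFDerivAt_curve_iff.1 h2
    refine Submodule.subset_span ⟨_, congrArg _ h0, ?_, h3⟩
    have h4 : ∀ᶠ t in 𝓝 0, γ t ∈ (chartAt E a).source :=
      hγ.continuousAt.eventually (by rw [h0]; exact (chartAt E a).open_source.mem_nhds hp)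
    filter_upwards [h4, hM] with t h5 h6
    refine ⟨(chartAt E a).map_source h5, ?_⟩
    rw [mem_preimage, (chartAt E a).left_inv h5]
    exact h6
  have h2 : Submodule.span ℂ (Tan E M p : Set E) ≤ S.comap (D : E →ₗ[ℂ] E) :=
    Submodule.span_le.2 h1
  rw [hspan, top_le_iff] at h2
  rw [eq_top_iff]
  intro e _
  have h3 : (chartDeriv a p hp).symm e ∈ S.comap (D : E →ₗ[ℂ] E) := h2 ▸ Submodule.mem_top
  simpa [D] using h3

/-- A germ of a holomorphic vector field vanishing along a generic set vanishes. -/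
theorem eventually_eq_zero_of_generic {M : Set Z} {a : Z} (ha : a ∈ M)
    (hspan : ∀ p ∈ M, Submodule.span ℂ (Tan E M p : Set E) = ⊤)
    {X : Π p : Z, TangentSpace 𝓘(ℂ, E) p} (hX : X ∈ holAt E a)
    (h0 : ∀ᶠ p in 𝓝[M] a, val X p = 0) : ∀ᶠ p in 𝓝 a, val X p = 0 := by
  have : CompleteSpace E := FiniteDimensional.complete ℂ E
  have haκ := mem_chart_source E a
  have ht : Tendsto (chartAt E a).symm (𝓝[(chartAt E a).target ∩ (chartAt E a).symm ⁻¹' M]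
      (chartAt E a a)) (𝓝[M] a) := by
    refine tendsto_nhdsWithin_iff.2 ⟨?_, ?_⟩
    · have := (chartAt E a).continuousAt_symm (mem_chart_target E a)
      rw [ContinuousAt, (chartAt E a).left_inv haκ] at this
      exact this.mono_left nhdsWithin_le_nhds
    · filter_upwards [self_mem_nhdsWithin] with e he using he.2
  have key := eventually_eq_zero_of_velocities (U := loc a X)
    (S := (chartAt E a).target ∩ (chartAt E a).symm ⁻¹' M) (a := chartAt E a a)
    ⟨mem_chart_target E a, by rw [mem_preimage, (chartAt E a).left_inv haκ]; exact ha⟩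
    (eventually_nhdsWithin_of_forall fun e he => by
      have h1 := (chartAt E a).map_target he.1
      have := span_velocities_chart h1 (hspan _ he.2)
      rwa [(chartAt E a).right_inv he.1] at this) (contDiffAt_loc hX)
    (by
      filter_upwards [ht.eventually h0, self_mem_nhdsWithin] with e h1 h2
      have h3 := (chartAt E a).map_target h2.1
      have := loc_apply a X h3
      rw [(chartAt E a).right_inv h2.1, h1, map_zero] at this
      exact this)
  filter_upwards [((chartAt E a).continuousAt haκ).eventually key,
    (chartAt E a).open_source.mem_nhds haκ] with p h1 h2
  rw [loc_apply a X h2] at h1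
  simpa using h1

/-- The source of the uniqueness of the induced subalgebra: germs of fields are compared along `M`,
where the CR maps carry information. -/
theorem HolGerm.ext_of_generic {M : Set Z} {a : Z} (ha : a ∈ M)
    (hspan : ∀ p ∈ M, Submodule.span ℂ (Tan E M p : Set E) = ⊤) {ξ η : HolGerm E a}
    (h : ∀ᶠ p in 𝓝[M] a, val ξ.rep p = val η.rep p) : ξ = η := by
  refine HolGerm.ext_rep ?_
  have h1 := eventually_eq_zero_of_generic ha hspan
    (X := ξ.rep - η.rep) (sub_mem ξ.rep_mem η.rep_mem)
    (by filter_upwards [h] with p hp using sub_eq_zero.2 hp)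
  filter_upwards [h1] with p hp using sub_eq_zero.1 hp

end Local

/-! ### Real forms and tubes -/

section RealForm

variable {C : Type*} [NormedAddCommGroup C] [NormedSpace ℂ C]

/-- `C = V ⊕ iV`. -/
def IsRealForm (V : Submodule ℝ C) : Prop := ∀ z : C, ∃! q : V × V,
  (q.1 : C) + Complex.I • (q.2 : C) = z

variable {V : Submodule ℝ C}

theorem IsRealForm.exists_eq (hV : IsRealForm V) (z : C) :
    ∃ x ∈ V, ∃ y ∈ V, z = x + Complex.I • y := by
  obtain ⟨q, hq, -⟩ := hV z
  exact ⟨q.1, q.1.2, q.2, q.2.2, hq.symm⟩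

theorem IsRealForm.eq_zero (hV : IsRealForm V) {x y : C} (hx : x ∈ V) (hy : y ∈ V)
    (h : x + Complex.I • y = 0) : x = 0 ∧ y = 0 := by
  have := (hV 0).unique (y₁ := (⟨x, hx⟩, ⟨y, hy⟩)) (y₂ := (0, 0)) h (by simp)
  rw [Prod.ext_iff] at this
  exact ⟨congrArg Subtype.val this.1, congrArg Subtype.val this.2⟩

theorem IsRealForm.span_eq_top (hV : IsRealForm V) : Submodule.span ℂ (V : Set C) = ⊤ := by
  rw [eq_top_iff]
  intro z _
  obtain ⟨x, hx, y, hy, rfl⟩ := hV.exists_eq z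
  exact add_mem (Submodule.subset_span hx) (Submodule.smul_mem _ _ (Submodule.subset_span hy))

variable [FiniteDimensional ℂ C]

/-- Real and imaginary part with respect to a real form. -/
noncomputable def reIm (hV : IsRealForm V) : C ≃L[ℝ] V × V :=
  (LinearEquiv.ofBijective
    ({ toFun := fun q => (q.1 : C) + Complex.I • (q.2 : C)
       map_add' := fun p q => by
        simp only [Prod.fst_add, Prod.snd_add, Submodule.coe_add, smul_add]; abel
       map_smul' := fun r q => by
        simp only [Prod.smul_fst, Prod.smul_snd, Submodule.coe_smul, RingHom.id_apply, smul_add]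
        rw [smul_comm] } : V × V →ₗ[ℝ] C)
    ⟨fun p q h => (hV _).unique h rfl, fun z => (hV z).exists⟩).symm.toContinuousLinearEquiv

theorem reIm_symm_apply (hV : IsRealForm V) (q : V × V) :
    (reIm hV).symm q = (q.1 : C) + Complex.I • (q.2 : C) := rfl

theorem re_add_im (hV : IsRealForm V) (z : C) :
    ((reIm hV z).1 : C) + Complex.I • ((reIm hV z).2 : C) = z := by
  rw [← reIm_symm_apply hV, ContinuousLinearEquiv.symm_apply_apply]

theorem reIm_add (hV : IsRealForm V) (x y : V) : reIm hV ((x : C) + Complex.I • (y : C)) = (x, y) := by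
  rw [← reIm_symm_apply hV (x, y), ContinuousLinearEquiv.apply_symm_apply]

theorem reIm_coe (hV : IsRealForm V) (x : V) : reIm hV (x : C) = (x, 0) := by
  simpa using reIm_add hV x 0

theorem mem_tube_iff (hV : IsRealForm V) {F : Set V} {z : C} :
    z ∈ tube V F ↔ (reIm hV z).2 ∈ F := by
  constructor
  · rintro ⟨x, y, hy, rfl⟩
    rw [reIm_add]; exact hy
  · intro h
    exact ⟨_, _, h, (re_add_im hV z).symm⟩

theorem add_mem_tube (F : Set V) {z x : C} (hz : z ∈ tube V F) (hx : x ∈ V) :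
    z + x ∈ tube V F := by
  obtain ⟨x', y, hy, rfl⟩ := hz
  exact ⟨x' + ⟨x, hx⟩, y, hy, by simp; abel⟩

theorem mem_Tan_tube {F : Set V} {z x : C} (hz : z ∈ tube V F) (hx : x ∈ V) :
    x ∈ Tan C (tube V F) z := by
  have h0 : HasDerivAt (fun t : ℝ => z + t • x) x 0 := by
    simpa using ((hasDerivAt_id (0 : ℝ)).smul_const x).const_add z
  exact mem_Tan_of_curve (by simp)
    (Eventually.of_forall fun t => add_mem_tube F hz (V.smul_mem t hx))
    (hasMFDerivAt_curve_iff.2 h0)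

/-- The translations by `V` alone already provide tangent vectors that span over `ℂ`. -/
theorem span_Tan_tube (hV : IsRealForm V) {F : Set V} {z : C} (hz : z ∈ tube V F) :
    Submodule.span ℂ (Tan C (tube V F) z : Set C) = ⊤ := by
  rw [eq_top_iff, ← hV.span_eq_top]
  exact Submodule.span_mono fun x hx => mem_Tan_tube hz hx

/-- In terms of real and imaginary parts a tube is the product `V × F`, so a parametrization of `F`
is multiplied with a translation of `V`. -/
theorem exists_isParam_tube (hV : IsRealForm V) {F : Set V} (hF : IsAnalyticSubmanifold V F)
    {c : C} (hc : c ∈ tube V F) :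
    ∃ (L : Submodule ℝ V) (σ : V × L → C) (r : C → V × L), IsParam C (tube V F) c σ r := by
  have hy := (mem_tube_iff hV).1 hc
  obtain ⟨L, σ, r, h⟩ := hF.exists_isParam hy
  refine ⟨L, fun q => (reIm hV).symm ((reIm hV c).1 + q.1, σ q.2),
    fun z => ((reIm hV z).1 - (reIm hV c).1, r (reIm hV z).2), ?_, ?_, ?_, ?_, ?_, ?_, ?_⟩
  · rw [contMDiffAt_iff_contDiffAt]
    refine (reIm hV).symm.contDiff.contDiffAt.comp _ (ContDiffAt.prodMk ?_ ?_)
    · exact contDiffAt_const.add contDiffAt_fst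
    · exact ContDiffAt.comp (g := σ) _ h.smooth.contDiffAt contDiffAt_snd
  · simp [h.map_zero]
  · have : Tendsto (fun q : V × L => q.2) (𝓝 0) (𝓝 0) := continuous_snd.tendsto 0
    filter_upwards [this.eventually h.mem] with q hq
    rw [mem_tube_iff hV, ContinuousLinearEquiv.apply_symm_apply]
    exact hq
  · rw [contMDiffAt_iff_contDiffAt]
    have h1 : ContDiffAt ℝ ω (fun z => reIm hV z) c := (reIm hV).contDiff.contDiffAt
    exact (h1.fst.sub contDiffAt_const).prodMk
      (ContDiffAt.comp (g := r) c h.smooth_inv.contDiffAt h1.snd)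
  · simp [h.inv_base]
  · have : Tendsto (fun z => (reIm hV z).2) (𝓝[tube V F] c) (𝓝[F] (reIm hV c).2) := by
      refine tendsto_nhdsWithin_iff.2 ⟨?_, ?_⟩
      · have : Continuous fun z => (reIm hV z).2 := by fun_prop
        exact (this.tendsto c).mono_left nhdsWithin_le_nhds
      · filter_upwards [self_mem_nhdsWithin] with z hz using (mem_tube_iff hV).1 hz
    filter_upwards [this.eventually h.right_inv] with z hz
    simp [hz]
  · have : Tendsto (fun q : V × L => q.2) (𝓝 0) (𝓝 0) := continuous_snd.tendsto 0
    filter_upwards [this.eventually h.left_inv] with q hq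
    simp [hq]

end RealForm

/-! ### Composition of germs of CR maps -/

section CRMaps

variable {E : Type v} [NormedAddCommGroup E] [NormedSpace ℂ E]
  {Z : Type u} [TopologicalSpace Z] [ChartedSpace E Z] [IsManifold 𝓘(ℂ, E) ω Z]
  {E' : Type v'} [NormedAddCommGroup E'] [NormedSpace ℂ E']
  {Z' : Type u'} [TopologicalSpace Z'] [ChartedSpace E' Z'] [IsManifold 𝓘(ℂ, E') ω Z']
  {E'' : Type*} [NormedAddCommGroup E''] [NormedSpace ℂ E'']
  {Z'' : Type*} [TopologicalSpace Z''] [ChartedSpace E'' Z''] [IsManifold 𝓘(ℂ, E'') ω Z'']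
  {M : Set Z} {a : Z} {N : Set Z'} {b : Z'} {K : Set Z''} {d : Z''}

theorem IsCRMapGerm.eventually_mdifferentiableAt {f : Z → Z'} (hf : IsCRMapGerm E E' M a N f) :
    ∀ᶠ p in 𝓝[M] a, MDifferentiableAt 𝓘(ℝ, E) 𝓘(ℝ, E') f p := by
  have : IsManifold 𝓘(ℝ, E) ω Z := isManifold_real
  have : IsManifold 𝓘(ℝ, E') ω Z' := isManifold_real
  exact (CRTube.eventually_mdifferentiableAt hf.analytic).filter_mono nhdsWithin_le_nhds

theorem IsCRMapGerm.tendsto {f : Z → Z'} (hf : IsCRMapGerm E E' M a N f) (hb : f a = b) :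
    Tendsto f (𝓝[M] a) (𝓝[N] b) :=
  tendsto_nhdsWithin_iff.2
    ⟨hb ▸ hf.analytic.continuousAt.tendsto.mono_left nhdsWithin_le_nhds, hf.mapsTo⟩

theorem IsCRMapGerm.eventually_cr {f : Z → Z'} (hf : IsCRMapGerm E E' M a N f) :
    ∀ᶠ p in 𝓝[M] a, ∀ v : E, v ∈ Tan E M p → Complex.I • v ∈ Tan E M p →
      (mD ℝ E E' f p v ∈ Tan E' N (f p) ∧ Complex.I • mD ℝ E E' f p v ∈ Tan E' N (f p)) ∧
        mD ℝ E E' f p (Complex.I • v) = Complex.I • mD ℝ E E' f p v := by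
  filter_upwards [hf.cr] with p h v h1 h2 using h v ⟨h1, h2⟩

theorem isCRMapGerm_of_eventually {f : Z → Z'} (h1 : ContMDiffAt 𝓘(ℝ, E) 𝓘(ℝ, E') ω f a)
    (h2 : ∀ᶠ p in 𝓝[M] a, f p ∈ N)
    (h3 : ∀ᶠ p in 𝓝[M] a, ∀ v : E, v ∈ Tan E M p → Complex.I • v ∈ Tan E M p →
      (mD ℝ E E' f p v ∈ Tan E' N (f p) ∧ Complex.I • mD ℝ E E' f p v ∈ Tan E' N (f p)) ∧
        mD ℝ E E' f p (Complex.I • v) = Complex.I • mD ℝ E E' f p v) :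
    IsCRMapGerm E E' M a N f where
  analytic := h1
  mapsTo := h2
  cr := by filter_upwards [h3] with p h v hv using h v hv.1 hv.2

theorem IsCRMapGerm.comp {f : Z → Z'} {g : Z' → Z''} (hg : IsCRMapGerm E' E'' N b K g)
    (hf : IsCRMapGerm E E' M a N f) (hb : f a = b) :
    IsCRMapGerm E E'' M a K (fun p => g (f p)) := by
  refine isCRMapGerm_of_eventually
    (ContMDiffAt.comp a (by rw [hb]; exact hg.analytic) hf.analytic)
    ((hf.tendsto hb).eventually hg.mapsTo) ?_
  filter_upwards [hf.eventually_cr, (hf.tendsto hb).eventually hg.eventually_cr,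
    hf.eventually_mdifferentiableAt, (hf.tendsto hb).eventually hg.eventually_mdifferentiableAt]
    with p h1 h2 h3 h4 v hv hIv
  obtain ⟨⟨h5, h6⟩, h7⟩ := h1 v hv hIv
  obtain ⟨h8, h9⟩ := h2 _ h5 h6
  rw [mD_comp h3 h4, ContinuousLinearMap.comp_apply, ContinuousLinearMap.comp_apply, h7]
  exact ⟨h8, h9⟩

/-- A complex linear differential that preserves the real tangent spaces preserves their
intersections with `i` times themselves. -/
theorem isCRMapGerm_of_holomorphic {f : Z → Z'} (hf : ContMDiffAt 𝓘(ℂ, E) 𝓘(ℂ, E') ω f a)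
    (hN : ∀ᶠ p in 𝓝[M] a, f p ∈ N) : IsCRMapGerm E E' M a N f := by
  refine isCRMapGerm_of_eventually (contMDiffAt_real hf) hN ?_
  filter_upwards [(CRTube.eventually_mdifferentiableAt hf).filter_mono nhdsWithin_le_nhds,
    eventually_eventually_nhdsWithin.2 hN] with p h1 h2 v hv hIv
  have h3 : mD ℝ E E' f p (Complex.I • v) = Complex.I • mD ℝ E E' f p v := by
    rw [mD_real_apply h1, mD_real_apply h1, map_smul]
  refine ⟨⟨mD_mem_Tan (mdifferentiableAt_real h1) h2 hv, ?_⟩, h3⟩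
  rw [← h3]
  exact mD_mem_Tan (mdifferentiableAt_real h1) h2 hIv

theorem isCRIsoGerm_id : IsCRIsoGerm E E M a M a (fun p => p) :=
  have h : IsCRMapGerm E E M a M (fun p => p) :=
    isCRMapGerm_of_holomorphic contMDiffAt_id self_mem_nhdsWithin
  ⟨rfl, h, _, h, Eventually.of_forall fun _ => rfl, Eventually.of_forall fun _ => rfl⟩

theorem IsCRIsoGerm.comp {f : Z → Z'} {g : Z' → Z''} (hg : IsCRIsoGerm E' E'' N b K d g)
    (hf : IsCRIsoGerm E E' M a N b f) (hb : b ∈ N) :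
    IsCRIsoGerm E E'' M a K d (fun p => g (f p)) := by
  obtain ⟨f0, f1, f', f2, f3, f4⟩ := hf
  obtain ⟨g0, g1, g', g2, g3, g4⟩ := hg
  have g5 : g' d = b := by rw [← g0]; exact g3.self_of_nhdsWithin hb
  refine ⟨(congrArg g f0).trans g0, g1.comp f1 f0, _, f2.comp g2 g5, ?_, ?_⟩
  · filter_upwards [f3, (f1.tendsto f0).eventually g3] with p h1 h2
    rw [h2, h1]
  · filter_upwards [g4, (g2.tendsto g5).eventually f4] with p h1 h2
    rw [h2, h1]

theorem IsCRIsoGerm.exists_symm {f : Z → Z'} (hf : IsCRIsoGerm E E' M a N b f) (ha : a ∈ M) :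
    ∃ g, IsCRIsoGerm E' E N b M a g ∧ (∀ᶠ p in 𝓝[M] a, g (f p) = p) ∧
      ∀ᶠ q in 𝓝[N] b, f (g q) = q := by
  obtain ⟨f0, f1, f', f2, f3, f4⟩ := hf
  exact ⟨f', ⟨by rw [← f0]; exact f3.self_of_nhdsWithin ha, f2, f, f1, f4, f3⟩, f3, f4⟩

theorem IsCRIsoGerm.map {f : Z → Z'} (hf : IsCRIsoGerm E E' M a N b f) :
    IsCRMapGerm E E' M a N f := hf.2.1

theorem IsCRIsoGerm.tendsto {f : Z → Z'} (hf : IsCRIsoGerm E E' M a N b f) :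
    Tendsto f (𝓝[M] a) (𝓝[N] b) := hf.map.tendsto hf.1

/-- Along `M`, the derivatives of mutually inverse germs are mutually inverse. -/
theorem IsCRMapGerm.eventually_mD_left_inverse {f : Z → Z'} {g : Z' → Z}
    (hf : IsCRMapGerm E E' M a N f) (hg : IsCRMapGerm E' E N b M g) (hb : f a = b)
    (hgf : ∀ᶠ p in 𝓝[M] a, g (f p) = p) :
    ∀ᶠ p in 𝓝[M] a, ∀ v ∈ Tan E M p, mD ℝ E' E g (f p) (mD ℝ E E' f p v) = v := by
  filter_upwards [hf.eventually_mdifferentiableAt,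
    (hf.tendsto hb).eventually hg.eventually_mdifferentiableAt,
    eventually_eventually_nhdsWithin.2 hgf] with p h1 h2 h3 v hv
  exact mD_left_inverse_of_mem_Tan h1 h2 h3 hv

theorem IsCRMapGerm.eventually_mD_mem_Tan {f : Z → Z'} (hf : IsCRMapGerm E E' M a N f) :
    ∀ᶠ p in 𝓝[M] a, ∀ v ∈ Tan E M p, mD ℝ E E' f p v ∈ Tan E' N (f p) := by
  filter_upwards [hf.eventually_mdifferentiableAt, eventually_eventually_nhdsWithin.2 hf.mapsTo]
    with p h1 h2 v hv
  exact mD_mem_Tan h1 h2 hv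

end CRMaps

/-! ### The two equivalence relations -/

section Equivalences

variable {E : Type v} [NormedAddCommGroup E] [NormedSpace ℂ E] [FiniteDimensional ℂ E]
  {Z : Type u} [TopologicalSpace Z] [ChartedSpace E Z] [IsManifold 𝓘(ℂ, E) ω Z]
  {M : Set Z} {a : Z}

theorem pushes_iff {g : Z → Z} {ξ η : HolGerm E a} :
    Pushes M a g ξ η ↔ ∀ᶠ p in 𝓝[M] a, mD ℝ E E g p (val ξ.rep p) = val η.rep (g p) := Iff.rfl

theorem IsAdmissible.mem_Tan {𝔳 : LieSubalgebra ℝ (HolGerm E a)} (h : IsAdmissible M a 𝔳)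
    {ξ : HolGerm E a} (hξ : ξ ∈ 𝔳) : ∀ᶠ p in 𝓝[M] a, val ξ.rep p ∈ Tan E M p := h.le_holM hξ

/-- Automorphism germs form a group acting by push forward. For symmetry, the fields are tangent to
`M`, and on tangent vectors the derivative of the inverse germ undoes that of `g`. -/
theorem equivalence_conjugate (ha : a ∈ M) : Equivalence (Conjugate (E := E) M a) where
  refl 𝔳 := by
    have h : ∀ ξ : HolGerm E a, Pushes M a (fun p => p) ξ ξ := fun ξ => by
      rw [pushes_iff]
      refine Eventually.of_forall fun p => ?_
      rw [mD_id]; rfl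
    exact ⟨_, isCRIsoGerm_id, fun ξ hξ => ⟨ξ, hξ, h ξ⟩, fun ξ hξ => ⟨ξ, hξ, h ξ⟩⟩
  symm {𝔳 𝔴} h := by
    obtain ⟨g, hg, h1, h2⟩ := h
    obtain ⟨g', hg', h3, h4⟩ := hg.exists_symm ha
    have key : ∀ ξ ∈ 𝔳.1, ∀ η, Pushes M a g ξ η → Pushes M a g' η ξ := by
      intro ξ hξ η h
      rw [pushes_iff] at h ⊢
      filter_upwards [hg'.tendsto.eventually h, h4, hg'.tendsto.eventually (𝔳.2.mem_Tan hξ),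
        hg'.tendsto.eventually (hg.map.eventually_mD_left_inverse hg'.map hg.1 h3)]
        with q h5 h6 h7 h8
      have := h8 _ h7
      rwa [h5, h6] at this
    refine ⟨g', hg', fun η hη => ?_, fun ξ hξ => ?_⟩
    · obtain ⟨ξ, hξ, h⟩ := h2 η hη
      exact ⟨ξ, hξ, key ξ hξ η h⟩
    · obtain ⟨η, hη, h⟩ := h1 ξ hξ
      exact ⟨η, hη, key ξ hξ η h⟩
  trans {𝔳 𝔴 𝔵} h k := by
    obtain ⟨g, hg, h1, h2⟩ := h
    obtain ⟨k, hk, k1, k2⟩ := k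
    have key : ∀ ξ η ζ, Pushes M a g ξ η → Pushes M a k η ζ →
        Pushes (E := E) M a (fun p => k (g p)) ξ ζ := by
      intro ξ η ζ h h'
      rw [pushes_iff] at *
      filter_upwards [h, hg.tendsto.eventually h', hg.map.eventually_mdifferentiableAt,
        hg.tendsto.eventually hk.map.eventually_mdifferentiableAt] with p e1 e2 e3 e4
      rw [mD_comp e3 e4, ContinuousLinearMap.comp_apply, e1, e2]
    refine ⟨_, hk.comp hg ha, fun ξ hξ => ?_, fun ζ hζ => ?_⟩
    · obtain ⟨η, hη, h⟩ := h1 ξ hξ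
      obtain ⟨ζ, hζ, h'⟩ := k1 η hη
      exact ⟨ζ, hζ, key _ _ _ h h'⟩
    · obtain ⟨η, hη, h'⟩ := k2 ζ hζ
      obtain ⟨ξ, hξ, h⟩ := h2 η hη
      exact ⟨ξ, hξ, key _ _ _ h h'⟩

theorem affineEquiv_tendsto {C C' : Type*} [NormedAddCommGroup C] [NormedSpace ℂ C]
    [FiniteDimensional ℂ C] [NormedAddCommGroup C'] [NormedSpace ℂ C'] (l : C ≃ᵃ[ℂ] C')
    {c : C} {c' : C'} (h : l c = c') : Tendsto l (𝓝 c) (𝓝 c') := by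
  rw [← h]
  exact (AffineMap.continuous_of_finiteDimensional (l : C →ᵃ[ℂ] C')).tendsto c

theorem equivalence_affEquiv : Equivalence (AffEquiv.{u, v, w} E M a) where
  refl R := ⟨AffineEquiv.refl ℂ R.C, rfl, Eventually.of_forall fun _ => Iff.rfl⟩
  symm {R R'} h := by
    obtain ⟨l, h1, h2⟩ := h
    have h3 : l.symm R'.c = R.c := by rw [← h1, AffineEquiv.symm_apply_apply]
    refine ⟨l.symm, h3, ?_⟩
    filter_upwards [(affineEquiv_tendsto l.symm h3).eventually h2] with z hz
    rw [hz, AffineEquiv.apply_symm_apply]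
  trans {R R' R''} h k := by
    obtain ⟨l, h1, h2⟩ := h
    obtain ⟨k, k1, k2⟩ := k
    refine ⟨l.trans k, by simp [h1, k1], ?_⟩
    filter_upwards [h2, (affineEquiv_tendsto l h1).eventually k2] with z hz hz'
    rw [hz, hz']
    rfl

end Equivalences

/-! ### Holomorphic extensions of CR isomorphisms and pull backs of constant fields -/

/-- `M` is generic and parametrized near `a ∈ M`. -/
structure IsGenericAt (E : Type*) [NormedAddCommGroup E] [NormedSpace ℂ E]
    {Z : Type*} [TopologicalSpace Z] [ChartedSpace E Z] (M : Set Z) (a : Z) : Prop where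
  mem : a ∈ M
  param : ∃ (m : ℕ) (σ : (Fin m → ℝ) → Z) (c : Z → (Fin m → ℝ)), IsParam E M a σ c
  span : ∀ p ∈ M, Submodule.span ℂ (Tan E M p : Set E) = ⊤

section Generic

variable {E : Type v} [NormedAddCommGroup E] [NormedSpace ℂ E] [FiniteDimensional ℂ E]
  {Z : Type u} [TopologicalSpace Z] [ChartedSpace E Z] [IsManifold 𝓘(ℂ, E) ω Z]
  {E' : Type v'} [NormedAddCommGroup E'] [NormedSpace ℂ E'] [FiniteDimensional ℂ E']
  {Z' : Type u'} [TopologicalSpace Z'] [ChartedSpace E' Z'] [IsManifold 𝓘(ℂ, E') ω Z']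
  {M : Set Z} {a : Z} {N : Set Z'} {b : Z'}

theorem IsGenericSubmanifold.isGenericAt (hM : IsGenericSubmanifold E M) (ha : a ∈ M) :
    IsGenericAt E M a where
  mem := ha
  param := by
    have : IsManifold 𝓘(ℝ, E) ω Z := isManifold_real
    obtain ⟨L, σ, c, h⟩ := hM.submanifold.exists_isParam ha
    exact h.exists_fin
  span := hM.generic

theorem isGenericAt_tube {C : Type*} [NormedAddCommGroup C] [NormedSpace ℂ C]
    [FiniteDimensional ℂ C] {V : Submodule ℝ C} (hV : IsRealForm V) {F : Set V}
    (hF : IsAnalyticSubmanifold V F) {c : C} (hc : c ∈ tube V F) :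
    IsGenericAt C (tube V F) c where
  mem := hc
  param := by
    obtain ⟨L, σ, r, h⟩ := exists_isParam_tube hV hF hc
    exact h.exists_fin
  span := fun _ hz => span_Tan_tube hV hz

theorem eq_id_of_span {S : Submodule ℝ E} (hS : Submodule.span ℂ (S : Set E) = ⊤)
    {A : E →L[ℂ] E} (h : ∀ v ∈ S, A v = v) (v : E) : A v = v := by
  have h1 : Submodule.span ℂ (S : Set E) ≤ LinearMap.eqLocus (A : E →ₗ[ℂ] E) LinearMap.id :=
    Submodule.span_le.2 h
  rw [hS] at h1
  exact h1 (Submodule.mem_top (x := v))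

/-- CR isomorphisms extend to holomorphic maps with invertible derivative. -/
theorem IsCRIsoGerm.exists_extension {f : Z → Z'} (hM : IsGenericAt E M a)
    (hN : IsGenericAt E' N b) (hf : IsCRIsoGerm E E' M a N b f) :
    ∃ F : Z → Z', ContMDiffAt 𝓘(ℂ, E) 𝓘(ℂ, E') ω F a ∧ F a = b ∧ (∀ᶠ p in 𝓝[M] a, F p = f p) ∧
      (mD ℂ E E' F a).IsInvertible := by
  obtain ⟨g, hg, hgf, hfg⟩ := hf.exists_symm hM.mem
  obtain ⟨m, σ, c, hσ⟩ := hM.param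
  obtain ⟨m', σ', c', hσ'⟩ := hN.param
  obtain ⟨F, hF, hFa, hFf⟩ := hf.map.exists_extension hσ (hM.span a hM.mem)
  obtain ⟨G, hG, hGb, hGg⟩ := hg.map.exists_extension hσ' (hN.span b hN.mem)
  have hfa := hf.1
  have hgb := hg.1
  have dF := hF.mdifferentiableAt (by simp)
  have dG := hG.mdifferentiableAt (by simp)
  have df := hf.map.eventually_mdifferentiableAt.self_of_nhdsWithin hM.mem
  have dg := hg.map.eventually_mdifferentiableAt.self_of_nhdsWithin hN.mem
  have e1 : ∀ v ∈ Tan E M a, mD ℂ E E' F a v = mD ℝ E E' f a v := fun v hv => by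
    rw [← mD_real_apply dF]
    exact mD_congr_of_mem_Tan (mdifferentiableAt_real dF) df hFf hv
  have e2 : ∀ v ∈ Tan E' N b, mD ℂ E' E G b v = mD ℝ E' E g b v := fun v hv => by
    rw [← mD_real_apply dG]
    exact mD_congr_of_mem_Tan (mdifferentiableAt_real dG) dg hGg hv
  have e3 : ∀ v ∈ Tan E M a, mD ℝ E E' f a v ∈ Tan E' N b := fun v hv => by
    have := hf.map.eventually_mD_mem_Tan.self_of_nhdsWithin hM.mem v hv
    rwa [hfa] at this
  have e4 : ∀ v ∈ Tan E' N b, mD ℝ E' E g b v ∈ Tan E M a := fun v hv => by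
    have := hg.map.eventually_mD_mem_Tan.self_of_nhdsWithin hN.mem v hv
    rwa [hgb] at this
  -- The derivatives of the extensions `F` and `G` of two inverse germs are mutually inverse on the
  -- tangent vectors of `M` and `N`; these span over `ℂ`, so they are inverse everywhere.
  refine ⟨F, hF, hFa.trans hfa, hFf, ContinuousLinearEquiv.equivOfInverse (mD ℂ E E' F a)
    (mD ℂ E' E G b) ?_ ?_, rfl⟩
  · refine eq_id_of_span (A := (mD ℂ E' E G b).comp (mD ℂ E E' F a)) (hM.span a hM.mem) ?_
    intro v hv
    have := (hf.map.eventually_mD_left_inverse hg.map hf.1 hgf).self_of_nhdsWithin hM.mem v hv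
    rw [hfa] at this
    rw [ContinuousLinearMap.comp_apply, e1 v hv, e2 _ (e3 v hv), this]
  · refine eq_id_of_span (A := (mD ℂ E E' F a).comp (mD ℂ E' E G b)) (hN.span b hN.mem) ?_
    intro v hv
    have := (hg.map.eventually_mD_left_inverse hf.map hg.1 hfg).self_of_nhdsWithin hN.mem v hv
    rw [hgb] at this
    rw [ContinuousLinearMap.comp_apply, e2 v hv, e1 _ (e4 v hv), this]

end Generic

section Pull

variable {E : Type v} [NormedAddCommGroup E] [NormedSpace ℂ E] [FiniteDimensional ℂ E]
  {Z : Type u} [TopologicalSpace Z] [ChartedSpace E Z] [IsManifold 𝓘(ℂ, E) ω Z]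
  {C : Type w} [NormedAddCommGroup C] [NormedSpace ℂ C] [FiniteDimensional ℂ C]
  {M : Set Z} {a : Z}

/-- Invertible operators form an open set. In the chart the derivative becomes a continuous map into
a single operator space, where this openness applies. -/
theorem eventually_isInvertible {F : Z → C} (hF : ContMDiffAt 𝓘(ℂ, E) 𝓘(ℂ, C) ω F a)
    (hF' : (mD ℂ E C F a).IsInvertible) : ∀ᶠ p in 𝓝 a, (mD ℂ E C F p).IsInvertible := by
  have : CompleteSpace E := FiniteDimensional.complete ℂ E
  have ha := mem_chart_source E a
  have h0 := mem_chart_target E a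
  have hs := contMDiffAt_chart_symm a h0
  let h : E → C := fun e => F ((chartAt E a).symm e)
  have hh : ContDiffAt ℂ ω h (chartAt E a a) := by
    rw [← contMDiffAt_iff_contDiffAt]
    refine ContMDiffAt.comp (g := F) _ ?_ hs
    rw [(chartAt E a).left_inv ha]; exact hF
  have key : ∀ p, ∀ hp : p ∈ (chartAt E a).source, MDifferentiableAt 𝓘(ℂ, E) 𝓘(ℂ, C) F p →
      fderiv ℂ h (chartAt E a p) = (mD ℂ E C F p).comp ((chartDeriv a p hp).symm : E →L[ℂ] E) := by
    intro p hp hFp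
    have h1 := contMDiffAt_chart_symm a ((chartAt E a).map_source hp)
    have h2 := (chartAt E a).left_inv hp
    rw [← mD_eq_fderiv, mD_comp (h1.mdifferentiableAt (by simp)) (by rw [h2]; exact hFp), h2]
    rfl
  obtain ⟨D, hD⟩ := hF'
  have hc : ContinuousAt (fderiv ℂ h) (chartAt E a a) :=
    (hh.fderiv_right (m := ω) le_top).continuousAt
  have h1 : ∀ᶠ f in 𝓝 (fderiv ℂ h (chartAt E a a)), f ∈ range ((↑) : (E ≃L[ℂ] C) → _) := by
    have : fderiv ℂ h (chartAt E a a) = ((chartDeriv a a ha).symm.trans D : E ≃L[ℂ] C) := by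
      rw [key a ha (hF.mdifferentiableAt (by simp)), ← hD]
      rfl
    rw [this]
    exact ContinuousLinearEquiv.nhds _
  filter_upwards [((chartAt E a).continuousAt ha).eventually (hc.eventually h1),
    (chartAt E a).open_source.mem_nhds ha, eventually_mdifferentiableAt hF] with p ⟨B, hB⟩ hp hFp
  have h2 := key p hp hFp
  refine ⟨(chartDeriv a p hp).trans B, ?_⟩
  ext v
  have := congrArg (fun l : E →L[ℂ] C => l (chartDeriv a p hp v)) (hB.trans h2)
  simpa using this

/-- The constant field `x ∂/∂z`. -/
def constField (x : C) : Π z : C, TangentSpace 𝓘(ℂ, C) z := fun _ => x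

/-- The pull back `F^*(x ∂/∂z)` of a constant field. -/
noncomputable def pull (F : Z → C) (x : C) : Π p : Z, TangentSpace 𝓘(ℂ, E) p :=
  VectorField.mpullback 𝓘(ℂ, E) 𝓘(ℂ, C) F (constField x)

theorem val_pull (F : Z → C) (x : C) (p : Z) :
    val (E := E) (pull F x) p = (mD ℂ E C F p).inverse x := rfl

theorem mD_val_pull {F : Z → C} {p : Z} (h : (mD ℂ E C F p).IsInvertible) (x : C) :
    mD ℂ E C F p (val (pull F x) p) = x := by
  obtain ⟨D, hD⟩ := h
  rw [val_pull, ← hD, ContinuousLinearMap.inverse_equiv]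
  simp

theorem injective_of_isInvertible {A : E →L[ℂ] C} (h : A.IsInvertible) : Function.Injective A := by
  obtain ⟨D, rfl⟩ := h
  exact D.injective

theorem contMDiffAt_const_field (x : C) (c : C) : ContMDiffAt 𝓘(ℂ, C) 𝓘(ℂ, C).tangent ω
    (T% (constField x)) c :=
  contMDiffAt_vectorSpace_iff_contDiffAt.2 contDiffAt_const

theorem pull_mem_holAt {F : Z → C} (hF : ContMDiffAt 𝓘(ℂ, E) 𝓘(ℂ, C) ω F a)
    (hF' : (mD ℂ E C F a).IsInvertible) (x : C) : pull F x ∈ holAt E a := by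
  have : CompleteSpace E := FiniteDimensional.complete ℂ E
  have : IsManifold 𝓘(ℂ, E) 1 Z := IsManifold.of_le (n := ω) le_top
  filter_upwards [eventually_isInvertible hF hF', eventually_contMDiffAt hF] with p h1 h2
  exact ContMDiffAt.mpullback_vectorField_preimage (n := ω) (contMDiffAt_const_field x _) h2 h1
    le_top

/-- The germ of the pull back of a constant field. -/
noncomputable def pullGerm {F : Z → C} (hF : ContMDiffAt 𝓘(ℂ, E) 𝓘(ℂ, C) ω F a)
    (hF' : (mD ℂ E C F a).IsInvertible) : C →ₗ[ℂ] HolGerm E a :=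
  (germ a).comp
    ({ toFun := fun x => ⟨pull F x, pull_mem_holAt hF hF' x⟩
       map_add' := fun x y => Subtype.ext <| funext fun p =>
        map_add ((mD ℂ E C F p).inverse) x y
       map_smul' := fun r x => Subtype.ext <| funext fun p =>
        map_smul ((mD ℂ E C F p).inverse) r x } : C →ₗ[ℂ] holAt E a)

variable {F : Z → C} (hF : ContMDiffAt 𝓘(ℂ, E) 𝓘(ℂ, C) ω F a)
  (hF' : (mD ℂ E C F a).IsInvertible)

theorem rep_pullGerm (x : C) : (pullGerm hF hF' x).rep =ᶠ[𝓝 a] pull F x :=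
  rep_germ (⟨pull F x, pull_mem_holAt hF hF' x⟩ : holAt E a)

theorem mD_val_pullGerm (x : C) :
    ∀ᶠ p in 𝓝 a, mD ℂ E C F p (val (pullGerm hF hF' x).rep p) = x := by
  filter_upwards [rep_pullGerm hF hF' x, eventually_isInvertible hF hF'] with p h1 h2
  have : val (pullGerm hF hF' x).rep p = val (pull F x) p := h1
  rw [this, mD_val_pull h2]

theorem pullGerm_injective : Function.Injective (pullGerm hF hF') := by
  intro x y h
  rw [← (mD_val_pullGerm hF hF' x).self_of_nhds, h, (mD_val_pullGerm hF hF' y).self_of_nhds]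

/-- Pull back by a local biholomorphism respects brackets, and constant fields commute. -/
theorem lie_pullGerm (x y : C) : ⁅pullGerm hF hF' x, pullGerm hF hF' y⁆ = 0 := by
  have : CompleteSpace E := FiniteDimensional.complete ℂ E
  have : CompleteSpace C := FiniteDimensional.complete ℂ C
  have : IsManifold 𝓘(ℂ, E) (minSmoothness ℂ 2) Z := IsManifold.of_le (n := ω) le_top
  have : IsManifold 𝓘(ℂ, E) (minSmoothness ℂ 3) Z := IsManifold.of_le (n := ω) le_top
  refine HolGerm.ext_rep ?_
  filter_upwards [HolGerm.rep_bracket (pullGerm hF hF' x) (pullGerm hF hF' y),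
    (rep_pullGerm hF hF' x).mlieBracket_vectorField (rep_pullGerm hF hF' y),
    HolGerm.rep_zero (E := E) (a := a), eventually_contMDiffAt hF] with p h1 h2 h3 h4
  rw [h1, h2, h3]
  have h5 := VectorField.mpullback_mlieBracket
    ((contMDiffAt_const_field x (F p)).mdifferentiableAt (by simp))
    ((contMDiffAt_const_field y (F p)).mdifferentiableAt (by simp)) h4 le_top
  refine h5.symm.trans ?_
  have h6 : (VectorField.mlieBracket 𝓘(ℂ, C) (constField x) (constField y) (F p) : C) = 0 := by
    refine (mlieBracket_vectorSpace _ _ _).trans ?_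
    change fderiv ℂ (fun _ : C => y) (F p) x - fderiv ℂ (fun _ : C => x) (F p) y = 0
    simp
  exact (congrArg (mD ℂ E C F p).inverse h6).trans (map_zero _)

end Pull

/-! ### The admissible subalgebra of a tube realization -/

section Induces

variable {E : Type v} [NormedAddCommGroup E] [NormedSpace ℂ E] [FiniteDimensional ℂ E]
  {Z : Type u} [TopologicalSpace Z] [ChartedSpace E Z] [IsManifold 𝓘(ℂ, E) ω Z]
  {M : Set Z} {a : Z}

theorem TubeRealization.induces_iff {R : TubeRealization.{u, v, w} E M a} {𝔳 : Admissible E M a} :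
    R.Induces 𝔳 ↔
      (∀ ξ ∈ 𝔳.1, ∃ x ∈ R.V, ∀ᶠ p in 𝓝[M] a, mD ℝ E R.C R.φ p (val ξ.rep p) = x) ∧
      ∀ x ∈ R.V, ∃ ξ ∈ 𝔳.1, ∀ᶠ p in 𝓝[M] a, mD ℝ E R.C R.φ p (val ξ.rep p) = x := Iff.rfl

theorem TubeRealization.isRealForm (R : TubeRealization.{u, v, w} E M a) : IsRealForm R.V :=
  R.realForm

theorem TubeRealization.isGenericAt (R : TubeRealization.{u, v, w} E M a) :
    IsGenericAt R.C (tube R.V R.F) R.c :=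
  isGenericAt_tube R.isRealForm R.submanifold R.c_mem

theorem TubeRealization.exists_symm (R : TubeRealization.{u, v, w} E M a) (ha : a ∈ M) :
    ∃ g, IsCRIsoGerm R.C E (tube R.V R.F) R.c M a g ∧ (∀ᶠ p in 𝓝[M] a, g (R.φ p) = p) ∧
      ∀ᶠ q in 𝓝[tube R.V R.F] R.c, R.φ (g q) = q := R.isCRIso.exists_symm ha

/-- A tangent field is recovered along `M` from its image under the differential of `φ`, and
genericity then determines its germ. -/
theorem TubeRealization.Induces.le {R : TubeRealization.{u, v, w} E M a}
    (hM : IsGenericAt E M a) {𝔳 𝔴 : Admissible E M a} (h : R.Induces 𝔳) (h' : R.Induces 𝔴) :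
    𝔳.1 ≤ 𝔴.1 := by
  intro ξ hξ
  obtain ⟨x, hx, h1⟩ := (TubeRealization.induces_iff.1 h).1 ξ hξ
  obtain ⟨η, hη, h2⟩ := (TubeRealization.induces_iff.1 h').2 x hx
  obtain ⟨g, hg, hgf, hfg⟩ := R.exists_symm hM.mem
  suffices ξ = η by rwa [this]
  refine HolGerm.ext_of_generic hM.mem hM.span ?_
  filter_upwards [h1, h2, 𝔳.2.mem_Tan hξ, 𝔴.2.mem_Tan hη,
    R.isCRIso.map.eventually_mD_left_inverse hg.map R.isCRIso.1 hgf] with p e1 e2 e3 e4 e5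
  rw [← e5 _ e3, ← e5 _ e4, e1, e2]

/-- The algebra consists of the pull backs under the holomorphic extension `F` of `φ`; on tangent
vectors of `M` the differentials of `F` and `φ` agree. -/
theorem TubeRealization.existsUnique_induces (R : TubeRealization.{u, v, w} E M a)
    (hM : IsGenericAt E M a) : ∃! 𝔳 : Admissible E M a, R.Induces 𝔳 := by
  obtain ⟨F, hF, hFa, hFφ, hF'⟩ := R.isCRIso.exists_extension hM R.isGenericAt
  obtain ⟨g, hg, hgf, hfg⟩ := R.exists_symm hM.mem
  let P := pullGerm hF hF'
  have hFT : ∀ᶠ p in 𝓝[M] a, ∀ v ∈ Tan E M p, mD ℝ E R.C R.φ p v = mD ℂ E R.C F p v := by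
    filter_upwards [eventually_eventually_nhdsWithin.2 hFφ,
      (eventually_mdifferentiableAt hF).filter_mono nhdsWithin_le_nhds,
      R.isCRIso.map.eventually_mdifferentiableAt] with p h1 h2 h3 v hv
    rw [← mD_real_apply h2]
    exact (mD_congr_of_mem_Tan (mdifferentiableAt_real h2) h3 h1 hv).symm
  -- The inverse germ `g` maps the tube into `M`, so `dg x` is tangent to `M`. Both `dg x` and the
  -- pull back of `x` are mapped to `x` by the injective `dF`, hence they coincide.
  have hPT : ∀ x ∈ R.V, ∀ᶠ p in 𝓝[M] a, val (P x).rep p ∈ Tan E M p := by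
    intro x hx
    filter_upwards [hFT, (mD_val_pullGerm hF hF' x).filter_mono nhdsWithin_le_nhds, hgf,
      R.isCRIso.tendsto.eventually self_mem_nhdsWithin,
      R.isCRIso.tendsto.eventually hg.map.eventually_mD_mem_Tan,
      R.isCRIso.tendsto.eventually (hg.map.eventually_mD_left_inverse R.isCRIso.map hg.1 hfg),
      (eventually_isInvertible hF hF').filter_mono nhdsWithin_le_nhds]
      with p h1 h2 h3 h4 h5 h6 h7
    have h8 := mem_Tan_tube h4 hx
    have h9 := h5 x h8
    have h10 := h6 x h8
    rw [h3] at h9 h10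
    rw [h1 _ h9, ← h2] at h10
    rw [← injective_of_isInvertible h7 h10, h2]
    exact h9
  let 𝔳 : LieSubalgebra ℝ (HolGerm E a) :=
    { toSubmodule := R.V.map (P.restrictScalars ℝ)
      lie_mem' := by
        rintro _ _ ⟨x, hx, rfl⟩ ⟨y, hy, rfl⟩
        have : ⁅P x, P y⁆ = 0 := lie_pullGerm hF hF' x y
        change ⁅P x, P y⁆ ∈ R.V.map (P.restrictScalars ℝ)
        rw [this]
        exact zero_mem _ }
  have hmem : ∀ ξ, ξ ∈ 𝔳 ↔ ∃ x ∈ R.V, P x = ξ := fun ξ => Iff.rfl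
  have hadm : IsAdmissible M a 𝔳 := by
    refine ⟨?_, ?_, ?_, ?_⟩
    · rintro _ ⟨x, hx, rfl⟩
      exact hPT x hx
    · refine ⟨fun ξ η => Subtype.ext ?_⟩
      obtain ⟨x, hx, h1⟩ := (hmem _).1 ξ.2
      obtain ⟨y, hy, h2⟩ := (hmem _).1 η.2
      change ⁅(ξ : HolGerm E a), (η : HolGerm E a)⁆ = 0
      rw [← h1, ← h2]
      exact lie_pullGerm hF hF' x y
    · rintro ξ hξ hIξ
      obtain ⟨x, hx, rfl⟩ := (hmem _).1 hξ
      obtain ⟨y, hy, h⟩ := (hmem _).1 hIξ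
      rw [← map_smul] at h
      have h1 : y = Complex.I • x := pullGerm_injective hF hF' h
      -- The relation `y = i x` is read as `y + i (-x) = 0`, which has only the zero solution in a
      -- real form.
      have h2 := R.isRealForm.eq_zero hy (neg_mem hx) (by rw [h1]; simp)
      rw [neg_eq_zero.1 h2.2, map_zero]
    · rw [eq_top_iff]
      intro e _
      refine ⟨P (mD ℂ E R.C F a e), ?_, ?_⟩
      · have h1 : (⊤ : Submodule ℂ R.C) ≤
            (Submodule.span ℂ (𝔳 : Set (HolGerm E a))).comap P := by
          rw [← R.isRealForm.span_eq_top, Submodule.span_le]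
          exact fun x hx => Submodule.subset_span ((hmem _).2 ⟨x, hx, rfl⟩)
        exact h1 Submodule.mem_top
      · exact injective_of_isInvertible hF' (mD_val_pullGerm hF hF' _).self_of_nhds
  have hind : ∀ x ∈ R.V, ∀ᶠ p in 𝓝[M] a, mD ℝ E R.C R.φ p (val (P x).rep p) = x := by
    intro x hx
    filter_upwards [hFT, hPT x hx, (mD_val_pullGerm hF hF' x).filter_mono nhdsWithin_le_nhds]
      with p h1 h2 h3
    rw [h1 _ h2]; exact h3
  have hI : R.Induces ⟨𝔳, hadm⟩ := by
    refine TubeRealization.induces_iff.2 ⟨?_, fun x hx => ⟨P x, (hmem _).2 ⟨x, hx, rfl⟩, hind x hx⟩⟩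
    intro ξ hξ
    obtain ⟨x, hx, rfl⟩ := (hmem _).1 hξ
    exact ⟨x, hx, hind x hx⟩
  exact ⟨_, hI, fun 𝔴 h𝔴 => Subtype.ext (le_antisymm (h𝔴.le hM hI) (hI.le hM h𝔴))⟩

end Induces

/-! ### Affine equivalence and conjugacy -/

section LinearAlgebra

/-- Equal ranges and equal dimensions give kernels of equal dimension; an isomorphism of the kernels
is combined with sections over the common range. -/
theorem exists_linearEquiv_of_range_eq {K V W Q : Type*} [Field K] [AddCommGroup V] [Module K V]
    [AddCommGroup W] [Module K W] [AddCommGroup Q] [Module K Q] [Module.Finite K V]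
    [Module.Finite K W] {p : V →ₗ[K] Q} {q : W →ₗ[K] Q}
    (hpq : LinearMap.range p = LinearMap.range q)
    (hVW : Module.finrank K V = Module.finrank K W) : ∃ e : V ≃ₗ[K] W, ∀ v, q (e v) = p v := by
  have hk : Module.finrank K (LinearMap.ker p) = Module.finrank K (LinearMap.ker q) := by
    have h1 := p.finrank_range_add_finrank_ker
    have h2 := q.finrank_range_add_finrank_ker
    rw [hpq] at h1
    omega
  let k : LinearMap.ker p ≃ₗ[K] LinearMap.ker q := LinearEquiv.ofFinrankEq _ _ hk
  obtain ⟨s, hs⟩ := p.rangeRestrict.exists_rightInverse_of_surjective p.range_rangeRestrict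
  obtain ⟨t, ht⟩ := q.rangeRestrict.exists_rightInverse_of_surjective q.range_rangeRestrict
  have hs' : ∀ y, p (s y) = y := fun y => congrArg Subtype.val (LinearMap.congr_fun hs y)
  have ht' : ∀ y, q (t y) = y := fun y => congrArg Subtype.val (LinearMap.congr_fun ht y)
  let P : V →ₗ[K] LinearMap.range q := p.codRestrict _ fun v => hpq ▸ LinearMap.mem_range_self p v
  let d : V →ₗ[K] LinearMap.ker p :=
    (LinearMap.id - s ∘ₗ p.rangeRestrict).codRestrict _ fun v => by
      rw [LinearMap.mem_ker, LinearMap.sub_apply, map_sub, LinearMap.comp_apply, hs']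
      exact sub_self _
  let f : V →ₗ[K] W := (LinearMap.ker q).subtype ∘ₗ k.toLinearMap ∘ₗ d + t ∘ₗ P
  have hf : ∀ v, f v = k (d v) + t (P v) := fun v => rfl
  have hqf : ∀ v, q (f v) = p v := fun v => by
    rw [hf, map_add, ht', LinearMap.mem_ker.1 (k (d v)).2, zero_add]
    rfl
  have hinj : Function.Injective f := by
    refine (injective_iff_map_eq_zero f).2 fun v hv => ?_
    have h1 : p v = 0 := by rw [← hqf, hv, map_zero]
    have h2 : P v = 0 := Subtype.ext h1
    have h3 : k (d v) = 0 := Subtype.ext (by simpa [hf, h2] using hv)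
    have h4 : d v = 0 := by simpa using h3
    have h5 : v - s (p.rangeRestrict v) = 0 := congrArg Subtype.val h4
    have h6 : p.rangeRestrict v = 0 := Subtype.ext h1
    rwa [h6, map_zero, sub_zero] at h5
  exact ⟨LinearEquiv.ofInjectiveOfFinrankEq f hinj hVW, hqf⟩

/-- The sum `V + W` need not be direct, so the `W`-component is a choice. Making it linearly keeps
it small for small vectors, as needed for germs. -/
theorem exists_section_sup {K U : Type*} [Field K] [AddCommGroup U] [Module K U]
    (V W : Submodule K U) : ∃ s : U →ₗ[K] U, (∀ u, s u ∈ W) ∧ ∀ u ∈ V ⊔ W, u - s u ∈ V := by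
  let f : V × W →ₗ[K] U := V.subtype.coprod W.subtype
  obtain ⟨t, ht⟩ := f.rangeRestrict.exists_rightInverse_of_surjective f.range_rangeRestrict
  obtain ⟨t', ht'⟩ := LinearMap.exists_extend t
  refine ⟨W.subtype ∘ₗ LinearMap.snd K V W ∘ₗ t', fun u => (t' u).2.2, fun u hu => ?_⟩
  have h1 : u ∈ LinearMap.range f := by
    obtain ⟨x, hx, y, hy, rfl⟩ := Submodule.mem_sup.1 hu
    exact ⟨(⟨x, hx⟩, ⟨y, hy⟩), rfl⟩
  have h2 : t' u = t ⟨u, h1⟩ := LinearMap.congr_fun ht' ⟨u, h1⟩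
  have h3 : ((t' u).1 : U) + (t' u).2 = u := by
    rw [h2]; exact congrArg Subtype.val (LinearMap.congr_fun ht ⟨u, h1⟩)
  have h4 : u - (t' u).2 = (t' u).1 := by rw [sub_eq_iff_eq_add, h3]
  change u - ((t' u).2 : U) ∈ V
  rw [h4]
  exact (t' u).1.2

variable {C : Type*} [NormedAddCommGroup C] [NormedSpace ℂ C] [FiniteDimensional ℂ C]
  {C' : Type*} [NormedAddCommGroup C'] [NormedSpace ℂ C'] [FiniteDimensional ℂ C']
  {V W : Submodule ℝ C}

theorem reIm_I_smul (hV : IsRealForm V) (z : C) :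
    reIm hV (Complex.I • z) = (-(reIm hV z).2, (reIm hV z).1) := by
  rw [← reIm_add hV (-(reIm hV z).2) (reIm hV z).1]
  congr 1
  conv_lhs => rw [← re_add_im hV z]
  rw [smul_add, smul_smul, Complex.I_mul_I]
  simp [add_comm]

/-- The complex linear extension of a real linear map. -/
noncomputable def IsRealForm.extend (hV : IsRealForm V) (f : V →ₗ[ℝ] C') : C →ₗ[ℂ] C' where
  toFun z := f (reIm hV z).1 + Complex.I • f (reIm hV z).2
  map_add' x y := by
    simp only [map_add, Prod.fst_add, Prod.snd_add, smul_add]; abel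
  map_smul' r z := by
    have h : reIm hV (r • z) = r.re • reIm hV z + r.im • reIm hV (Complex.I • z) := by
      rw [← map_smul, ← map_smul, ← map_add]
      congr 1
      conv_lhs => rw [← Complex.re_add_im r, add_smul, mul_smul]
      rfl
    rw [h, reIm_I_smul]
    simp only [Prod.fst_add, Prod.snd_add, Prod.smul_fst, Prod.smul_snd, map_add, map_smul, map_neg,
      RingHom.id_apply]
    conv_rhs => rw [← Complex.re_add_im r]
    have h1 : ∀ (t : ℝ) (w : C'), t • w = (t : ℂ) • w := fun _ _ => rfl
    simp only [h1, smul_add, smul_neg, add_smul, mul_smul]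
    rw [smul_comm Complex.I, smul_comm Complex.I (r.im : ℂ), smul_smul Complex.I Complex.I,
      Complex.I_mul_I]
    simp only [neg_smul, one_smul, smul_neg]
    abel

theorem IsRealForm.extend_apply (hV : IsRealForm V) (f : V →ₗ[ℝ] C') (z : C) :
    hV.extend f z = f (reIm hV z).1 + Complex.I • f (reIm hV z).2 := rfl

theorem IsRealForm.extend_coe (hV : IsRealForm V) (f : V →ₗ[ℝ] C') (x : V) :
    hV.extend f x = f x := by
  rw [hV.extend_apply, reIm_coe]; simp

theorem IsRealForm.finrank (hV : IsRealForm V) :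
    Module.finrank ℝ C = Module.finrank ℝ V + Module.finrank ℝ V := by
  rw [(reIm hV).toLinearEquiv.finrank_eq, Module.finrank_prod]

/-- Two real forms are related by an automorphism that is the identity modulo their sum. -/
theorem IsRealForm.exists_equiv (hV : IsRealForm V) (hW : IsRealForm W) :
    ∃ A : C ≃ₗ[ℂ] C, (∀ z, A z ∈ W ↔ z ∈ V) ∧ ∀ z, A z - z ∈ V ⊔ W := by
  -- The largest complex subspace of `V + W`. Modulo `H` both real forms have the same image: if `w
  -- = x + i y` with `w` in one and `x`, `y` in the other, then `w - x` and `i (w - x) = -y` lie in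
  -- `V + W`.
  let H : Submodule ℝ C :=
    { carrier := {h | h ∈ V ⊔ W ∧ Complex.I • h ∈ V ⊔ W}
      add_mem' := fun {x y} hx hy => ⟨add_mem hx.1 hy.1, by
        rw [smul_add]; exact add_mem hx.2 hy.2⟩
      zero_mem' := ⟨zero_mem _, by rw [smul_zero]; exact zero_mem _⟩
      smul_mem' := fun r x hx => ⟨Submodule.smul_mem _ r hx.1, by
        rw [smul_comm]; exact Submodule.smul_mem _ r hx.2⟩ }
  have key : ∀ {V₁ V₂ : Submodule ℝ C}, IsRealForm V₁ → V₁ ≤ V ⊔ W → V₂ ≤ V ⊔ W →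
      V₂.map H.mkQ ≤ V₁.map H.mkQ := by
    rintro V₁ V₂ h1 h2 h3 _ ⟨w, hw, rfl⟩
    obtain ⟨x, hx, y, hy, rfl⟩ := h1.exists_eq w
    refine ⟨x, hx, ?_⟩
    rw [Submodule.mkQ_apply, Submodule.mkQ_apply, eq_comm, Submodule.Quotient.eq]
    refine ⟨sub_mem (h3 hw) (h2 hx), ?_⟩
    rw [add_sub_cancel_left, smul_smul, Complex.I_mul_I, neg_smul, one_smul]
    exact neg_mem (h2 hy)
  have hr : LinearMap.range (H.mkQ ∘ₗ V.subtype) = LinearMap.range (H.mkQ ∘ₗ W.subtype) := by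
    rw [LinearMap.range_comp, LinearMap.range_comp, Submodule.range_subtype,
      Submodule.range_subtype]
    exact le_antisymm (key hW le_sup_right le_sup_left) (key hV le_sup_left le_sup_right)
  obtain ⟨e, he⟩ := exists_linearEquiv_of_range_eq hr (by
    have := hV.finrank; have := hW.finrank; omega)
  have he' : ∀ x : V, (e x : C) - x ∈ H := fun x => (Submodule.Quotient.eq H).1 (he x)
  -- `e : V → W` moves vectors only by elements of `H`, so both `e x - x` and `i (e y - y)` lie in
  -- `V + W`; the complex linear extension therefore moves points only within `V + W`.
  let B : C →ₗ[ℂ] C := hV.extend (W.subtype ∘ₗ e.toLinearMap)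
  have hB : ∀ z, B z = e (reIm hV z).1 + Complex.I • (e (reIm hV z).2 : C) := fun z => rfl
  have hinj : Function.Injective B := by
    refine (injective_iff_map_eq_zero B).2 fun z hz => ?_
    rw [hB] at hz
    have := hW.eq_zero (e (reIm hV z).1).2 (e (reIm hV z).2).2 hz
    have h1 : (reIm hV z).1 = 0 := by simpa using this.1
    have h2 : (reIm hV z).2 = 0 := by simpa using this.2
    rw [← re_add_im hV z, h1, h2]; simp
  refine ⟨LinearEquiv.ofInjectiveEndo B hinj, fun z => ⟨fun h => ?_, fun h => ?_⟩, fun z => ?_⟩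
  · change B z ∈ W at h
    rw [hB] at h
    have h1 : Complex.I • (e (reIm hV z).2 : C) ∈ W := by
      simpa using sub_mem h (e (reIm hV z).1).2
    have h2 := hW.eq_zero (neg_mem h1) (e (reIm hV z).2).2 (by simp)
    have h3 : (reIm hV z).2 = 0 := by simpa using h2.2
    rw [← re_add_im hV z, h3]; simp
  · change B z ∈ W
    have := hV.extend_coe (W.subtype ∘ₗ e.toLinearMap) ⟨z, h⟩
    change B z = e ⟨z, h⟩ at this
    rw [this]
    exact (e ⟨z, h⟩).2
  · change B z - z ∈ V ⊔ W
    have h1 : B z - z = (((e (reIm hV z).1 : C) - ((reIm hV z).1 : C)) +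
        Complex.I • ((e (reIm hV z).2 : C) - ((reIm hV z).2 : C))) := by
      have h2 : B z - z = B z - (((reIm hV z).1 : C) + Complex.I • ((reIm hV z).2 : C)) := by
        rw [re_add_im]
      rw [h2, hB, smul_sub]; abel
    rw [h1]
    exact add_mem (he' _).1 (he' _).2

/-- An affine equivalence of tube germs can be chosen compatible with the real forms. -/
theorem exists_adapted_equiv {V' : Submodule ℝ C'} (hV : IsRealForm V) (hV' : IsRealForm V')
    {F : Set V} {F' : Set V'} {c : C} {c' : C'} (D : C ≃L[ℂ] C')
    (h : ∀ᶠ z in 𝓝 c, z ∈ tube V F ↔ c' + D (z - c) ∈ tube V' F') :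
    ∃ D' : C ≃L[ℂ] C', (∀ x, D' x ∈ V' ↔ x ∈ V) ∧
      ∀ᶠ z in 𝓝 c, z ∈ tube V F ↔ c' + D' (z - c) ∈ tube V' F' := by
  let W : Submodule ℝ C := V'.comap ((D : C →L[ℂ] C').restrictScalars ℝ : C →ₗ[ℝ] C')
  have hW' : ∀ w, w ∈ W ↔ D w ∈ V' := fun w => Iff.rfl
  have hW : IsRealForm W := by
    intro z
    obtain ⟨x, hx, y, hy, hz⟩ := hV'.exists_eq (D z)
    refine ⟨(⟨D.symm x, by rw [hW']; simpa⟩, ⟨D.symm y, by rw [hW']; simpa⟩), ?_, ?_⟩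
    · change D.symm x + Complex.I • D.symm y = z
      rw [← map_smul, ← map_add, ← hz, D.symm_apply_apply]
    · rintro ⟨⟨x', hx'⟩, ⟨y', hy'⟩⟩ h
      change x' + Complex.I • y' = z at h
      rw [hW'] at hx' hy'
      have h1 : D x' + Complex.I • D y' = D z := by rw [← h, map_add, map_smul]
      have h2 := hV'.eq_zero (sub_mem hx' hx) (sub_mem hy' hy)
        (by rw [smul_sub, sub_add_sub_comm, h1, ← hz, sub_self])
      ext
      · change x' = D.symm x
        rw [← sub_eq_zero.1 h2.1, D.symm_apply_apply]
      · change y' = D.symm y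
        rw [← sub_eq_zero.1 h2.2, D.symm_apply_apply]
  obtain ⟨A, hA, hAVW⟩ := hV.exists_equiv hW
  obtain ⟨s, hsW, hsV⟩ := exists_section_sup V W
  let A' : C ≃L[ℂ] C := A.toContinuousLinearEquiv
  refine ⟨A'.trans D, fun x => (hW' (A x)).symm.trans (hA x), ?_⟩
  have hs : Continuous s := s.continuous_of_finiteDimensional
  have t1 : Tendsto (fun z => z + s (A' (z - c) - (z - c))) (𝓝 c) (𝓝 c) := by
    have : Continuous fun z => z + s (A' (z - c) - (z - c)) := by fun_prop
    have := this.tendsto c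
    simpa using this
  have t2 : Tendsto (fun z => c + A' (z - c)) (𝓝 c) (𝓝 c) := by
    have : Continuous fun z => c + A' (z - c) := by fun_prop
    have := this.tendsto c
    simpa using this
  filter_upwards [h, t1.eventually h, t2.eventually h] with z h1 h2 h3
  -- Precomposing with `A` displaces `z` by `k ∈ V + W`. The displacement is split into `s k ∈ W`,
  -- harmless for the second tube, and `k - s k ∈ V`, harmless for the first; `t1` and `t2` keep the
  -- intermediate and final points near `c`.
  set k := A' (z - c) - (z - c) with hk
  have hkV : k - s k ∈ V := hsV k (hAVW (z - c))
  have e1 : c + A' (z - c) = z + s k + (k - s k) := by rw [hk]; abel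
  have e2 : z + s k ∈ tube V F ↔ c + A' (z - c) ∈ tube V F := by
    rw [e1]
    refine ⟨fun h => add_mem_tube F h hkV, fun h => ?_⟩
    simpa using add_mem_tube F h (neg_mem hkV)
  have e3 : c' + D (z - c) ∈ tube V' F' ↔ c' + D (z + s k - c) ∈ tube V' F' := by
    have h4 : D (s k) ∈ V' := (hW' _).1 (hsW k)
    have h5 : c' + D (z + s k - c) = c' + D (z - c) + D (s k) := by
      rw [add_assoc, ← map_add]; congr 2; abel
    rw [h5]
    refine ⟨fun h => add_mem_tube F' h h4, fun h => ?_⟩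
    simpa using add_mem_tube F' h (neg_mem h4)
  rw [h1, e3, ← h2, e2, h3, add_sub_cancel_left]
  rfl

/-- A holomorphic map whose derivatives along `V` are constant on a tube is affine. -/
theorem eventually_affine (hV : IsRealForm V) {F : Set V} {c : C} (hc : c ∈ tube V F) {f : C → C'}
    (hf : ContDiffAt ℂ ω f c)
    (h : ∀ x ∈ V, ∃ y, ∀ᶠ z in 𝓝[tube V F] c, fderiv ℂ f z x = y) :
    ∀ᶠ z in 𝓝 c, f z = f c + fderiv ℂ f c (z - c) := by
  have : CompleteSpace C := FiniteDimensional.complete ℂ C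
  have : CompleteSpace C' := FiniteDimensional.complete ℂ C'
  -- Tubes are generic, so constancy of the derivative along the tube spreads to a full
  -- neighbourhood by the identity principle.
  have h1 : ∀ x ∈ V, ∀ᶠ z in 𝓝 c, fderiv ℂ f z x = fderiv ℂ f c x := by
    intro x hx
    obtain ⟨y, hy⟩ := h x hx
    have h2 : ContDiffAt ℂ ω (fun z => fderiv ℂ f z x - fderiv ℂ f c x) c :=
      ((hf.fderiv_right (m := ω) le_top).clm_apply contDiffAt_const).sub contDiffAt_const
    have h3 := eventually_eq_zero_of_velocities hc ?_ h2 ?_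
    · filter_upwards [h3] with z hz using sub_eq_zero.1 hz
    · refine eventually_nhdsWithin_of_forall fun p hp => ?_
      rw [eq_top_iff, ← hV.span_eq_top]
      refine Submodule.span_mono fun x hx => ⟨fun t : ℝ => p + t • x, by simp,
        Eventually.of_forall fun t => add_mem_tube F hp (V.smul_mem t hx), ?_⟩
      simpa using ((hasDerivAt_id (0 : ℝ)).smul_const x).const_add p
    · filter_upwards [hy] with z hz
      rw [hz, hy.self_of_nhdsWithin hc, sub_self]
  have h2 : ∀ᶠ z in 𝓝 c, LinearMap.eqLocus (fderiv ℂ f z : C →ₗ[ℂ] C')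
      (fderiv ℂ f c : C →ₗ[ℂ] C') = ⊤ := by
    refine eventually_eq_top fun w => ?_
    obtain ⟨x, hx, y, hy, rfl⟩ := hV.exists_eq w
    filter_upwards [h1 x hx, h1 y hy] with z h3 h4
    exact add_mem (S := Submodule ℂ C) h3 (Submodule.smul_mem _ Complex.I h4)
  have h3 : ∀ᶠ z in 𝓝 c, DifferentiableAt ℂ f z := by
    filter_upwards [hf.eventually (by simp)] with z hz using hz.differentiableAt (by simp)
  obtain ⟨r, hr, hball⟩ := Metric.eventually_nhds_iff_ball.1 (h2.and h3)
  have hlin : ∀ z, DifferentiableAt ℂ (fun z => fderiv ℂ f c (z - c)) z := fun z =>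
    (fderiv ℂ f c).differentiableAt.comp z (differentiableAt_id.sub_const c)
  filter_upwards [Metric.ball_mem_nhds c hr] with z hz
  have h4 := (Metric.isOpen_ball (x := c) (ε := r)).is_const_of_fderiv_eq_zero
    (𝕜 := ℂ) (f := fun z => f z - fderiv ℂ f c (z - c)) (convex_ball c r).isPreconnected
    (fun w hw => ((hball w hw).2.sub (hlin w)).differentiableWithinAt) (fun w hw => ?_)
    hz (Metric.mem_ball_self hr)
  · simp only [sub_self, map_zero, sub_zero] at h4
    rw [← h4]; abel
  · rw [fderiv_fun_sub (hball w hw).2 (hlin w)]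
    have h5 : fderiv ℂ (fun z => fderiv ℂ f c (z - c)) w = fderiv ℂ f c := by
      rw [fderiv_comp_sub (f := fun z => fderiv ℂ f c z)]
      exact (fderiv ℂ f c).fderiv
    have h6 : fderiv ℂ f w = fderiv ℂ f c := by
      ext v
      have : v ∈ LinearMap.eqLocus (fderiv ℂ f w : C →ₗ[ℂ] C') (fderiv ℂ f c : C →ₗ[ℂ] C') := by
        rw [(hball w hw).1]; trivial
      exact this
    rw [h5, h6, sub_self]
    rfl

end LinearAlgebra

/-! ### Affinely equivalent realizations versus conjugate subalgebras -/

section Classes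

variable {E : Type v} [NormedAddCommGroup E] [NormedSpace ℂ E] [FiniteDimensional ℂ E]
  {Z : Type u} [TopologicalSpace Z] [ChartedSpace E Z] [IsManifold 𝓘(ℂ, E) ω Z]
  {M : Set Z} {a : Z}

/-- An affine isomorphism with prescribed value at the base point amounts to its linear part, which
is continuous in finite dimension. -/
theorem affEquiv_iff {R R' : TubeRealization.{u, v, w} E M a} : AffEquiv E M a R R' ↔
    ∃ D : R.C ≃L[ℂ] R'.C, ∀ᶠ z in 𝓝 R.c, z ∈ tube R.V R.F ↔ R'.c + D (z - R.c) ∈ tube R'.V R'.F := by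
  constructor
  · rintro ⟨l, h1, h2⟩
    refine ⟨l.linear.toContinuousLinearEquiv, ?_⟩
    filter_upwards [h2] with z hz
    have h3 : l z = l.linear (z - R.c) + l R.c := by
      have := l.map_vadd R.c (z - R.c)
      simpa using this
    rw [h1, add_comm] at h3
    rw [h3] at hz
    exact hz
  · rintro ⟨D, h⟩
    refine ⟨((AffineEquiv.vaddConst ℂ R.c).symm.trans D.toLinearEquiv.toAffineEquiv).trans
      (AffineEquiv.vaddConst ℂ R'.c), by simp, ?_⟩
    filter_upwards [h] with z hz
    have : (((AffineEquiv.vaddConst ℂ R.c).symm.trans D.toLinearEquiv.toAffineEquiv).trans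
      (AffineEquiv.vaddConst ℂ R'.c)) z = R'.c + D (z - R.c) := by
      simp [add_comm]
    rw [this]
    exact hz

theorem isCRIsoGerm_affine {C C' : Type*} [NormedAddCommGroup C] [NormedSpace ℂ C]
    [NormedAddCommGroup C'] [NormedSpace ℂ C'] {T : Set C} {T' : Set C'} {c : C} {c' : C'}
    (D : C ≃L[ℂ] C') (h : ∀ᶠ z in 𝓝 c, z ∈ T ↔ c' + D (z - c) ∈ T') :
    IsCRIsoGerm C C' T c T' c' (fun z => c' + D (z - c)) := by
  have h1 : Tendsto (fun w => c + D.symm (w - c')) (𝓝 c') (𝓝 c) := by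
    have : Continuous fun w => c + D.symm (w - c') := by fun_prop
    simpa using this.tendsto c'
  refine ⟨by simp, isCRMapGerm_of_holomorphic ?_ ?_, fun w => c + D.symm (w - c'),
    isCRMapGerm_of_holomorphic ?_ ?_, Eventually.of_forall fun z => by simp,
    Eventually.of_forall fun z => by simp⟩
  · rw [contMDiffAt_iff_contDiffAt]
    exact contDiffAt_const.add
      (D.contDiff.contDiffAt.comp c (contDiffAt_id.sub contDiffAt_const))
  · filter_upwards [h.filter_mono nhdsWithin_le_nhds, self_mem_nhdsWithin] with z hz hz'
      using hz.1 hz'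
  · rw [contMDiffAt_iff_contDiffAt]
    exact contDiffAt_const.add
      (D.symm.contDiff.contDiffAt.comp c' (contDiffAt_id.sub contDiffAt_const))
  · filter_upwards [(h1.eventually h).filter_mono nhdsWithin_le_nhds, self_mem_nhdsWithin]
      with w hw hw'
    rw [hw]
    simpa using hw'

theorem mD_affine {C C' : Type*} [NormedAddCommGroup C] [NormedSpace ℂ C]
    [NormedAddCommGroup C'] [NormedSpace ℂ C'] {c : C} {c' : C'} (D : C ≃L[ℂ] C') (z x : C) :
    mD ℝ C C' (fun z => c' + D (z - c)) z x = D x := by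
  have h : HasFDerivAt (fun z => c' + D (z - c)) (D : C →L[ℂ] C') z :=
    (HasFDerivAt.comp z (D : C →L[ℂ] C').hasFDerivAt
      ((hasFDerivAt_id z).sub_const c)).const_add c'
  rw [mD_eq_fderiv, (h.restrictScalars ℝ).fderiv]
  rfl

variable {R R' : TubeRealization.{u, v, w} E M a} {𝔳 𝔳' : Admissible E M a}

/-- The automorphism is `φ'⁻¹ ∘ λ ∘ φ`, where the affine map `λ` has been adapted so that its linear
part `D` takes `V` onto `V'`; constant fields then correspond under `D`. -/
theorem AffEquiv.conjugate (ha : a ∈ M) (h : AffEquiv E M a R R') (h𝔳 : R.Induces 𝔳)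
    (h𝔳' : R'.Induces 𝔳') : Conjugate M a 𝔳 𝔳' := by
  obtain ⟨D₀, hD₀⟩ := affEquiv_iff.1 h
  obtain ⟨D, hDV, hD⟩ := exists_adapted_equiv R.isRealForm R'.isRealForm D₀ hD₀
  have hl := isCRIsoGerm_affine D hD
  obtain ⟨ψ, hψ, h1, h2⟩ := R'.exists_symm ha
  rw [TubeRealization.induces_iff] at h𝔳 h𝔳'
  have hlφ := hl.comp R.isCRIso R.c_mem
  have key : ∀ ξ, ∀ η ∈ 𝔳'.1, ∀ x, (∀ᶠ p in 𝓝[M] a, mD ℝ E R.C R.φ p (val ξ.rep p) = x) →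
      (∀ᶠ p in 𝓝[M] a, mD ℝ E R'.C R'.φ p (val η.rep p) = D x) →
      Pushes M a (fun p => ψ (R'.c + D (R.φ p - R.c))) ξ η := by
    intro ξ η hη x hξx hηx
    rw [pushes_iff]
    have hg := hψ.comp hlφ R'.c_mem
    filter_upwards [hξx, hg.tendsto.eventually hηx, hg.tendsto.eventually (𝔳'.2.mem_Tan hη),
      hg.tendsto.eventually (R'.isCRIso.map.eventually_mD_left_inverse hψ.map R'.isCRIso.1 h1),
      R.isCRIso.map.eventually_mdifferentiableAt,
      R.isCRIso.tendsto.eventually hl.map.eventually_mdifferentiableAt,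
      hlφ.tendsto.eventually hψ.map.eventually_mdifferentiableAt,
      hlφ.tendsto.eventually h2, hlφ.map.eventually_mdifferentiableAt]
      with p e1 e2 e3 e4 e5 e6 e7 e8 e9
    rw [mD_comp (f := fun p => R'.c + D (R.φ p - R.c)) e9 e7, ContinuousLinearMap.comp_apply,
      mD_comp (g := fun z => R'.c + D (z - R.c)) e5 e6, ContinuousLinearMap.comp_apply, e1,
      mD_affine, ← e2]
    have := e4 _ e3
    rwa [e8] at this
  refine ⟨_, hψ.comp hlφ R'.c_mem, fun ξ hξ => ?_, fun η hη => ?_⟩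
  · obtain ⟨x, hx, hξx⟩ := h𝔳.1 ξ hξ
    obtain ⟨η, hη, hηx⟩ := h𝔳'.2 (D x) ((hDV x).2 hx)
    exact ⟨η, hη, key ξ η hη x hξx hηx⟩
  · obtain ⟨y, hy, hηy⟩ := h𝔳'.1 η hη
    obtain ⟨ξ, hξ, hξx⟩ := h𝔳.2 (D.symm y) ((hDV _).1 (by simpa))
    exact ⟨ξ, hξ, key ξ η hη _ hξx (by simpa using hηy)⟩

/-- In tube coordinates the automorphism becomes `φ' ∘ g ∘ φ⁻¹`. It sends constant fields from `V`
to constant fields, so its holomorphic extension is affine. -/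
theorem Conjugate.affEquiv (hM : IsGenericAt E M a) (h : Conjugate M a 𝔳 𝔳') (h𝔳 : R.Induces 𝔳)
    (h𝔳' : R'.Induces 𝔳') : AffEquiv E M a R R' := by
  have ha := hM.mem
  obtain ⟨g, hg, hg1, hg2⟩ := h
  obtain ⟨ψ, hψ, h1, h2⟩ := R.exists_symm ha
  rw [TubeRealization.induces_iff] at h𝔳 h𝔳'
  have hgψ := hg.comp hψ ha
  have hf := R'.isCRIso.comp hgψ ha
  have hconst : ∀ x ∈ R.V, ∃ y, ∀ᶠ z in 𝓝[tube R.V R.F] R.c,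
      mD ℝ R.C R'.C (fun z => R'.φ (g (ψ z))) z x = y := by
    intro x hx
    obtain ⟨ξ, hξ, hξx⟩ := h𝔳.2 x hx
    obtain ⟨η, hη, hξη⟩ := hg1 ξ hξ
    obtain ⟨y, hy, hηy⟩ := h𝔳'.1 η hη
    rw [pushes_iff] at hξη
    refine ⟨y, ?_⟩
    filter_upwards [hψ.tendsto.eventually hξx, hψ.tendsto.eventually hξη,
      hgψ.tendsto.eventually hηy, hψ.tendsto.eventually (𝔳.2.mem_Tan hξ),
      hψ.tendsto.eventually (R.isCRIso.map.eventually_mD_left_inverse hψ.map R.isCRIso.1 h1), h2,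
      hψ.map.eventually_mdifferentiableAt,
      hψ.tendsto.eventually hg.map.eventually_mdifferentiableAt,
      hgψ.tendsto.eventually R'.isCRIso.map.eventually_mdifferentiableAt,
      hgψ.map.eventually_mdifferentiableAt] with z e1 e2 e3 e4 e5 e6 e7 e8 e9 e10
    have e11 := e5 _ e4
    rw [e1, e6] at e11
    rw [mD_comp (f := fun z => g (ψ z)) e10 e9, ContinuousLinearMap.comp_apply, mD_comp e7 e8,
      ContinuousLinearMap.comp_apply, e11, e2, e3]
  obtain ⟨G, hG, hGc, hGf, hG'⟩ := hf.exists_extension R.isGenericAt R'.isGenericAt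
  obtain ⟨D, hD⟩ := hG'
  have haff : ∀ᶠ z in 𝓝 R.c, G z = R'.c + D (z - R.c) := by
    have := eventually_affine R.isRealForm R.c_mem hG.contDiffAt fun x hx => ?_
    · rw [hGc, ← mD_eq_fderiv, ← hD] at this
      exact this
    · obtain ⟨y, hy⟩ := hconst x hx
      refine ⟨y, ?_⟩
      filter_upwards [hy, eventually_eventually_nhdsWithin.2 hGf, hf.map.eventually_mdifferentiableAt,
        (eventually_mdifferentiableAt hG).filter_mono nhdsWithin_le_nhds, self_mem_nhdsWithin]
        with z e1 e2 e3 e4 e5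
      rw [← mD_eq_fderiv, ← mD_real_apply e4,
        mD_congr_of_mem_Tan (mdifferentiableAt_real e4) e3 e2 (mem_Tan_tube e5 hx), e1]
  refine affEquiv_iff.2 ⟨D, ?_⟩
  obtain ⟨k, hk, hkf, hfk⟩ := hf.exists_symm R.c_mem
  have ht : Tendsto (fun z => R'.c + D (z - R.c)) (𝓝 R.c) (𝓝 R'.c) := by
    have : Continuous fun z => R'.c + D (z - R.c) := by fun_prop
    simpa using this.tendsto R.c
  -- Mapping tube into tube gives only one implication; for the other, the inverse germ `k` inverts
  -- the affine map along the second tube.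
  have hback : ∀ᶠ q in 𝓝[tube R'.V R'.F] R'.c, k q ∈ tube R.V R.F ∧ q = R'.c + D (k q - R.c) := by
    filter_upwards [hfk, hk.tendsto.eventually hGf, hk.map.mapsTo,
      hk.tendsto.eventually (haff.filter_mono nhdsWithin_le_nhds)] with q e1 e2 e3 e4
    exact ⟨e3, by rw [← e4, e2, e1]⟩
  filter_upwards [haff, eventually_nhdsWithin_iff.1 hGf, eventually_nhdsWithin_iff.1 hf.map.mapsTo,
    ht.eventually (eventually_nhdsWithin_iff.1 hback)] with z e1 e2 e3 e4
  refine ⟨fun hz => ?_, fun hz => ?_⟩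
  · rw [← e1, e2 hz]
    exact e3 hz
  · obtain ⟨e5, e6⟩ := e4 hz
    have : z = k (R'.c + D (z - R.c)) := by
      simpa using e6
    rw [this]
    exact e5

end Classes

/-! ### Primitives and straightening of commuting frames -/

section Primitive

variable {E G : Type*} [NormedAddCommGroup E] [NormedSpace ℂ E] [NormedAddCommGroup G]
  [NormedSpace ℂ G] [CompleteSpace G]

/-- The power series of a primitive with value `b` at the base point. -/
noncomputable def primitiveSeries (b : G) (p : FormalMultilinearSeries ℂ E (E →L[ℂ] G)) :
    FormalMultilinearSeries ℂ E G
  | 0 => ContinuousMultilinearMap.uncurry0 ℂ E b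
  | n + 1 => ((n : ℂ) + 1)⁻¹ • ContinuousMultilinearMap.uncurryRight (Ei := fun _ => E) (p n)

theorem primitiveSeries_zero (b : G) (p : FormalMultilinearSeries ℂ E (E →L[ℂ] G))
    (m : Fin 0 → E) : primitiveSeries b p 0 m = b := rfl

theorem primitiveSeries_succ (b : G) (p : FormalMultilinearSeries ℂ E (E →L[ℂ] G)) (n : ℕ) (y : E) :
    primitiveSeries b p (n + 1) (fun _ => y) = ((n : ℂ) + 1)⁻¹ • p n (fun _ => y) y := rfl

theorem norm_primitiveSeries_succ_le (b : G) (p : FormalMultilinearSeries ℂ E (E →L[ℂ] G)) (n : ℕ) :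
    ‖primitiveSeries b p (n + 1)‖ ≤ ‖p n‖ := by
  rw [primitiveSeries, norm_smul, ContinuousMultilinearMap.uncurryRight_norm]
  refine mul_le_of_le_one_left (by positivity) ?_
  rw [norm_inv]
  refine inv_le_one_of_one_le₀ ?_
  have : ((n : ℂ) + 1) = ((n + 1 : ℕ) : ℂ) := by push_cast; rfl
  rw [this, Complex.norm_natCast]
  exact_mod_cast Nat.succ_pos n

/-- A primitive of an analytic map is analytic. -/
theorem analyticAt_of_hasFDerivAt {f : E → G} {f' : E → E →L[ℂ] G} {a : E}
    (hf : ∀ᶠ x in 𝓝 a, HasFDerivAt f (f' x) x) (hf' : AnalyticAt ℂ f' a) : AnalyticAt ℂ f a := by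
  obtain ⟨p, r, hp⟩ := hf'
  obtain ⟨ε, hε, hball⟩ := Metric.eventually_nhds_iff_ball.1 hf
  obtain ⟨ρ, hρ0, hρ⟩ := ENNReal.lt_iff_exists_nnreal_btwn.1
    (lt_min hp.r_pos (ENNReal.ofReal_pos.2 hε))
  have hρr : (ρ : ENNReal) < r := hρ.trans_le (min_le_left _ _)
  have hρε : (ρ : ℝ) < ε := by
    have := hρ.trans_le (min_le_right _ _)
    rw [ENNReal.lt_ofReal_iff_toReal_lt ENNReal.coe_ne_top] at this
    simpa using this
  have hsum := p.summable_norm_mul_pow (hρr.trans_le hp.r_le)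
  obtain ⟨q, hq0, hq, hqn⟩ : ∃ q : FormalMultilinearSeries ℂ E G, (∀ m, q 0 m = f a) ∧
      (∀ n y, q (n + 1) (fun _ => y) = ((n : ℂ) + 1)⁻¹ • p n (fun _ => y) y) ∧
      ∀ n, ‖q (n + 1)‖ ≤ ‖p n‖ :=
    ⟨primitiveSeries (f a) p, primitiveSeries_zero _ _, primitiveSeries_succ _ _,
      norm_primitiveSeries_succ_le _ _⟩
  refine ⟨q, ρ, ?_, by simpa using hρ0, fun {y} hy => ?_⟩
  · refine q.le_radius_of_bound (max ‖f a‖ ((∑' n, ‖p n‖ * (ρ : ℝ) ^ n) * ρ)) fun n => ?_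
    rcases n with _ | n
    · refine le_max_of_le_left ?_
      rw [pow_zero, mul_one]
      exact ContinuousMultilinearMap.opNorm_le_bound (norm_nonneg _) fun m => by simp [hq0]
    · refine le_max_of_le_right ?_
      rw [pow_succ, ← mul_assoc]
      refine mul_le_mul_of_nonneg_right ?_ ρ.2
      exact (mul_le_mul_of_nonneg_right (hqn n) (by positivity)).trans
        (hsum.le_tsum n fun _ _ => by positivity)
  · have hy' : ‖y‖ < ρ := by simpa [← NNReal.coe_lt_coe] using hy
    have hty : ∀ t ∈ uIcc (0 : ℝ) 1, ‖(t : ℂ) • y‖ ≤ ‖y‖ := fun t ht => by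
      rw [uIcc_of_le zero_le_one] at ht
      rw [norm_smul, Complex.norm_real, Real.norm_of_nonneg ht.1]
      exact mul_le_of_le_one_left (norm_nonneg _) ht.2
    have hterm : ∀ t ∈ uIcc (0 : ℝ) 1,
        HasSum (fun n => (t : ℂ) ^ n • p n (fun _ => y) y) (f' (a + (t : ℂ) • y) y) := by
      intro t ht
      have h1 : (t : ℂ) • y ∈ Metric.eball (0 : E) r := by
        rw [Metric.mem_eball, edist_zero_right]
        refine lt_of_le_of_lt ?_ hρr
        rw [← ofReal_norm, ← ENNReal.ofReal_coe_nnreal]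
        exact ENNReal.ofReal_le_ofReal ((hty t ht).trans hy'.le)
      have h2 := (hp.hasSum h1).mapL (ContinuousLinearMap.apply ℂ G y)
      refine h2.congr_fun fun n => ?_
      have := (p n).map_smul_univ (fun _ => (t : ℂ)) (fun _ => y)
      simp only [Finset.prod_const, Finset.card_univ, Fintype.card_fin] at this
      change _ = p n (fun _ => (t : ℂ) • y) y
      rw [this]; rfl
    have hderiv : ∀ t ∈ uIcc (0 : ℝ) 1,
        HasDerivAt (fun t : ℝ => f (a + (t : ℂ) • y)) (f' (a + (t : ℂ) • y) y) t := by
      intro t ht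
      have h1 := hball (a + (t : ℂ) • y) (by
        rw [mem_ball_iff_norm, add_sub_cancel_left]
        exact ((hty t ht).trans_lt hy').trans hρε)
      have h2 : HasDerivAt (fun t : ℝ => a + (t : ℂ) • y) y t := by
        simpa using ((hasDerivAt_id t).ofReal_comp.smul_const y).const_add a
      exact (h1.restrictScalars ℝ).comp_hasDerivAt t h2
    -- The derivative `f' (a + t y) y` of `t ↦ f (a + t y)` is integrated termwise over `[0, 1]`;
    -- the factor `1 / (n + 1)` in the primitive series is the integral of `tⁿ`.
    have hint := intervalIntegral.hasSum_integral_of_dominated_convergence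
      (μ := MeasureTheory.volume) (a := 0) (b := 1)
      (F := fun n (t : ℝ) => (t : ℂ) ^ n • p n (fun _ => y) y)
      (f := fun t : ℝ => f' (a + (t : ℂ) • y) y) (fun n _ => ‖p n‖ * (ρ : ℝ) ^ n * ρ)
      (fun n => Continuous.aestronglyMeasurable (by fun_prop))
      (fun n => Eventually.of_forall fun t ht => by
        have ht' := uIoc_subset_uIcc ht
        rw [uIcc_of_le zero_le_one] at ht'
        rw [norm_smul, norm_pow, Complex.norm_real, Real.norm_of_nonneg ht'.1]
        have h1 : ‖p n (fun _ => y) y‖ ≤ ‖p n‖ * (ρ : ℝ) ^ n * ρ := by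
          refine ((p n fun _ => y).le_opNorm y).trans ?_
          refine mul_le_mul ?_ hy'.le (norm_nonneg _) (by positivity)
          refine ((p n).le_opNorm _).trans ?_
          simp only [Finset.prod_const, Finset.card_univ, Fintype.card_fin]
          gcongr
        exact (mul_le_of_le_one_left (norm_nonneg _) (pow_le_one₀ ht'.1 ht'.2)).trans h1)
      (Eventually.of_forall fun t _ => hsum.mul_right _) intervalIntegrable_const
      (Eventually.of_forall fun t ht => hterm t (uIoc_subset_uIcc ht))
    have hcont : IntervalIntegrable (fun t : ℝ => f' (a + (t : ℂ) • y) y) MeasureTheory.volume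
        0 1 := by
      refine ContinuousOn.intervalIntegrable fun t ht => ContinuousAt.continuousWithinAt ?_
      have h1 : ContinuousAt f' (a + (t : ℂ) • y) := by
        refine hp.analyticAt_of_mem ?_ |>.continuousAt
        rw [Metric.mem_eball, edist_eq_enorm_sub, add_sub_cancel_left]
        refine lt_of_le_of_lt ?_ hρr
        rw [← ofReal_norm, ← ENNReal.ofReal_coe_nnreal]
        exact ENNReal.ofReal_le_ofReal ((hty t ht).trans hy'.le)
      have h2 : ContinuousAt (fun t : ℝ => a + (t : ℂ) • y) t := by fun_prop
      exact (ContinuousAt.comp (f := fun t : ℝ => a + (t : ℂ) • y) h1 h2).clm_apply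
        continuousAt_const
    rw [intervalIntegral.integral_eq_sub_of_hasDerivAt hderiv hcont] at hint
    have hI : ∀ n : ℕ, ∫ t in (0 : ℝ)..1, (t : ℂ) ^ n • p n (fun _ => y) y =
        q (n + 1) (fun _ => y) := by
      intro n
      rw [intervalIntegral.integral_smul_const, hq]
      congr 1
      have := integral_pow (a := (0 : ℝ)) (b := 1) n
      have h2 : ∫ t in (0 : ℝ)..1, (t : ℂ) ^ n = ((∫ t in (0 : ℝ)..1, t ^ n : ℝ) : ℂ) := by
        rw [← intervalIntegral.integral_ofReal]; simp
      rw [h2, this]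
      simp
    simp only [hI] at hint
    have h0 : q 0 (fun _ => y) = f a := hq0 _
    have := (hasSum_nat_add_iff (f := fun n => q n (fun _ => y)) 1).1 hint
    simpa [h0] using this

end Primitive

section Frame

variable {E C : Type*} [NormedAddCommGroup E] [NormedSpace ℂ E] [CompleteSpace E]
  [NormedAddCommGroup C] [NormedSpace ℂ C] [CompleteSpace C]

/-- A commuting frame is given by the inverse of the derivative of a map. -/
theorem exists_primitive_of_commuting {A : E → C →L[ℂ] E} {x : E} (hA : ContDiffAt ℂ ω A x)
    (hx : (A x).IsInvertible)
    (hcomm : ∀ᶠ e in 𝓝 x, ∀ c d, fderiv ℂ A e (A e c) d = fderiv ℂ A e (A e d) c) :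
    ∃ w : E → C, ContDiffAt ℂ ω w x ∧ w x = 0 ∧
      ∀ᶠ e in 𝓝 x, ∃ D : C ≃L[ℂ] E, (D : C →L[ℂ] E) = A e ∧
        HasFDerivAt w (D.symm : E →L[ℂ] C) e := by
  obtain ⟨D₀, hD₀⟩ := hx
  -- The dual coframe, a `C`-valued one-form. Differentiating `θ (A c) = c` turns commutation of the
  -- frame into symmetry of `dθ`, that is, closedness, and the Poincaré lemma on a ball yields a
  -- primitive.
  let θ : E → E →L[ℂ] C := fun e => (A e).inverse
  have hθ : ContDiffAt ℂ ω θ x := by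
    refine ContDiffAt.comp (g := ContinuousLinearMap.inverse) x ?_ hA
    rw [← hD₀]
    exact contDiffAt_map_inverse D₀
  have hinv : ∀ᶠ e in 𝓝 x, A e ∈ range ((↑) : (C ≃L[ℂ] E) → C →L[ℂ] E) := by
    refine hA.continuousAt.eventually ?_
    rw [← hD₀]
    exact D₀.nhds
  have hθA : ∀ e, A e ∈ range ((↑) : (C ≃L[ℂ] E) → C →L[ℂ] E) →
      (∀ c, θ e (A e c) = c) ∧ ∀ v, A e (θ e v) = v := by
    rintro e ⟨D, hD⟩
    have : θ e = D.symm := by simp only [θ]; rw [← hD, ContinuousLinearMap.inverse_equiv]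
    rw [this, ← hD]
    simp
  have hsymm : ∀ᶠ e in 𝓝 x, ∀ v w, fderiv ℂ θ e v w = fderiv ℂ θ e w v := by
    have hdθ : ∀ᶠ e in 𝓝 x, ∀ v c, fderiv ℂ θ e v (A e c) = - θ e (fderiv ℂ A e v c) := by
      filter_upwards [eventually_eventually_nhds.2 hinv, hA.eventually (by simp),
        hθ.eventually (by simp)] with e h1 h2 h3 v c
      have h4 : HasFDerivAt (fun e => θ e (A e c)) (0 : E →L[ℂ] C) e :=
        (hasFDerivAt_const c e).congr_of_eventuallyEq
          (h1.mono fun e he => (hθA e he).1 c)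
      have h5 := (h3.differentiableAt (by simp)).hasFDerivAt.clm_apply
        ((h2.differentiableAt (by simp)).hasFDerivAt.clm_apply (hasFDerivAt_const c e))
      have h6 := congrArg (fun l : E →L[ℂ] C => l v) (h5.unique h4)
      simp at h6
      rw [← add_eq_zero_iff_eq_neg, add_comm]
      exact h6
    filter_upwards [hdθ, hcomm, hinv] with e h1 h2 h3 v w
    have h4 := (hθA e h3).2
    rw [← h4 v, ← h4 w, h1, h1, h4, h4]
    have h5 := h2 (θ e v) (θ e w)
    rw [h4, h4] at h5
    rw [h5]
  obtain ⟨ε, hε, hball⟩ := Metric.eventually_nhds_iff_ball.1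
    (hsymm.and ((hθ.eventually (by simp)).and hinv))
  have hreal : ∀ e ∈ Metric.ball x ε,
      HasFDerivAt θ ((fderiv ℂ θ e).restrictScalars ℝ) e := fun e he =>
    ((hball e he).2.1.differentiableAt (by simp)).hasFDerivAt.restrictScalars ℝ
  have hdiff : DifferentiableOn ℝ θ (Metric.ball x ε) := fun e he =>
    (hreal e he).differentiableAt.differentiableWithinAt
  obtain ⟨f, hf⟩ := (convex_ball x ε).exists_forall_hasFDerivAt_of_fderiv_symmetric (𝕜 := ℂ)
    Metric.isOpen_ball hdiff
    (fun e he v w => by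
      rw [(hreal e he).fderiv]
      exact (hball e he).1 v w)
  have hf' : ∀ᶠ e in 𝓝 x, HasFDerivAt f (θ e) e :=
    eventually_of_mem (Metric.ball_mem_nhds x hε) hf
  refine ⟨fun e => f e - f x, ?_, sub_self _, ?_⟩
  · exact (analyticAt_of_hasFDerivAt hf' hθ.analyticAt).contDiffAt.sub contDiffAt_const
  · filter_upwards [hf', hinv] with e h1 ⟨D, hD⟩
    refine ⟨D, hD, ?_⟩
    have : θ e = D.symm := by simp only [θ]; rw [← hD, ContinuousLinearMap.inverse_equiv]
    rw [← this]
    exact h1.sub_const _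

end Frame

/-! ### Straightening abelian algebras of holomorphic vector fields -/

/-- Finitely many vectors generate `C`, so finitely many eventual equalities suffice. -/
theorem eventually_clm_eq {K C G α : Type*} [NontriviallyNormedField K] [NormedAddCommGroup C]
    [NormedSpace K C] [FiniteDimensional K C] [NormedAddCommGroup G] [NormedSpace K G]
    {l : Filter α} {f g : α → C →L[K] G} (h : ∀ x, ∀ᶠ p in l, f p x = g p x) :
    ∀ᶠ p in l, f p = g p := by
  have : ∀ᶠ p in l, LinearMap.eqLocus (f p : C →ₗ[K] G) (g p : C →ₗ[K] G) = ⊤ :=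
    eventually_eq_top h
  filter_upwards [this] with p hp
  ext x
  have : x ∈ LinearMap.eqLocus (f p : C →ₗ[K] G) (g p : C →ₗ[K] G) := by rw [hp]; trivial
  exact this

theorem contDiffAt_clm_of_apply {C D G : Type*} [NormedAddCommGroup C] [NormedSpace ℂ C]
    [FiniteDimensional ℂ C] [NormedAddCommGroup D] [NormedSpace ℂ D] [NormedAddCommGroup G]
    [NormedSpace ℂ G] {A : D → C →L[ℂ] G} {x : D} (h : ∀ c, ContDiffAt ℂ ω (fun e => A e c) x) :
    ContDiffAt ℂ ω A x := by
  let e₁ : C ≃L[ℂ] (Fin (Module.finrank ℂ C) → ℂ) :=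
    ContinuousLinearEquiv.ofFinrankEq (Module.finrank_fin_fun ℂ).symm
  let e₂ := (e₁.arrowCongr (1 : G ≃L[ℂ] G)).trans (ContinuousLinearEquiv.piRing (Fin _))
  have h1 : A = fun e => e₂.symm (e₂ (A e)) := by ext1 e; simp
  rw [h1]
  exact e₂.symm.contDiff.contDiffAt.comp x (contDiffAt_pi.2 fun i => h _)

theorem eventually_eq_of_fderiv_eq_zero {C G : Type*} [NormedAddCommGroup C] [NormedSpace ℂ C]
    [NormedAddCommGroup G] [NormedSpace ℂ G] {f : C → G} {c : C}
    (hf : ∀ᶠ z in 𝓝 c, DifferentiableAt ℂ f z) (h : ∀ᶠ z in 𝓝 c, fderiv ℂ f z = 0) :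
    ∀ᶠ z in 𝓝 c, f z = f c := by
  obtain ⟨r, hr, hball⟩ := Metric.eventually_nhds_iff_ball.1 (hf.and h)
  filter_upwards [Metric.ball_mem_nhds c hr] with z hz
  exact (Metric.isOpen_ball (x := c) (ε := r)).is_const_of_fderiv_eq_zero (𝕜 := ℂ)
    (convex_ball c r).isPreconnected
    (fun w hw => (hball w hw).1.differentiableWithinAt) (fun w hw => (hball w hw).2)
    hz (Metric.mem_ball_self hr)

section Straighten

variable {E : Type v} [NormedAddCommGroup E] [NormedSpace ℂ E] [FiniteDimensional ℂ E]
  {Z : Type u} [TopologicalSpace Z] [ChartedSpace E Z] [IsManifold 𝓘(ℂ, E) ω Z]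
  {C : Type w} [NormedAddCommGroup C] [NormedSpace ℂ C] [FiniteDimensional ℂ C]
  {a : Z}

/-- Evaluation of germs, with values in the model space. -/
noncomputable def evalV (a : Z) : HolGerm E a →ₗ[ℂ] E := evalAt a

theorem evalV_apply (ξ : HolGerm E a) : evalV a ξ = val ξ.rep a := rfl

/-- Evaluation of vector fields, with values in the model space. -/
def valL (p : Z) : (Π p : Z, TangentSpace 𝓘(ℂ, E) p) →ₗ[ℂ] E where
  toFun X := val X p
  map_add' _ _ := rfl
  map_smul' _ _ := rfl

/-- Representatives chosen linearly can be controlled on one common neighbourhood. -/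
theorem exists_fields (L : C →ₗ[ℂ] HolGerm E a) :
    ∃ X : C →ₗ[ℂ] holAt E a, ∀ z, germ a (X z) = L z := by
  obtain ⟨s, hs⟩ := (germ (E := E) a).exists_rightInverse_of_surjective
    (LinearMap.range_eq_top.2 (Submodule.mkQ_surjective _))
  exact ⟨s ∘ₗ L, fun z => LinearMap.congr_fun hs (L z)⟩

/-- At a given point the parameters whose field is holomorphic there form a subspace, so one
neighbourhood serving a finite generating set serves all fields. -/
theorem eventually_forall_contMDiffAt (X : C →ₗ[ℂ] holAt E a) :
    ∀ᶠ p in 𝓝 a, ∀ z, ContMDiffAt 𝓘(ℂ, E) 𝓘(ℂ, E).tangent ω (T% ((X z).1)) p := by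
  let S : Z → Submodule ℂ C := fun p =>
    { carrier := {z | ContMDiffAt 𝓘(ℂ, E) 𝓘(ℂ, E).tangent ω (T% ((X z).1)) p}
      add_mem' := fun {x y} hx hy => by
        have : (X (x + y)).1 = (X x).1 + (X y).1 := by rw [map_add]; rfl
        rw [mem_ofPred_eq, this]
        exact ContMDiffAt.add_section hx hy
      zero_mem' := by
        have : (X 0).1 = 0 := by rw [map_zero]; rfl
        rw [mem_ofPred_eq, this]
        exact (Bundle.contMDiff_zeroSection ℂ _).contMDiffAt
      smul_mem' := fun r x hx => by
        have : (X (r • x)).1 = r • (X x).1 := by rw [map_smul]; rfl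
        rw [mem_ofPred_eq, this]
        exact ContMDiffAt.const_smul_section hx }
  have : ∀ᶠ p in 𝓝 a, S p = ⊤ := eventually_eq_top fun z => (X z).2
  filter_upwards [this] with p hp z
  have : z ∈ S p := by rw [hp]; trivial
  exact this

/-- Commuting fields that span the tangent space become constant in suitable coordinates. -/
theorem exists_straightening (L : C →ₗ[ℂ] HolGerm E a) (hL : ∀ x y, ⁅L x, L y⁆ = 0)
    (hbij : Function.Bijective fun z => evalV a (L z)) :
    ∃ (X : C →ₗ[ℂ] Π p : Z, TangentSpace 𝓘(ℂ, E) p) (ψ : OpenPartialHomeomorph C Z) (r : ℝ),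
      0 < r ∧ ψ.source = Metric.ball 0 r ∧ ψ 0 = a ∧ (∀ z, (L z).rep =ᶠ[𝓝 a] X z) ∧
      (∀ p ∈ ψ.target, ∀ z, ContMDiffAt 𝓘(ℂ, E) 𝓘(ℂ, E).tangent ω (T% (X z)) p) ∧
      (∀ z ∈ ψ.source, ContMDiffAt 𝓘(ℂ, C) 𝓘(ℂ, E) ω ψ z) ∧
      (∀ p ∈ ψ.target, ContMDiffAt 𝓘(ℂ, E) 𝓘(ℂ, C) ω ψ.symm p) ∧
      ∀ z ∈ ψ.source, (mD ℂ C E ψ z).IsInvertible ∧ ∀ x, mD ℂ C E ψ z x = val (X x) (ψ z) := by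
  have : CompleteSpace E := FiniteDimensional.complete ℂ E
  have : CompleteSpace C := FiniteDimensional.complete ℂ C
  obtain ⟨X₀, hX₀⟩ := exists_fields L
  let X : C →ₗ[ℂ] Π p : Z, TangentSpace 𝓘(ℂ, E) p := (holAt E a).subtype ∘ₗ X₀
  have hX : ∀ z, X z ∈ holAt E a := fun z => (X₀ z).2
  have hLX : ∀ z, (L z).rep =ᶠ[𝓝 a] X z := fun z => by
    rw [← hX₀]; exact rep_germ _
  let A : E → C →L[ℂ] E := fun e => LinearMap.toContinuousLinearMap
    (((mD ℂ E E (chartAt E a).symm e).inverse : E →ₗ[ℂ] E) ∘ₗ valL ((chartAt E a).symm e) ∘ₗ X)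
  have hAloc : ∀ e z, A e z = loc a (X z) e := fun e z => rfl
  have ha := mem_chart_source E a
  have hA : ContDiffAt ℂ ω A (chartAt E a a) :=
    contDiffAt_clm_of_apply fun z => contDiffAt_loc (hX z)
  have hAa : (A (chartAt E a a)).IsInvertible := by
    have h1 : ∀ z, A (chartAt E a a) z = chartDeriv a a ha (evalV a (L z)) := fun z => by
      rw [hAloc, loc_apply a _ ha, evalV_apply]
      exact congrArg (chartDeriv a a ha) ((hLX z).self_of_nhds).symm
    have h2 : Function.Bijective (A (chartAt E a a) : C →ₗ[ℂ] E) := by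
      have : ⇑(A (chartAt E a a) : C →ₗ[ℂ] E) =
          chartDeriv a a ha ∘ fun z => evalV a (L z) := funext h1
      rw [this]
      exact (chartDeriv a a ha).bijective.comp hbij
    exact ⟨(LinearEquiv.ofBijective _ h2).toContinuousLinearEquiv, by ext; rfl⟩
  -- In the chart the bracket of `X c` and `X d` is the derivative of `X d` along `X c` minus that
  -- of `X c` along `X d`, so its vanishing is exactly the symmetry required of `A`.
  have hcomm : ∀ᶠ e in 𝓝 (chartAt E a a), ∀ c d,
      fderiv ℂ A e (A e c) d = fderiv ℂ A e (A e d) c := by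
    have h1 : ∀ᶠ e in 𝓝 (chartAt E a a), (fderiv ℂ A e).comp (A e) =
        ((fderiv ℂ A e).comp (A e)).flip := by
      refine eventually_clm_eq fun c => eventually_clm_eq fun d => ?_
      have ht : Tendsto (chartAt E a).symm (𝓝 (chartAt E a a)) (𝓝 a) := by
        have := (chartAt E a).continuousAt_symm (mem_chart_target E a)
        rwa [ContinuousAt, (chartAt E a).left_inv ha] at this
      have hbr : ∀ᶠ p in 𝓝 a, val (VectorField.mlieBracket 𝓘(ℂ, E) (X c) (X d)) p = 0 := by
        filter_upwards [(L c).rep_bracket (L d), (hLX c).mlieBracket_vectorField (hLX d),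
          HolGerm.rep_zero (E := E) (a := a)] with p h1 h2 h3
        rw [hL] at h1
        exact (h2.symm.trans h1.symm).trans h3
      filter_upwards [eventually_loc_mlieBracket (hX c) (hX d), ht.eventually hbr,
        hA.eventually (by simp)] with e h1 h2 h3
      have h4 : loc a (VectorField.mlieBracket 𝓘(ℂ, E) (X c) (X d)) e =
        (mD ℂ E E (chartAt E a).symm e).inverse
          (val (VectorField.mlieBracket 𝓘(ℂ, E) (X c) (X d)) ((chartAt E a).symm e)) := rfl
      rw [h2, map_zero, h1] at h4
      have h5 : ∀ b v, fderiv ℂ (loc a (X b)) e v = fderiv ℂ A e v b := fun b v => by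
        have := ((h3.differentiableAt (by simp)).hasFDerivAt.clm_apply (hasFDerivAt_const b e)).fderiv
        refine (congrArg (fun l : E →L[ℂ] E => l v) this).trans ?_
        simp
      have h6 : fderiv ℂ (loc a (X d)) e (loc a (X c) e) -
        fderiv ℂ (loc a (X c)) e (loc a (X d) e) = 0 := h4
      rw [h5, h5] at h6
      exact sub_eq_zero.1 h6
    filter_upwards [h1] with e he c d
    have := congrArg (fun B : C →L[ℂ] C →L[ℂ] E => B c d) he
    exact this
  obtain ⟨w, hw, hw0, hwD⟩ := exists_primitive_of_commuting hA hAa hcomm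
  obtain ⟨D₀, hD₀, hwD₀⟩ := hwD.self_of_nhds
  let W : OpenPartialHomeomorph E C := hw.toOpenPartialHomeomorph w hwD₀ (by simp)
  have hWa : chartAt E a a ∈ W.source := hw.mem_toOpenPartialHomeomorph_source hwD₀ (by simp)
  let ψ₀ : OpenPartialHomeomorph C Z := ((chartAt E a).trans W).symm
  have hψ₀s : ∀ p, ψ₀.symm p = w (chartAt E a p) := fun p => rfl
  have haT : a ∈ ψ₀.target := by
    change a ∈ ((chartAt E a).trans W).source
    rw [OpenPartialHomeomorph.trans_source]
    exact ⟨ha, hWa⟩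
  have hs0 : ψ₀.symm a = 0 := by rw [hψ₀s, hw0]
  have h0S : (0 : C) ∈ ψ₀.source := by rw [← hs0]; exact ψ₀.symm.map_source haT
  have hψ0 : ψ₀ 0 = a := by rw [← hs0]; exact ψ₀.right_inv haT
  have hW0 : W.symm 0 = chartAt E a a := by rw [← hw0]; exact W.left_inv hWa
  have hψ₀an : ContMDiffAt 𝓘(ℂ, C) 𝓘(ℂ, E) ω ψ₀ 0 := by
    have h1 : ContDiffAt ℂ ω W.symm 0 := by
      refine W.contDiffAt_symm (f₀' := D₀.symm) ?_ ?_ ?_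
      · rw [← hw0]; exact W.map_source hWa
      · rw [hW0]; exact hwD₀
      · rw [hW0]; exact hw
    refine ContMDiffAt.comp (g := (chartAt E a).symm) (I' := 𝓘(ℂ, E)) 0 ?_ h1.contMDiffAt
    change ContMDiffAt 𝓘(ℂ, E) 𝓘(ℂ, E) ω (chartAt E a).symm (W.symm 0)
    rw [hW0]
    exact contMDiffAt_chart_symm a (mem_chart_target E a)
  have hwan : ContMDiffAt 𝓘(ℂ, E) 𝓘(ℂ, C) ω ψ₀.symm a :=
    ContMDiffAt.comp (g := w) (I' := 𝓘(ℂ, E)) a hw.contMDiffAt (contMDiffAt_chart a ha)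
  have hψt : Tendsto ψ₀ (𝓝 0) (𝓝 a) := by
    have := ψ₀.continuousAt h0S
    rwa [ContinuousAt, hψ0] at this
  have hev : ∀ᶠ z in 𝓝 (0 : C), z ∈ ψ₀.source ∧ ContMDiffAt 𝓘(ℂ, C) 𝓘(ℂ, E) ω ψ₀ z ∧
      (∀ x, ContMDiffAt 𝓘(ℂ, E) 𝓘(ℂ, E).tangent ω (T% (X x)) (ψ₀ z)) ∧
      ContMDiffAt 𝓘(ℂ, E) 𝓘(ℂ, C) ω ψ₀.symm (ψ₀ z) ∧
      ∃ D : C ≃L[ℂ] E, (D : C →L[ℂ] E) = A (chartAt E a (ψ₀ z)) ∧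
        HasFDerivAt w (D.symm : E →L[ℂ] C) (chartAt E a (ψ₀ z)) :=
    (ψ₀.open_source.eventually_mem h0S).and <| (eventually_contMDiffAt hψ₀an).and <|
      (hψt.eventually (eventually_forall_contMDiffAt X₀)).and <|
      (hψt.eventually (eventually_contMDiffAt hwan)).and <|
      hψt.eventually (((chartAt E a).continuousAt ha).eventually hwD)
  obtain ⟨r, hr, hball⟩ := Metric.eventually_nhds_iff_ball.1 hev
  -- A ball contains with `z` the segment from `0` to `z`, whose image will be the integral curve
  -- defining the exponential.
  let ψ := ψ₀.restrOpen (Metric.ball 0 r) Metric.isOpen_ball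
  have hsource : ψ.source = Metric.ball 0 r := by
    rw [OpenPartialHomeomorph.restrOpen_source]
    exact inter_eq_right.2 fun z hz => (hball z hz).1
  have htarget : ∀ p ∈ ψ.target, ∃ z ∈ Metric.ball (0 : C) r, ψ₀ z = p := fun p hp =>
    ⟨ψ.symm p, hsource ▸ ψ.map_target hp, ψ.right_inv hp⟩
  refine ⟨X, ψ, r, hr, hsource, hψ0, hLX, ?_, ?_, ?_, ?_⟩
  · intro p hp z
    obtain ⟨y, hy, rfl⟩ := htarget p hp
    exact (hball y hy).2.2.1 z
  · intro z hz
    rw [hsource] at hz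
    exact (hball z hz).2.1
  · intro p hp
    obtain ⟨y, hy, rfl⟩ := htarget p hp
    exact (hball y hy).2.2.2.1
  · intro z hz
    rw [hsource] at hz
    obtain ⟨h1, h2, -, h3, D, hD, hwD⟩ := hball z hz
    have hpt : ψ₀ z ∈ ψ₀.target := ψ₀.map_source h1
    have hp : ψ₀ z ∈ (chartAt E a).source := by
      have : ψ₀ z ∈ ((chartAt E a).trans W).source := hpt
      rw [OpenPartialHomeomorph.trans_source] at this
      exact this.1
    have h4 : mD ℂ E C ψ₀.symm (ψ₀ z) =
        (D.symm : E →L[ℂ] C).comp (chartDeriv a (ψ₀ z) hp : E →L[ℂ] E) := by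
      have h5 : MDifferentiableAt 𝓘(ℂ, E) 𝓘(ℂ, C) w (chartAt E a (ψ₀ z)) :=
        hwD.differentiableAt.mdifferentiableAt
      have h6 := mD_comp (g := w) (mdifferentiableAt_chart a hp) h5
      rw [mD_chart a hp, mD_eq_fderiv, hwD.fderiv] at h6
      exact h6
    have h7 : ψ₀.symm (ψ₀ z) = z := ψ₀.left_inv h1
    have h8 : ∀ v, mD ℂ C E ψ₀ z (mD ℂ E C ψ₀.symm (ψ₀ z) v) = v := fun v => by
      have := mD_left_inverse (f := ψ₀.symm) (g := ψ₀) (p := ψ₀ z)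
        (h3.mdifferentiableAt (by simp)) (by rw [h7]; exact h2.mdifferentiableAt (by simp))
        (by filter_upwards [ψ₀.open_target.mem_nhds hpt] with q hq using ψ₀.right_inv hq) v
      rwa [h7] at this
    have h9 : mD ℂ C E ψ z = (D.trans (chartDeriv a (ψ₀ z) hp).symm : C ≃L[ℂ] E) := by
      ext x
      have := h8 ((chartDeriv a (ψ₀ z) hp).symm (D x))
      rw [h4] at this
      change mD ℂ C E ψ₀ z x = _
      simpa using this
    refine ⟨⟨_, h9.symm⟩, fun x => ?_⟩
    rw [h9]
    have h10 : D x = chartDeriv a (ψ₀ z) hp (val (X x) (ψ₀ z)) := by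
      rw [← loc_apply a _ hp, ← hAloc, ← hD]; rfl
    change (chartDeriv a (ψ₀ z) hp).symm (D x) = val (X x) (ψ₀ z)
    rw [h10, ContinuousLinearEquiv.symm_apply_apply]

/-- A germ that commutes with a commuting frame and vanishes at `a` is zero. -/
theorem HolGerm.eq_zero_of_commuting (L : C →ₗ[ℂ] HolGerm E a) (hL : ∀ x y, ⁅L x, L y⁆ = 0)
    (hbij : Function.Bijective fun z => evalV a (L z)) {η : HolGerm E a}
    (hη : ∀ z, ⁅L z, η⁆ = 0) (h0 : evalV a η = 0) : η = 0 := by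
  have : CompleteSpace E := FiniteDimensional.complete ℂ E
  have : CompleteSpace C := FiniteDimensional.complete ℂ C
  have : IsManifold 𝓘(ℂ, E) 1 Z := IsManifold.of_le (n := ω) le_top
  have : IsManifold 𝓘(ℂ, E) (minSmoothness ℂ 2) Z := IsManifold.of_le (n := ω) le_top
  have : IsManifold 𝓘(ℂ, E) (minSmoothness ℂ 3) Z := IsManifold.of_le (n := ω) le_top
  obtain ⟨X, ψ, r, hr, hsource, hψ0, hLX, hXan, hψan, hsan, hψX⟩ := exists_straightening L hL hbij
  have h0S : (0 : C) ∈ ψ.source := by rw [hsource]; exact Metric.mem_ball_self hr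
  have hψt : Tendsto ψ (𝓝 0) (𝓝 a) := by
    have := ψ.continuousAt h0S
    rwa [ContinuousAt, hψ0] at this
  let pb : (Π p : Z, TangentSpace 𝓘(ℂ, E) p) → C → C := fun Y =>
    VectorField.mpullback 𝓘(ℂ, C) 𝓘(ℂ, E) ψ Y
  have hpb : ∀ Y z, pb Y z = (mD ℂ C E ψ z).inverse (val Y (ψ z)) := fun Y z => rfl
  have hpbX : ∀ x, ∀ z ∈ ψ.source, pb (X x) z = x := fun x z hz => by
    obtain ⟨⟨D, hD⟩, h⟩ := hψX z hz
    rw [hpb, ← h, ← hD, ContinuousLinearMap.inverse_equiv]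
    simp
  have hg : ContDiffAt ℂ ω (pb η.rep) 0 := by
    refine contMDiffAt_vectorSpace_iff_contDiffAt.1 ?_
    refine ContMDiffAt.mpullback_vectorField_preimage (n := ω) ?_ (hψan 0 h0S) (hψX 0 h0S).1 le_top
    rw [hψ0]
    exact η.rep_mem.self_of_nhds
  -- In the coordinates `ψ` the frame is constant, so commuting with it means that all directional
  -- derivatives of the pulled back `η` vanish.
  have hdg : ∀ᶠ z in 𝓝 (0 : C), fderiv ℂ (pb η.rep) z = 0 := by
    refine eventually_clm_eq fun x => ?_
    have hbr : ∀ᶠ p in 𝓝 a, val (VectorField.mlieBracket 𝓘(ℂ, E) (X x) η.rep) p = 0 := by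
      filter_upwards [(L x).rep_bracket η,
        (hLX x).mlieBracket_vectorField (EventuallyEq.refl _ η.rep),
        HolGerm.rep_zero (E := E) (a := a)] with p h1 h2 h3
      rw [hη] at h1
      exact (h2.symm.trans h1.symm).trans h3
    filter_upwards [hψt.eventually hbr, ψ.open_source.mem_nhds h0S,
      hψt.eventually (mdiffAt_of_mem η.rep_mem)] with z h1 h2 h3
    have h4 := VectorField.mpullback_mlieBracket
      ((hXan _ (ψ.map_source h2) x).mdifferentiableAt (by simp)) h3 (hψan z h2) le_top
    have h5 : pb (VectorField.mlieBracket 𝓘(ℂ, E) (X x) η.rep) z =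
      VectorField.lieBracket ℂ (pb (X x)) (pb η.rep) z := h4.trans (mlieBracket_vectorSpace _ _ z)
    have h6 : pb (X x) =ᶠ[𝓝 z] fun _ => x := by
      filter_upwards [ψ.open_source.mem_nhds h2] with y hy using hpbX x y hy
    rw [hpb, h1, map_zero, VectorField.lieBracket_eq] at h5
    simp only [h6.fderiv_eq, h6.self_of_nhds] at h5
    simpa using h5.symm
  have hconst := eventually_eq_of_fderiv_eq_zero
    ((hg.eventually (by simp)).mono fun z hz => hz.differentiableAt (by simp)) hdg
  have hg0 : pb η.rep 0 = 0 := by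
    rw [hpb, hψ0, ← evalV_apply, h0, map_zero]
  have hzero : ∀ᶠ z in 𝓝 (0 : C), val η.rep (ψ z) = 0 := by
    filter_upwards [hconst, ψ.open_source.mem_nhds h0S] with z h1 h2
    obtain ⟨⟨D, hD⟩, -⟩ := hψX z h2
    rw [hg0, hpb, ← hD, ContinuousLinearMap.inverse_equiv] at h1
    simpa using h1
  have haT : a ∈ ψ.target := by rw [← hψ0]; exact ψ.map_source h0S
  have hst : Tendsto ψ.symm (𝓝 a) (𝓝 0) := by
    have := ψ.symm.continuousAt haT
    rwa [ContinuousAt, ← hψ0, ψ.left_inv h0S, hψ0] at this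
  refine HolGerm.ext_rep ?_
  filter_upwards [hst.eventually hzero, ψ.open_target.mem_nhds haT,
    HolGerm.rep_zero (E := E) (a := a)] with p h1 h2 h3
  rw [ψ.right_inv h2] at h1
  rw [h3]
  exact h1

end Straighten

/-! ### Submanifolds that are invariant under real translations are tubes -/

section Graph

variable {V : Type*} [NormedAddCommGroup V] [NormedSpace ℝ V] [FiniteDimensional ℝ V]
  {K : Submodule ℝ V} {π : V →L[ℝ] K} {G : K → V} {ρ : ℝ}

/-- The chart `y ↦ y - G (π y) + π y` that maps the graph of `G` into `K`. -/
noncomputable def graphChart (hπ : ∀ k : K, π k = k) (hG : ContDiffOn ℝ ω G (Metric.ball 0 ρ))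
    (hπG : ∀ k ∈ Metric.ball 0 ρ, π (G k) = k) : OpenPartialHomeomorph V V where
  toFun y := y - G (π y) + π y
  invFun y := y + G (π y) - π y
  source := π ⁻¹' Metric.ball 0 ρ
  target := π ⁻¹' Metric.ball 0 ρ
  map_source' y hy := by
    have : π (y - G (π y) + π y) = π y := by
      rw [map_add, map_sub, hπ, hπG _ hy]; abel
    rwa [mem_preimage, this]
  map_target' y hy := by
    have : π (y + G (π y) - π y) = π y := by
      rw [map_sub, map_add, hπ, hπG _ hy]; abel
    rwa [mem_preimage, this]
  left_inv' y hy := by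
    have : π (y - G (π y) + π y) = π y := by
      rw [map_add, map_sub, hπ, hπG _ hy]; abel
    rw [this]; abel
  right_inv' y hy := by
    have : π (y + G (π y) - π y) = π y := by
      rw [map_sub, map_add, hπ, hπG _ hy]; abel
    rw [this]; abel
  open_source := Metric.isOpen_ball.preimage π.continuous
  open_target := Metric.isOpen_ball.preimage π.continuous
  continuousOn_toFun := by
    have : ContinuousOn (fun y => G (π y)) (π ⁻¹' Metric.ball 0 ρ) :=
      hG.continuousOn.comp π.continuous.continuousOn fun _ h => h
    exact (continuousOn_id.sub this).add (by fun_prop)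
  continuousOn_invFun := by
    have : ContinuousOn (fun y => G (π y)) (π ⁻¹' Metric.ball 0 ρ) :=
      hG.continuousOn.comp π.continuous.continuousOn fun _ h => h
    exact (continuousOn_id.add this).sub (by fun_prop)

/-- On the chart domain `π` kills `y - G (π y)`, so this difference lies in `K` only if it is zero,
that is, only on the graph. -/
theorem isAnalyticSubmanifold_graph (hπ : ∀ k : K, π k = k)
    (hG : ContDiffOn ℝ ω G (Metric.ball 0 ρ)) (hπG : ∀ k ∈ Metric.ball 0 ρ, π (G k) = k) :
    IsAnalyticSubmanifold V (G '' Metric.ball 0 ρ) := by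
  rintro _ ⟨k, hk, rfl⟩
  have hGπ : ContDiffOn ℝ ω (fun y => G (π y)) (π ⁻¹' Metric.ball 0 ρ) :=
    hG.comp π.contDiff.contDiffOn fun _ h => h
  have hKπ : ContDiffOn ℝ ω (fun y => (π y : V)) (π ⁻¹' Metric.ball 0 ρ) :=
    (K.subtypeL.contDiff.comp π.contDiff).contDiffOn
  refine ⟨graphChart hπ hG hπG, ?_, ?_, K, ?_⟩
  · have h1 : ContMDiffOn 𝓘(ℝ, V) 𝓘(ℝ, V) ω (graphChart hπ hG hπG)
        (graphChart hπ hG hπG).source := ((contDiffOn_id.sub hGπ).add hKπ).contMDiffOn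
    have h2 : ContMDiffOn 𝓘(ℝ, V) 𝓘(ℝ, V) ω (graphChart hπ hG hπG).symm
        (graphChart hπ hG hπG).target := ((contDiffOn_id.add hGπ).sub hKπ).contMDiffOn
    exact OpenPartialHomeomorph.mem_maximalAtlas_of_contMDiffOn _ h1 h2
  · change π (G k) ∈ Metric.ball 0 ρ
    rwa [hπG k hk]
  · intro y hy
    change y ∈ G '' Metric.ball 0 ρ ↔ y - G (π y) + π y ∈ K
    have hy' : π y ∈ Metric.ball 0 ρ := hy
    constructor
    · rintro ⟨k, hk, rfl⟩
      rw [hπG k hk, sub_self, zero_add]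
      exact k.2
    · intro h
      have h1 : y - G (π y) ∈ K := by simpa using sub_mem h (π y).2
      have h2 := hπ ⟨_, h1⟩
      rw [map_sub, hπG _ hy', sub_self] at h2
      have h3 : y - G (π y) = 0 := (congrArg Subtype.val h2).symm
      exact ⟨π y, hy', (sub_eq_zero.1 h3).symm⟩

end Graph

section Tube

variable {C : Type*} [NormedAddCommGroup C] [NormedSpace ℂ C] [FiniteDimensional ℂ C]
  {V : Submodule ℝ C} {P : Type*} [NormedAddCommGroup P] [NormedSpace ℝ P] [FiniteDimensional ℝ P]

/-- A parametrized germ at `0` with tangent spaces containing `V` is the graph of a map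
`V × K → iV` not depending on the first variable. -/
theorem exists_graph_of_param (hV : IsRealForm V) {N : Set C} {σ : P → C} {r : C → P}
    (h : IsParam C N 0 σ r) (hT : ∀ x ∈ V, ∀ᶠ z in 𝓝[N] 0, x ∈ Tan C N z) :
    ∃ (K : Submodule ℝ V) (π : V →L[ℝ] K) (G : K → V), (∀ k : K, π k = k) ∧ G 0 = 0 ∧
      ContDiffAt ℝ ω G 0 ∧ (∀ᶠ k in 𝓝 0, π (G k) = k) ∧
      ∀ᶠ z in 𝓝 0, z ∈ N ↔ (reIm hV z).2 = G (π (reIm hV z).2) := by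
  have : CompleteSpace P := FiniteDimensional.complete ℝ P
  have hσ : ContDiffAt ℝ ω σ 0 := h.smooth.contDiffAt
  have hσt : Tendsto σ (𝓝 0) (𝓝[N] 0) := h.tendsto
  -- `σ ∘ r` is the identity on `N`, so `dr x` is a preimage under `dσ` of the tangent vector `x`.
  have hsec : ∀ x : V, ∀ᶠ p in 𝓝 0, ∃ u, fderiv ℝ σ p u = x := by
    intro x
    have hr : ∀ᶠ z in 𝓝[N] (0 : C), MDifferentiableAt 𝓘(ℝ, C) 𝓘(ℝ, P) r z :=
      (eventually_mdifferentiableAt h.smooth_inv).filter_mono nhdsWithin_le_nhds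
    filter_upwards [hσt.eventually (hT x x.2), h.left_inv,
      hσt.eventually (eventually_eventually_nhdsWithin.2 h.right_inv), hσt.eventually hr,
      eventually_mdifferentiableAt h.smooth] with p h1 h2 h3 h4 h5
    refine ⟨mD ℝ C P r (σ p) x, ?_⟩
    have h6 : MDifferentiableAt 𝓘(ℝ, P) 𝓘(ℝ, C) σ (r (σ p)) := by rwa [h2]
    have h7 := mD_congr_of_mem_Tan (f := fun q => σ (r q)) (g := fun q => q) (h6.comp (σ p) h4)
      mdifferentiableAt_id h3 h1
    rw [mD_comp h4 h6, mD_id, h2, mD_eq_fderiv] at h7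
    exact h7
  let D := fderiv ℝ σ 0
  have hD : HasFDerivAt σ D 0 := (hσ.differentiableAt (by simp)).hasFDerivAt
  have hDinj : ∀ u, D u = 0 → u = 0 := by
    intro u hu
    have h1 := mD_left_inverse (f := σ) (g := r) (h.smooth.mdifferentiableAt (by simp))
      (by rw [h.map_zero]; exact h.smooth_inv.mdifferentiableAt (by simp)) h.left_inv u
    rw [mD_eq_fderiv σ] at h1
    change mD ℝ C P r (σ 0) (D u) = u at h1
    rw [← h1, hu, map_zero]
  let iV : V →ₗ[ℝ] C :=
    { toFun := fun y => Complex.I • (y : C)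
      map_add' := fun x y => by simp
      map_smul' := fun t x => smul_comm Complex.I t (x : C) }
  -- The imaginary directions in the tangent space at `0`: the range of `D` contains `V` and
  -- therefore equals `V + iK`.
  let K : Submodule ℝ V := (LinearMap.range (D : P →ₗ[ℝ] C)).comap iV
  have hK : ∀ y : V, y ∈ K ↔ ∃ u, D u = Complex.I • (y : C) := fun y => Iff.rfl
  obtain ⟨π₀, hπ₀⟩ := K.subtype.exists_leftInverse_of_injective K.ker_subtype
  let π : V →L[ℝ] K := LinearMap.toContinuousLinearMap π₀
  have hπ : ∀ k : K, π k = k := fun k => LinearMap.congr_fun hπ₀ k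
  -- The real part and the `K`-component of the imaginary part are coordinates on `N` near `0`; the
  -- map `J` below is the resulting parametrization of `N` by `V × K`.
  let Q : C →L[ℝ] V × K := ((ContinuousLinearMap.fst ℝ V V).prod
    (π.comp (ContinuousLinearMap.snd ℝ V V))).comp (reIm hV : C →L[ℝ] V × V)
  have hQ : ∀ z, Q z = ((reIm hV z).1, π (reIm hV z).2) := fun z => rfl
  have hQV : ∀ x : V, Q x = (x, 0) := fun x => by rw [hQ, reIm_coe, map_zero]
  have hbij : Function.Bijective (Q.comp D : P →ₗ[ℝ] V × K) := by
    constructor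
    · refine (injective_iff_map_eq_zero _).2 fun u hu => hDinj u ?_
      change Q (D u) = 0 at hu
      rw [hQ, Prod.ext_iff] at hu
      have h1 : (reIm hV (D u)).1 = 0 := hu.1
      have h2 : π (reIm hV (D u)).2 = 0 := hu.2
      have h3 : (reIm hV (D u)).2 ∈ K := by
        refine ⟨u, ?_⟩
        have := re_add_im hV (D u)
        rw [h1] at this
        change D u = Complex.I • ((reIm hV (D u)).2 : C)
        simpa using this.symm
      have h4 := hπ ⟨_, h3⟩
      rw [h2] at h4
      have h5 : (reIm hV (D u)).2 = 0 := (congrArg Subtype.val h4).symm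
      rw [← re_add_im hV (D u), h1, h5]; simp
    · rintro ⟨x, k⟩
      obtain ⟨u, hu⟩ := (hsec x).self_of_nhds
      obtain ⟨u', hu'⟩ := (hK k).1 k.2
      refine ⟨u + u', ?_⟩
      change Q (D (u + u')) = (x, k)
      have hDu : D u = x := hu
      rw [map_add, hDu, hu', hQ, reIm_add, hπ]
  let B : P ≃L[ℝ] V × K := (LinearEquiv.ofBijective _ hbij).toContinuousLinearEquiv
  have hH : ContDiffAt ℝ ω (fun p => Q (σ p)) 0 := Q.contDiff.contDiffAt.comp 0 hσ
  have hB : HasFDerivAt (fun p => Q (σ p)) (B : P →L[ℝ] V × K) 0 := by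
    have : (B : P →L[ℝ] V × K) = Q.comp D := by ext u <;> rfl
    rw [this]
    exact Q.hasFDerivAt.comp 0 hD
  let H := hH.toOpenPartialHomeomorph _ hB (by simp)
  have hHσ : ∀ p, H p = Q (σ p) := fun p => rfl
  have h0S : (0 : P) ∈ H.source := hH.mem_toOpenPartialHomeomorph_source hB (by simp)
  have hH0 : H 0 = 0 := by rw [hHσ, h.map_zero, map_zero]
  have h0T : (0 : V × K) ∈ H.target := hH0 ▸ H.map_source h0S
  have hHs0 : H.symm 0 = 0 := by
    have := H.left_inv h0S
    rwa [hH0] at this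
  have hHs : ContDiffAt ℝ ω H.symm 0 := by
    refine H.contDiffAt_symm h0T (f₀' := B) ?_ ?_
    · rw [hHs0]; exact hB
    · rw [hHs0]; exact hH
  have hHt : Tendsto H.symm (𝓝 0) (𝓝 0) := by
    have := hHs.continuousAt
    rwa [ContinuousAt, hHs0] at this
  let J : V × K → C := fun q => σ (H.symm q)
  have hJ : ContDiffAt ℝ ω J 0 := by
    refine ContDiffAt.comp (g := σ) 0 ?_ hHs
    rw [hHs0]; exact hσ
  have hJ0 : J 0 = 0 := by simp only [J, hHs0, h.map_zero]
  have hQJ : ∀ᶠ q in 𝓝 0, Q (J q) = q := by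
    filter_upwards [H.open_target.mem_nhds h0T] with q hq using H.right_inv hq
  have hJN : ∀ᶠ q in 𝓝 0, J q ∈ N := hHt.eventually h.mem
  have hJd : ∀ᶠ q in 𝓝 0, DifferentiableAt ℝ J q :=
    (hJ.eventually (by simp)).mono fun q hq => hq.differentiableAt (by simp)
  -- Vectors `x ∈ V` are tangent to `N` and `Q x = (x, 0)`, so the derivative of `J` in the
  -- direction `x` is `x` itself. Integration then gives `J (x, k) = x + J (0, k)`.
  have hdJ : ∀ᶠ q in 𝓝 0, (fderiv ℝ J q).comp (ContinuousLinearMap.inl ℝ V K) = V.subtypeL := by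
    refine eventually_clm_eq fun x => ?_
    have hd : ∀ᶠ p in 𝓝 0, DifferentiableAt ℝ σ p :=
      (hσ.eventually (by simp)).mono fun q hq => hq.differentiableAt (by simp)
    filter_upwards [hHt.eventually (hsec x), hJd, H.open_target.mem_nhds h0T,
      hHt.eventually hd, hHt.eventually (H.open_source.eventually_mem h0S)]
      with q ⟨u, hu⟩ h2 h3 h4 h5
    have h6 : HasFDerivAt (fun p => Q (σ p)) (Q.comp (fderiv ℝ σ (H.symm q))) (H.symm q) :=
      Q.hasFDerivAt.comp _ h4.hasFDerivAt
    have h7 : (fun p => J (Q (σ p))) =ᶠ[𝓝 (H.symm q)] σ := by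
      filter_upwards [H.open_source.mem_nhds h5] with p hp
      exact congrArg σ (H.left_inv hp)
    have h8 : Q (σ (H.symm q)) = q := H.right_inv h3
    have h9 : HasFDerivAt (fun p => J (Q (σ p)))
        ((fderiv ℝ J q).comp (Q.comp (fderiv ℝ σ (H.symm q)))) (H.symm q) := by
      refine HasFDerivAt.comp (g := J) (H.symm q) ?_ h6
      rw [h8]; exact h2.hasFDerivAt
    have h10 := (h9.congr_of_eventuallyEq h7.symm).unique h4.hasFDerivAt
    have h11 := congrArg (fun l : P →L[ℝ] C => l u) h10
    simp only [ContinuousLinearMap.comp_apply, hu, hQV] at h11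
    exact h11
  obtain ⟨ρ, hρ, hball⟩ := Metric.eventually_nhds_iff_ball.1 ((hJd.and hdJ).and (hQJ.and hJN))
  have hmem : ∀ (x : V) (k : K), ‖x‖ < ρ → ‖k‖ < ρ → (x, k) ∈ Metric.ball (0 : V × K) ρ :=
    fun x k hx hk => by
      rw [mem_ball_zero_iff, Prod.norm_def]
      exact max_lt hx hk
  have hJx : ∀ (x : V) (k : K), ‖x‖ < ρ → ‖k‖ < ρ → J (x, k) = x + J (0, k) := by
    intro x k hx hk
    have hd : ∀ y ∈ Metric.ball (0 : V) ρ,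
        HasFDerivAt (fun y : V => J (y, k) - (y : C)) (0 : V →L[ℝ] C) y := by
      intro y hy
      have hyk := hmem y k (mem_ball_zero_iff.1 hy) hk
      have h1 : HasFDerivAt (fun y : V => (y, k)) (ContinuousLinearMap.inl ℝ V K) y :=
        hasFDerivAt_prodMk_left y k
      have h2 := ((hball _ hyk).1.1.hasFDerivAt.comp y h1).sub V.subtypeL.hasFDerivAt
      rw [(hball _ hyk).1.2, sub_self] at h2
      exact h2
    have := Metric.isOpen_ball.is_const_of_fderiv_eq_zero (𝕜 := ℝ)
      (convex_ball (0 : V) ρ).isPreconnected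
      (fun y hy => (hd y hy).differentiableAt.differentiableWithinAt)
      (fun y hy => (hd y hy).fderiv) (mem_ball_zero_iff.2 hx) (Metric.mem_ball_self hρ)
    simp only [ZeroMemClass.coe_zero, sub_zero] at this
    rw [← this]; abel
  -- `Q ∘ J` is the identity, so `J (0, k)` has real part zero and is `i G(k)`.
  let G : K → V := fun k => (reIm hV (J (0, k))).2
  have hJG : ∀ k : K, ‖k‖ < ρ → J (0, k) = Complex.I • (G k : C) ∧ π (G k) = k := by
    intro k hk
    have h1 := (hball _ (hmem 0 k (by simpa using hρ) hk)).2.1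
    rw [hQ, Prod.ext_iff] at h1
    refine ⟨?_, h1.2⟩
    have h2 : (reIm hV (J (0, k))).1 = 0 := h1.1
    have h3 := re_add_im hV (J (0, k))
    rw [h2] at h3
    simpa using h3.symm
  have hnear : ∀ᶠ k in 𝓝 (0 : K), ‖k‖ < ρ := by
    filter_upwards [Metric.ball_mem_nhds (0 : K) hρ] with k hk using mem_ball_zero_iff.1 hk
  refine ⟨K, π, G, hπ, ?_, ?_, hnear.mono fun k hk => (hJG k hk).2, ?_⟩
  · have : G 0 = (reIm hV (J 0)).2 := rfl
    rw [this, hJ0, map_zero]; rfl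
  · have h1 : ContDiffAt ℝ ω (fun k : K => ((0 : V), k)) 0 := contDiffAt_const.prodMk contDiffAt_id
    have h2 : ContDiffAt ℝ ω (fun k : K => J (0, k)) 0 := ContDiffAt.comp (g := J) (0 : K) hJ h1
    exact ((reIm hV).contDiff.contDiffAt.comp (0 : K) h2).snd
  · have ht : Tendsto (fun z => Q z) (𝓝 0) (𝓝 0) := by
      simpa using Q.continuous.tendsto 0
    have hrt : Tendsto r (𝓝 0) (𝓝 0) := by
      have := h.smooth_inv.continuousAt
      rwa [ContinuousAt, h.inv_base] at this
    filter_upwards [ht.eventually (Metric.ball_mem_nhds 0 hρ),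
      eventually_nhdsWithin_iff.1 h.right_inv,
      hrt.eventually (H.open_source.eventually_mem h0S)] with z h1 h2 h3
    have h4 : ‖(reIm hV z).1‖ < ρ ∧ ‖π (reIm hV z).2‖ < ρ := by
      have : Q z ∈ Metric.ball 0 ρ := h1
      rw [hQ, mem_ball_zero_iff, Prod.norm_def] at this
      exact max_lt_iff.1 this
    have h5 : J (Q z) = (reIm hV z).1 + Complex.I • (G (π (reIm hV z).2) : C) := by
      rw [hQ, hJx _ _ h4.1 h4.2, (hJG _ h4.2).1]
    constructor
    · intro hz
      have h6 : J (Q z) = z := by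
        have h7 : H.symm (Q z) = r z := by
          have := H.left_inv h3
          rwa [hHσ, h2 hz] at this
        simp only [J, h7, h2 hz]
      rw [h6] at h5
      have h7 := congrArg (fun z => (reIm hV z).2) h5
      simp only [reIm_add] at h7
      exact h7
    · intro hz
      rw [← hz, re_add_im] at h5
      have := (hball _ h1).2.2
      rwa [h5] at this

/-- The graph condition involves only the imaginary part of `z`. The graph of `G` over a small ball
is the base: connected as an image of a ball, embedded by the graph chart. -/
theorem exists_tube_of_param (hV : IsRealForm V) {N : Set C} {σ : P → C} {r : C → P}
    (h : IsParam C N 0 σ r) (hT : ∀ x ∈ V, ∀ᶠ z in 𝓝[N] 0, x ∈ Tan C N z) :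
    ∃ F : Set V, IsAnalyticSubmanifold V F ∧ IsConnected F ∧ (0 : C) ∈ tube V F ∧
      ∀ᶠ z in 𝓝 0, z ∈ N ↔ z ∈ tube V F := by
  obtain ⟨K, π, G, hπ, hG0, hG, hπG, hN⟩ := exists_graph_of_param hV h hT
  obtain ⟨ρ, hρ, hball⟩ := Metric.eventually_nhds_iff_ball.1
    (hπG.and (hG.eventually (by simp)))
  have hGon : ContDiffOn ℝ ω G (Metric.ball 0 ρ) := fun k hk => (hball k hk).2.contDiffWithinAt
  have h0 := Metric.mem_ball_self (x := (0 : K)) hρ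
  refine ⟨G '' Metric.ball 0 ρ,
    isAnalyticSubmanifold_graph hπ hGon fun k hk => (hball k hk).1,
    ((convex_ball (0 : K) ρ).isConnected ⟨0, h0⟩).image G hGon.continuousOn, ?_, ?_⟩
  · rw [mem_tube_iff hV, map_zero]
    exact ⟨0, h0, hG0⟩
  · have ht : Tendsto (fun z => π (reIm hV z).2) (𝓝 0) (𝓝 0) := by
      have : Continuous fun z => π (reIm hV z).2 := by fun_prop
      simpa using this.tendsto 0
    filter_upwards [hN, ht.eventually (Metric.ball_mem_nhds 0 hρ)] with z h1 h2
    rw [h1, mem_tube_iff hV]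
    constructor
    · intro hz
      exact ⟨_, h2, hz.symm⟩
    · rintro ⟨k, hk, hkz⟩
      rw [← hkz, (hball k hk).1]

end Tube

/-! ### Realizations from admissible subalgebras -/

section Realize

variable {E : Type v} [NormedAddCommGroup E] [NormedSpace ℂ E] [FiniteDimensional ℂ E]
  {Z : Type u} [TopologicalSpace Z] [ChartedSpace E Z] [IsManifold 𝓘(ℂ, E) ω Z]
  {M : Set Z} {a : Z}

theorem lie_eq_zero_of_mem_span {𝔳 : LieSubalgebra ℝ (HolGerm E a)} (h : IsLieAbelian 𝔳)
    {ξ η : HolGerm E a} (hξ : ξ ∈ Submodule.span ℂ (𝔳 : Set (HolGerm E a)))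
    (hη : η ∈ Submodule.span ℂ (𝔳 : Set (HolGerm E a))) : ⁅ξ, η⁆ = 0 := by
  have h0 : ∀ ξ ∈ 𝔳, ∀ η ∈ 𝔳, ⁅ξ, η⁆ = 0 := fun ξ hξ η hη =>
    congrArg Subtype.val (h.trivial ⟨ξ, hξ⟩ ⟨η, hη⟩)
  have h1 : ∀ ξ ∈ 𝔳, ⁅ξ, η⁆ = 0 := fun ξ hξ => by
    induction hη using Submodule.span_induction with
    | mem η hη => exact h0 ξ hξ η hη
    | zero => exact lie_zero ξ
    | add x y _ _ hx hy => rw [lie_add, hx, hy, add_zero]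
    | smul r x _ hx => rw [lie_smul, hx, smul_zero]
  induction hξ using Submodule.span_induction with
  | mem ξ hξ => exact h1 ξ hξ
  | zero => exact zero_lie η
  | add x y _ _ hx hy => rw [add_lie, hx, hy, add_zero]
  | smul r x _ hx => rw [smul_lie, hx, smul_zero]

/-- Evaluation at `a` is an isomorphism on the complexification of an admissible subalgebra. -/
theorem IsAdmissible.bijective_evalV {𝔳 : LieSubalgebra ℝ (HolGerm E a)} (h : IsAdmissible M a 𝔳) :
    Function.Bijective
      (evalV a ∘ₗ (Submodule.span ℂ (𝔳 : Set (HolGerm E a))).subtype) := by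
  set 𝔢 := Submodule.span ℂ (𝔳 : Set (HolGerm E a))
  have hsurj : Function.Surjective (evalV a ∘ₗ 𝔢.subtype) := by
    intro e
    have h1 : e ∈ 𝔢.map (evalV a) := by
      have h2 : 𝔢.map (evalV a) = ⊤ := h.spans
      rw [h2]; trivial
    obtain ⟨ξ, hξ, h2⟩ := h1
    exact ⟨⟨ξ, hξ⟩, h2⟩
  refine ⟨(injective_iff_map_eq_zero _).2 fun ξ hξ => ?_, hsurj⟩
  -- `𝔢` is not yet known to be finite dimensional. A linear section of the evaluation selects a
  -- commuting frame inside `𝔢`; `ξ` commutes with it and vanishes at `a`.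
  obtain ⟨s, hs⟩ := (evalV a ∘ₗ 𝔢.subtype).exists_rightInverse_of_surjective
    (LinearMap.range_eq_top.2 hsurj)
  have hs' : ∀ e, evalV a (s e : HolGerm E a) = e := LinearMap.congr_fun hs
  refine Subtype.ext (HolGerm.eq_zero_of_commuting (𝔢.subtype ∘ₗ s) (fun x y => ?_) ?_
    (fun z => ?_) hξ)
  · exact lie_eq_zero_of_mem_span h.abelian (s x).2 (s y).2
  · have : (fun z => evalV a ((𝔢.subtype ∘ₗ s) z)) = id := funext hs'
    rw [this]
    exact Function.bijective_id
  · exact lie_eq_zero_of_mem_span h.abelian (s z).2 ξ.2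

variable {C : Type w} [NormedAddCommGroup C] [NormedSpace ℂ C] [FiniteDimensional ℂ C]

/-- The real form corresponding to `𝔳` under a linear isomorphism of `C` with `𝔳 ⊕ i𝔳`. -/
def realFormOf (𝔳 : LieSubalgebra ℝ (HolGerm E a))
    (L : C ≃ₗ[ℂ] Submodule.span ℂ (𝔳 : Set (HolGerm E a))) : Submodule ℝ C where
  carrier := {z | (L z : HolGerm E a) ∈ 𝔳}
  add_mem' {x y} hx hy := by
    rw [mem_ofPred_eq, map_add]
    exact add_mem (S := LieSubalgebra ℝ (HolGerm E a)) hx hy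
  zero_mem' := by
    rw [mem_ofPred_eq, map_zero]
    exact zero_mem 𝔳
  smul_mem' r x hx := by
    have h : (L (r • x) : HolGerm E a) = r • (L x : HolGerm E a) :=
      congrArg Subtype.val (L.map_smul (r : ℂ) x)
    rw [mem_ofPred_eq, h]
    exact 𝔳.smul_mem r hx

theorem mem_realFormOf {𝔳 : LieSubalgebra ℝ (HolGerm E a)}
    {L : C ≃ₗ[ℂ] Submodule.span ℂ (𝔳 : Set (HolGerm E a))} {z : C} :
    z ∈ realFormOf 𝔳 L ↔ (L z : HolGerm E a) ∈ 𝔳 := Iff.rfl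

theorem exists_mem_add_I_smul_mem {𝔳 : LieSubalgebra ℝ (HolGerm E a)} {ζ : HolGerm E a}
    (hζ : ζ ∈ Submodule.span ℂ (𝔳 : Set (HolGerm E a))) :
    ∃ ξ ∈ 𝔳, ∃ η ∈ 𝔳, ζ = ξ + Complex.I • η := by
  induction hζ using Submodule.span_induction with
  | mem ξ hξ => exact ⟨ξ, hξ, 0, zero_mem _, by simp⟩
  | zero => exact ⟨0, zero_mem _, 0, zero_mem _, by simp⟩
  | add x y _ _ hx hy =>
    obtain ⟨ξ, hξ, η, hη, rfl⟩ := hx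
    obtain ⟨ξ', hξ', η', hη', rfl⟩ := hy
    exact ⟨ξ + ξ', add_mem hξ hξ', η + η', add_mem hη hη', by rw [smul_add]; abel⟩
  | smul r x _ hx =>
    obtain ⟨ξ, hξ, η, hη, rfl⟩ := hx
    refine ⟨r.re • ξ - r.im • η, sub_mem (𝔳.smul_mem _ hξ) (𝔳.smul_mem _ hη),
      r.im • ξ + r.re • η, add_mem (𝔳.smul_mem _ hξ) (𝔳.smul_mem _ hη), ?_⟩
    have h1 : ∀ (t : ℝ) (w : HolGerm E a), t • w = (t : ℂ) • w := fun _ _ => rfl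
    conv_lhs => rw [← Complex.re_add_im r]
    simp only [h1, smul_add, add_smul, mul_smul]
    rw [smul_comm Complex.I (r.im : ℂ) ξ, smul_comm Complex.I (r.re : ℂ) η,
      smul_smul Complex.I Complex.I, Complex.I_mul_I]
    simp only [neg_smul, one_smul, smul_neg]
    abel

theorem IsAdmissible.isRealForm {𝔳 : LieSubalgebra ℝ (HolGerm E a)} (h : IsAdmissible M a 𝔳)
    (L : C ≃ₗ[ℂ] Submodule.span ℂ (𝔳 : Set (HolGerm E a))) : IsRealForm (realFormOf 𝔳 L) := by
  intro z
  obtain ⟨ξ, hξ, η, hη, hz⟩ := exists_mem_add_I_smul_mem (L z).2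
  let ξ' : Submodule.span ℂ (𝔳 : Set (HolGerm E a)) := ⟨ξ, Submodule.subset_span hξ⟩
  let η' : Submodule.span ℂ (𝔳 : Set (HolGerm E a)) := ⟨η, Submodule.subset_span hη⟩
  refine ⟨(⟨L.symm ξ', by rw [mem_realFormOf, L.apply_symm_apply]; exact hξ⟩,
    ⟨L.symm η', by rw [mem_realFormOf, L.apply_symm_apply]; exact hη⟩), ?_, ?_⟩
  · change L.symm ξ' + Complex.I • L.symm η' = z
    apply L.injective
    rw [map_add, map_smul, L.apply_symm_apply, L.apply_symm_apply]
    exact Subtype.ext hz.symm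
  · rintro ⟨⟨x, hx⟩, ⟨y, hy⟩⟩ hxy
    change x + Complex.I • y = z at hxy
    rw [mem_realFormOf] at hx hy
    have h1 : (L x : HolGerm E a) + Complex.I • (L y : HolGerm E a) = ξ + Complex.I • η := by
      rw [← hz, ← hxy, map_add, map_smul]; rfl
    have h2 : (L x : HolGerm E a) - ξ = Complex.I • (η - (L y : HolGerm E a)) := by
      rw [smul_sub, sub_eq_sub_iff_add_eq_add, h1]; abel
    have h3 : η - (L y : HolGerm E a) = 0 := by
      refine h.totallyReal _ (sub_mem hη hy) ?_
      rw [← h2]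
      exact sub_mem hx hξ
    rw [h3, smul_zero] at h2
    have hx' : L x = ξ' := Subtype.ext (sub_eq_zero.1 h2)
    have hy' : L y = η' := Subtype.ext (sub_eq_zero.1 h3).symm
    ext
    · change x = L.symm ξ'
      rw [← hx', L.symm_apply_apply]
    · change y = L.symm η'
      rw [← hy', L.symm_apply_apply]

/-- Brings `M` into the exponential coordinates, where the graph description applies. -/
theorem isParam_preimage {P : Type*} [NormedAddCommGroup P] [NormedSpace ℝ P] {σ : P → Z}
    {r : Z → P} (h : IsParam E M a σ r) (ψ : OpenPartialHomeomorph C Z) (h0 : 0 ∈ ψ.source)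
    (hψ0 : ψ 0 = a) (hψ : ContMDiffAt 𝓘(ℂ, C) 𝓘(ℂ, E) ω ψ 0)
    (hψs : ContMDiffAt 𝓘(ℂ, E) 𝓘(ℂ, C) ω ψ.symm a) :
    IsParam C (ψ.source ∩ ψ ⁻¹' M) 0 (fun p => ψ.symm (σ p)) (fun z => r (ψ z)) := by
  have haT : a ∈ ψ.target := hψ0 ▸ ψ.map_source h0
  have hσt : ∀ᶠ p in 𝓝 0, σ p ∈ ψ.target :=
    h.smooth.continuousAt.eventually (by rw [h.map_zero]; exact ψ.open_target.mem_nhds haT)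
  have hs0 : ψ.symm a = 0 := by rw [← hψ0]; exact ψ.left_inv h0
  refine ⟨?_, ?_, ?_, ?_, ?_, ?_, ?_⟩
  · refine ContMDiffAt.comp (0 : P) (I' := 𝓘(ℝ, E)) (g := ψ.symm) ?_ h.smooth
    rw [h.map_zero]
    exact contMDiffAt_real hψs
  · rw [h.map_zero, hs0]
  · filter_upwards [hσt, h.mem] with p h1 h2
    refine ⟨ψ.map_target h1, ?_⟩
    rw [mem_preimage, ψ.right_inv h1]
    exact h2
  · refine ContMDiffAt.comp (0 : C) (I' := 𝓘(ℝ, E)) (g := r) ?_ (contMDiffAt_real hψ)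
    rw [hψ0]
    exact h.smooth_inv
  · rw [hψ0, h.inv_base]
  · have ht : Tendsto ψ (𝓝[ψ.source ∩ ψ ⁻¹' M] 0) (𝓝[M] a) := by
      refine tendsto_nhdsWithin_iff.2 ⟨?_, ?_⟩
      · have := ψ.continuousAt h0
        rw [ContinuousAt, hψ0] at this
        exact this.mono_left nhdsWithin_le_nhds
      · filter_upwards [self_mem_nhdsWithin] with z hz using hz.2
    filter_upwards [ht.eventually h.right_inv, self_mem_nhdsWithin] with z h1 h2
    rw [h1, ψ.left_inv h2.1]
  · filter_upwards [hσt, h.left_inv] with p h1 h2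
    rw [ψ.right_inv h1, h2]

/-- Every admissible subalgebra comes from the tube realization given by the exponential map. -/
theorem Admissible.exists_realization (hM : IsGenericAt E M a) (𝔳 : Admissible E M a) :
    ∃ R : TubeRealization.{u, v, w} E M a, R.Induces 𝔳 ∧ R.IsExp 𝔳 := by
  let 𝔢 := Submodule.span ℂ (𝔳.1 : Set (HolGerm E a))
  let ev : 𝔢 ≃ₗ[ℂ] E := LinearEquiv.ofBijective _ 𝔳.2.bijective_evalV
  -- A copy of `ℂⁿ` in the universe required of a realization; it is identified with `𝔢` by `L`,
  -- through the evaluation at `a`.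
  let C : Type w := ULift.{w} (Fin (Module.finrank ℂ E) → ℂ)
  have : FiniteDimensional ℂ C := Module.Finite.equiv ULift.moduleEquiv.symm
  let L : C ≃ₗ[ℂ] 𝔢 := (LinearEquiv.ofFinrankEq C E (by
    rw [ULift.moduleEquiv.finrank_eq, Module.finrank_fin_fun])).trans ev.symm
  have hL : ∀ x y, ⁅(𝔢.subtype ∘ₗ L.toLinearMap) x, (𝔢.subtype ∘ₗ L.toLinearMap) y⁆ = 0 :=
    fun x y => lie_eq_zero_of_mem_span 𝔳.2.abelian (L x).2 (L y).2
  have hbij : Function.Bijective fun z => evalV a ((𝔢.subtype ∘ₗ L.toLinearMap) z) :=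
    𝔳.2.bijective_evalV.comp L.bijective
  obtain ⟨X, ψ, r, hr, hsource, hψ0, hLX, hXan, hψan, hsan, hψX⟩ :=
    exists_straightening (𝔢.subtype ∘ₗ L.toLinearMap) hL hbij
  have h0S : (0 : C) ∈ ψ.source := by rw [hsource]; exact Metric.mem_ball_self hr
  have haT : a ∈ ψ.target := hψ0 ▸ ψ.map_source h0S
  have hs0 : ψ.symm a = 0 := by rw [← hψ0]; exact ψ.left_inv h0S
  have hψt : Tendsto ψ (𝓝 0) (𝓝 a) := by
    have := ψ.continuousAt h0S
    rwa [ContinuousAt, hψ0] at this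
  have hst : Tendsto ψ.symm (𝓝 a) (𝓝 0) := by
    have := ψ.symm.continuousAt haT
    rwa [ContinuousAt, hs0] at this
  let V := realFormOf 𝔳.1 L
  have hV : IsRealForm V := 𝔳.2.isRealForm L
  obtain ⟨m, σ, c, hσ⟩ := hM.param
  have hpar := isParam_preimage hσ ψ h0S hψ0 (hψan 0 h0S) (hsan a haT)
  set N := ψ.source ∩ ψ ⁻¹' M with hN
  have hinv : ∀ p ∈ ψ.target, ∀ v, mD ℂ E C ψ.symm p (mD ℂ C E ψ (ψ.symm p) v) = v := by
    intro p hp v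
    have hz := ψ.map_target hp
    have h1 := ψ.right_inv hp
    have := mD_left_inverse (f := ψ) (g := ψ.symm) (p := ψ.symm p)
      ((hψan _ hz).mdifferentiableAt (by simp))
      (by rw [h1]; exact (hsan p hp).mdifferentiableAt (by simp))
      (by filter_upwards [ψ.open_source.mem_nhds hz] with q hq using ψ.left_inv hq) v
    rwa [h1] at this
  have hdX : ∀ p ∈ ψ.target, ∀ x, mD ℂ E C ψ.symm p (val (X x) p) = x := by
    intro p hp x
    have h1 := (hψX _ (ψ.map_target hp)).2 x
    rw [ψ.right_inv hp] at h1
    rw [← h1]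
    exact hinv p hp x
  have htN : Tendsto ψ (𝓝[N] 0) (𝓝[M] a) :=
    tendsto_nhdsWithin_iff.2 ⟨hψt.mono_left nhdsWithin_le_nhds,
      eventually_nhdsWithin_of_forall fun z hz => hz.2⟩
  -- For `x ∈ V` the field `X x` is tangent to `M` and becomes the constant field `x` under `ψ⁻¹`,
  -- so `x` is tangent to `N` at all its points near `0`.
  have hT : ∀ x ∈ V, ∀ᶠ z in 𝓝[N] 0, x ∈ Tan C N z := by
    intro x hx
    have hx' : ∀ᶠ p in 𝓝[M] a, val (X x) p ∈ Tan E M p := by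
      filter_upwards [𝔳.2.mem_Tan hx, (hLX x).filter_mono nhdsWithin_le_nhds] with p h1 h2
      have : val (X x) p = val (L x : HolGerm E a).rep p := h2.symm
      rwa [this]
    filter_upwards [htN.eventually hx', self_mem_nhdsWithin] with z h1 h2
    have hp := ψ.map_source h2.1
    have h3 : ∀ᶠ q in 𝓝[M] (ψ z), ψ.symm q ∈ N := by
      filter_upwards [mem_nhdsWithin_of_mem_nhds (ψ.open_target.mem_nhds hp),
        self_mem_nhdsWithin] with q hq hqM
      exact ⟨ψ.map_target hq, by rwa [mem_preimage, ψ.right_inv hq]⟩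
    have hd := (hsan _ hp).mdifferentiableAt (by simp)
    have h4 := mD_mem_Tan (mdifferentiableAt_real hd) h3 h1
    rwa [mD_real_apply hd, hdX _ hp, ψ.left_inv h2.1] at h4
  obtain ⟨F, hF, hFc, h0F, hNF⟩ := exists_tube_of_param hV hpar hT
  have hmaps : ∀ᶠ p in 𝓝[M] a, ψ.symm p ∈ tube V F := by
    filter_upwards [(hst.eventually hNF).filter_mono nhdsWithin_le_nhds, self_mem_nhdsWithin,
      mem_nhdsWithin_of_mem_nhds (ψ.open_target.mem_nhds haT)] with p h1 h2 h3
    exact h1.1 ⟨ψ.map_target h3, by rwa [mem_preimage, ψ.right_inv h3]⟩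
  have hmaps' : ∀ᶠ z in 𝓝[tube V F] 0, ψ z ∈ M := by
    filter_upwards [hNF.filter_mono nhdsWithin_le_nhds, self_mem_nhdsWithin] with z h1 h2
    exact (h1.2 h2).2
  have hiso : IsCRIsoGerm E C M a (tube V F) 0 ψ.symm := by
    refine ⟨hs0, isCRMapGerm_of_holomorphic (hsan a haT) hmaps, ψ,
      isCRMapGerm_of_holomorphic (hψan 0 h0S) hmaps', ?_, ?_⟩
    · filter_upwards [mem_nhdsWithin_of_mem_nhds (ψ.open_target.mem_nhds haT)] with p hp
        using ψ.right_inv hp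
    · filter_upwards [mem_nhdsWithin_of_mem_nhds (ψ.open_source.mem_nhds h0S)] with z hz
        using ψ.left_inv hz
  let R : TubeRealization.{u, v, w} E M a :=
    { C := C
      V := V
      realForm := hV
      F := F
      submanifold := hF
      connected := hFc
      c := 0
      c_mem := h0F
      φ := ψ.symm
      isCRIso := hiso }
  have hind : ∀ x, ∀ᶠ p in 𝓝[M] a, mD ℝ E C ψ.symm p (val (L x : HolGerm E a).rep p) = x := by
    intro x
    filter_upwards [(hLX x).filter_mono nhdsWithin_le_nhds,
      mem_nhdsWithin_of_mem_nhds (ψ.open_target.mem_nhds haT)] with p h1 h2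
    have : val (L x : HolGerm E a).rep p = val (X x) p := h1
    rw [this, mD_real_apply ((hsan p h2).mdifferentiableAt (by simp)), hdX p h2]
  refine ⟨R, TubeRealization.induces_iff.2 ⟨fun ξ hξ => ?_, fun x hx => ⟨L x, hx, hind x⟩⟩,
    rfl, L, X, ψ, fun z => Iff.rfl, hLX, fun z p hp => hXan p hp z, h0S, hψ0,
    fun z hz => (hψan z hz).contMDiffWithinAt, fun p hp => (hsan p hp).contMDiffWithinAt, ?_,
    Eventually.of_forall fun _ => rfl⟩
  · have h1 := hind (L.symm ⟨ξ, Submodule.subset_span hξ⟩)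
    refine ⟨L.symm ⟨ξ, Submodule.subset_span hξ⟩, ?_, ?_⟩
    · change (L (L.symm ⟨ξ, Submodule.subset_span hξ⟩) : HolGerm E a) ∈ 𝔳.1
      rw [L.apply_symm_apply]
      exact hξ
    · rw [L.apply_symm_apply] at h1
      exact h1
  · intro z hz
    have hmem : ∀ t ∈ Icc (0 : ℝ) 1, t • z ∈ ψ.source := fun t ht => by
      rw [hsource, mem_ball_zero_iff] at hz ⊢
      rw [norm_smul, Real.norm_of_nonneg ht.1]
      exact (mul_le_of_le_one_left (norm_nonneg _) ht.2).trans_lt hz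
    -- `dψ` maps the constant field `z` to `X z`, hence the segment `t z` to an integral curve of `X
    -- z`, which reaches `ψ z` at time `1`.
    refine ⟨fun t => ψ (t • z), by simp [hψ0], by simp, fun t ht => ψ.map_source (hmem t ht), ?_⟩
    intro t ht
    have hd := (hψan _ (hmem t ht)).mdifferentiableAt (by simp)
    have h1 : HasMFDerivAt 𝓘(ℝ, ℝ) 𝓘(ℝ, C) (fun t : ℝ => t • z) t
        ((1 : ℝ →L[ℝ] ℝ).smulRight z) :=
      hasMFDerivAt_curve_iff.2 (by simpa using (hasDerivAt_id t).smul_const z)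
    have h2 := (hasMFDerivAt_mD (mdifferentiableAt_real hd)).comp t h1
    have h3 : (mD ℝ C E ψ (t • z)).comp ((1 : ℝ →L[ℝ] ℝ).smulRight z) =
        (1 : ℝ →L[ℝ] ℝ).smulRight (val (X z) (ψ (t • z))) := by
      rw [comp_smulRight_one, mD_real_apply hd, (hψX _ (hmem t ht)).2]
    exact (hasMFDerivAt_of_eq h2 h3).hasMFDerivWithinAt

end Realize

/-! ### The bijection of classes -/

section Bijection

variable {E : Type v} [NormedAddCommGroup E] [NormedSpace ℂ E] [FiniteDimensional ℂ E]
  {Z : Type u} [TopologicalSpace Z] [ChartedSpace E Z] [IsManifold 𝓘(ℂ, E) ω Z]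
  {M : Set Z} {a : Z}

/-- Affine equivalence classes of realizations correspond to conjugacy classes of admissible
subalgebras. -/
theorem exists_equiv_quot (hM : IsGenericAt E M a) :
    ∃ Θ : Quot (AffEquiv.{u, v, w} E M a) ≃ Quot (Conjugate (E := E) M a),
      ∀ (R : TubeRealization.{u, v, w} E M a) (𝔳 : Admissible E M a),
        R.Induces 𝔳 → Θ (Quot.mk _ R) = Quot.mk _ 𝔳 := by
  choose f hf hfu using fun R : TubeRealization.{u, v, w} E M a => R.existsUnique_induces hM
  let θ : Quot (AffEquiv.{u, v, w} E M a) → Quot (Conjugate (E := E) M a) :=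
    Quot.map f fun R R' h => h.conjugate hM.mem (hf R) (hf R')
  have hθ : ∀ R 𝔳, R.Induces 𝔳 → θ (Quot.mk _ R) = Quot.mk _ 𝔳 := fun R 𝔳 h =>
    congrArg (Quot.mk _) (hfu R 𝔳 h).symm
  have hinj : Function.Injective θ := by
    rintro ⟨R⟩ ⟨R'⟩ h
    refine Quot.sound ?_
    -- Equality in `Quot` only yields the generated equivalence relation, which is conjugacy itself
    -- since conjugacy is already one.
    have h1 : Conjugate M a (f R) (f R') := by
      have := Quot.eqvGen_exact h
      rwa [(equivalence_conjugate hM.mem).eqvGen_eq] at this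
    exact h1.affEquiv hM (hf R) (hf R')
  have hsurj : Function.Surjective θ := by
    rintro ⟨𝔳⟩
    obtain ⟨R, hR, -⟩ := Admissible.exists_realization.{u, v, w} hM 𝔳
    exact ⟨Quot.mk _ R, hθ R 𝔳 hR⟩
  exact ⟨Equiv.ofBijective θ ⟨hinj, hsurj⟩, hθ⟩

end Bijection

end CRTube

theorem mainTheorem2
    {E : Type v} [NormedAddCommGroup E] [NormedSpace ℂ E] [FiniteDimensional ℂ E]
    {Z : Type u} [TopologicalSpace Z] [T2Space Z] [ChartedSpace E Z] [IsManifold 𝓘(ℂ, E) ω Z]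
    (M : Set Z) (hM : CRTube.IsGenericSubmanifold E M) (a : Z) (ha : a ∈ M) :
    Equivalence (CRTube.AffEquiv.{u, v, w} E M a) ∧
    Equivalence (CRTube.Conjugate (E := E) M a) ∧
    (∀ R : CRTube.TubeRealization.{u, v, w} E M a,
      ∃! 𝔳 : CRTube.Admissible E M a, R.Induces 𝔳) ∧
    (∃ Θ : Quot (CRTube.AffEquiv.{u, v, w} E M a) ≃ Quot (CRTube.Conjugate (E := E) M a),
      ∀ (R : CRTube.TubeRealization.{u, v, w} E M a) (𝔳 : CRTube.Admissible E M a),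
        R.Induces 𝔳 → Θ (Quot.mk _ R) = Quot.mk _ 𝔳) ∧
    ∀ 𝔳 : CRTube.Admissible E M a, ∃ R : CRTube.TubeRealization.{u, v, w} E M a,
      R.Induces 𝔳 ∧ R.IsExp 𝔳 := by
  have hG := hM.isGenericAt ha
  exact ⟨CRTube.equivalence_affEquiv, CRTube.equivalence_conjugate ha,
    fun R => R.existsUnique_induces hG, CRTube.exists_equiv_quot hG,
    CRTube.Admissible.exists_realization hG⟩
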